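/- **Conventions.** A *free profunctor* $P:\mathbf A\nrightarrow\mathbf B$ between finite groupoids is a family of finite sets $P_{b,a}$ ($a\in\mathbf A$, $b\in\mathbf B$) with actions $(f,x,g)\mapsto f.x.g\in P_{b',a'}$ for $f:a\to a'$, $x\in P_{b,a}$, $g:b'\to b$, satisfying $\mathrm{id}.x.\mathrm{id}=x$ and $(f'f).x.(gg')=f'.(f.x.g).g'$, such that the left and the right action are free ($f.x=f'.x\Rightarrow f=f'$ and $x.g=x.g'\Rightarrow g=g'$). A *protransformation* $\sigma:P\Rightarrow P'$ is a family of functions $\sigma:P_{b,a}\times P'_{b,a}\to\mathbb N$ with $\sigma(f.p.g,f.p'.g)=\sigma(p,p')$. $\mathbf{GAf}$ is the dagger bicategory of finite groupoids, free profunctors and protransformations, with vertical composition $(\tau\sigma)(p,r)=\sum_q\sigma(p,q)\tau(q,r)$, composition of profunctors $(S\circ P)_{c,a}=\bigl(\coprod_b P_{b,a}\times S_{c,b}\bigr)/\bigl((x.f,y)\sim(x,f.y)\bigr)$, with classes written $[p,s]$, identity profunctors $\mathrm{id}_{\mathbf A}=(\mathrm{Hom}(b,a))_{b,a}$, horizontal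 composition $(\tau\circ\sigma)([s,t],[s',t'])=\sum_{f:b\to b'}\sigma(s,s'.f)\,\tau(f.t,t')$ (for $s\in S_{b,a}$, $t\in T_{c,b}$, $s'\in S'_{b',a}$, $t'\in T'_{c,b'}$), and dagger $\sigma^\dagger(q,p)=\sigma(p,q)$. $\mathbf{C^*Alg}$ is the dagger bicategory of finite-dimensional unital C*-algebras, finite-dimensional Hilbert bimodules and intertwiners. Here a Hilbert bimodule from $A$ to $B$ is a unital $A$-$B$-bimodule $E$ with a positive definite $B$-valued inner product $\langle\cdot,\cdot\rangle$ that is right $B$-linear in the second variable, satisfies $\langle x,y\rangle^*=\langle y,x\rangle$ and $\langle ax,y\rangle=\langle x,a^*y\rangle$; the composite of $E:A\to B$ and $F:B\to C$ is the tensor product $E\otimes_BF$ with $\langle x\otimes y,x'\otimes y'\rangle=\langle y,\langle x,x'\rangle y'\rangle$; the identity on $B$ is $B$ with $\langle x,y\rangle=x^*y$; the dagger of an intertwiner is its adjoint, $\langle Sx,y\rangle=\langle x,S^\dagger y\rangle$. A *dagger pseudofunctor* between dagger bicategories is a pseudofunctor $F$ with $F(\sigma^\dagger)=F(\sigma)^\dagger$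 on 2-morphisms and with unitary coherence isomorphisms. *Quantization* $Q$ is given by the following data. * On a finite groupoid $\mathbf A$: $Q(\mathbf A)=\mathbb C\mathbf A$, the groupoid C*-algebra, i.e. the vector space freely generated by the morphisms of $\mathbf A$ with $f\star g=fg$ if $f,g$ are composable and $f\star g=0$ otherwise, and $f^*=f^{-1}$. * On a free profunctor $P:\mathbf A\nrightarrow\mathbf B$: $Q(P)$ is the $\mathbb C\mathbf A$-$\mathbb C\mathbf B$-bimodule $\bigoplus_{b,a}\mathbb CP_{b,a}$, with the linear extensions of the actions of the morphisms (zero where the action is not defined) and with inner product determined by $\langle p,p.g\rangle=g$ and $\langle p,p'\rangle=0$ if $p'$ is not of the form $p.g$. * On a protransformation $\sigma:P\Rightarrow P'$: $Q(\sigma)$ is the intertwiner with $Q(\sigma)(p)=\sum_{q\in P'_{b,a}}\sigma(p,q)\,q$ for $p\in P_{b,a}$. **Theorem.** These data define a dagger pseudofunctor $Q:\mathbf{GAf}\to\mathbf{C^*Alg}$: there is a dagger pseudofunctor whose values on objects, morphisms and 2-morphisms are those of $Q$. Its coherence isomorphisms can be chosen to be the unitaries $Q(P)\otimes_{\mathbb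 C\mathbf B}Q(S)\cong Q(S\circ P)$ with $p\otimes s\mapsto[p,s]$ for $p\in P_{b,a}$, $s\in S_{c,b}$, and $Q(\mathrm{id}_{\mathbf A})\cong\mathbb C\mathbf A$ with $f\mapsto f$. Moreover, for every dagger pseudofunctor $R:\mathbf{C^*Alg}\to\mathbf K$ into a dagger bicategory $\mathbf K$ (for instance, the representation pseudofunctor $\mathrm{Rep}:\mathbf{C^*Alg}\to\mathbf{2Hilb}$), the composite $R\circ Q:\mathbf{GAf}\to\mathbf K$ is a dagger pseudofunctor. -/

import Mathlib

open CategoryTheory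
open scoped BigOperators TensorProduct ComplexConjugate Bicategory

universe u

namespace GroupoidQuantization

noncomputable section

/-! ### Finite groupoids, free profunctors, protransformations -/

/-- A finite groupoid: finitely many objects and finitely many morphisms. -/
class FiniteGroupoid (A : Type u) extends Groupoid.{u} A where
  finite_obj : Finite A
  finite_hom : ∀ a b : A, Finite (a ⟶ b)

instance (A : Type u) [FiniteGroupoid A] : Fintype A :=
  @Fintype.ofFinite A FiniteGroupoid.finite_obj

instance {A : Type u} [FiniteGroupoid A] (a b : A) : Fintype (a ⟶ b) :=
  @Fintype.ofFinite _ (FiniteGroupoid.finite_hom a b)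

/-- A free profunctor from `A` to `B`: a functor `Bᵒᵖ × A → FinSet`, i.e. a family of finite sets
`P.obj a b` (usually written `P_{b,a}`) on which the morphisms of `A` act covariantly from the left
and the morphisms of `B` act contravariantly from the right (`P.map f g x` is `f.x.g`), such that
both actions are free. -/
structure FreeProfunctor (A B : Type u) [FiniteGroupoid A] [FiniteGroupoid B] extends
    ProfunctorCore.{u} A B where
  finite : ∀ a b, Finite (obj a b)
  left_free : ∀ {a a' : A} {b : B} (f f' : a ⟶ a') (x : obj a b),
    map f (𝟙 b) x = map f' (𝟙 b) x → f = f'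
  right_free : ∀ {a : A} {b b' : B} (g g' : b' ⟶ b) (x : obj a b),
    map (𝟙 a) g x = map (𝟙 a) g' x → g = g'

namespace FreeProfunctor

variable {A B C D : Type u} [FiniteGroupoid A] [FiniteGroupoid B] [FiniteGroupoid C]
  [FiniteGroupoid D]

instance (P : FreeProfunctor A B) (a : A) (b : B) : Fintype (P.obj a b) :=
  @Fintype.ofFinite _ (P.finite a b)

/-- The left action `f.x`. -/
def l (P : FreeProfunctor A B) {a a' : A} {b : B} (f : a ⟶ a') (x : P.obj a b) : P.obj a' b :=
  P.map f (𝟙 b) x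

/-- The right action `x.g`. -/
def r (P : FreeProfunctor A B) {a : A} {b b' : B} (x : P.obj a b) (g : b' ⟶ b) : P.obj a b' :=
  P.map (𝟙 a) g x

section actions

variable (P : FreeProfunctor A B) {a a' a'' : A} {b b' b'' : B}

lemma map_map (f : a ⟶ a') (f' : a' ⟶ a'') (g : b' ⟶ b) (g' : b'' ⟶ b') (x : P.obj a b) :
    P.map f' g' (P.map f g x) = P.map (f ≫ f') (g' ≫ g) x := by
  rw [P.map_comp]; rfl

@[simp] lemma map_id_id (x : P.obj a b) : P.map (𝟙 a) (𝟙 b) x = x := by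
  rw [P.map_id]; rfl

@[simp] lemma l_id (x : P.obj a b) : P.l (𝟙 a) x = x := P.map_id_id x

@[simp] lemma r_id (x : P.obj a b) : P.r x (𝟙 b) = x := P.map_id_id x

lemma l_l (f : a ⟶ a') (f' : a' ⟶ a'') (x : P.obj a b) :
    P.l f' (P.l f x) = P.l (f ≫ f') x := by
  rw [l, l, map_map, Category.comp_id]; rfl

lemma r_r (g : b' ⟶ b) (g' : b'' ⟶ b') (x : P.obj a b) :
    P.r (P.r x g) g' = P.r x (g' ≫ g) := by
  rw [r, r, map_map, Category.comp_id]; rfl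

lemma l_r (f : a ⟶ a') (g : b' ⟶ b) (x : P.obj a b) :
    P.l f (P.r x g) = P.r (P.l f x) g := by
  simp [l, r, map_map, -ProfunctorCore.map_comp]

lemma map_eq (f : a ⟶ a') (g : b' ⟶ b) (x : P.obj a b) :
    P.map f g x = P.r (P.l f x) g := by
  simp [l, r, map_map, -ProfunctorCore.map_comp]

end actions

/-- The identity profunctor `(a, b) ↦ Hom(b, a)`, on which morphisms act by composition. -/
def id (A : Type u) [FiniteGroupoid A] : FreeProfunctor A A where
  obj a b := b ⟶ a
  map f g := ↾fun h => g ≫ h ≫ f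
  map_id := by intros; ext; simp
  map_comp := by intros; ext; simp
  finite a b := FiniteGroupoid.finite_hom b a
  left_free f f' x h := by
    simpa [cancel_epi] using h
  right_free g g' x h := by
    simpa [cancel_mono] using h

/-- A morphism as an element of the identity profunctor. -/
def ofHom {a b : A} (f : b ⟶ a) : (id A).obj a b := f

/-- An element of the identity profunctor as a morphism. -/
def toHom {a b : A} (x : (id A).obj a b) : b ⟶ a := x

@[simp] lemma toHom_ofHom {a b : A} (f : b ⟶ a) : toHom (ofHom f) = f := rfl

@[simp] lemma ofHom_toHom {a b : A} (x : (id A).obj a b) : ofHom (toHom x) = x := rfl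

lemma toHom_injective {a b : A} {x y : (id A).obj a b} (h : toHom x = toHom y) : x = y := h

@[simp] lemma toHom_l {a a' b : A} (f : a ⟶ a') (x : (id A).obj a b) :
    toHom ((id A).l f x) = toHom x ≫ f :=
  (Category.id_comp _ : 𝟙 b ≫ toHom x ≫ f = toHom x ≫ f)

@[simp] lemma toHom_r {a b b' : A} (g : b' ⟶ b) (x : (id A).obj a b) :
    toHom ((id A).r x g) = g ≫ toHom x :=
  congrArg (g ≫ ·) (Category.comp_id (toHom x))

/-- The equivalence relation `(x.f, y) ∼ (x, f.y)` on `∐_b P_{b,a} × Q_{c,b}`. -/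
def compSetoid (P : FreeProfunctor A B) (Q : FreeProfunctor B C) (a : A) (c : C) :
    Setoid (Σ b : B, P.obj a b × Q.obj b c) where
  r x y := ∃ f : x.1 ⟶ y.1, x.2.1 = P.r y.2.1 f ∧ Q.l f x.2.2 = y.2.2
  iseqv :=
    { refl := fun x => ⟨𝟙 _, by simp, by simp⟩
      symm := by
        rintro x y ⟨f, h₁, h₂⟩
        refine ⟨Groupoid.inv f, ?_, ?_⟩
        · rw [h₁, r_r]; simp
        · rw [← h₂, l_l]; simp
      trans := by
        rintro x y z ⟨f, h₁, h₂⟩ ⟨g, h₃, h₄⟩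
        refine ⟨f ≫ g, ?_, ?_⟩
        · rw [h₁, h₃, r_r]
        · rw [← h₄, ← h₂, l_l] }

/-- The set `∐_b P_{b,a} × Q_{c,b} / ∼`. -/
def CompObj (P : FreeProfunctor A B) (Q : FreeProfunctor B C) (a : A) (c : C) : Type u :=
  Quotient (compSetoid P Q a c)

/-- The action on the composite: `f.[p, q].g = [f.p, q.g]`. -/
def compMap (P : FreeProfunctor A B) (Q : FreeProfunctor B C) {a a' : A} {c c' : C}
    (f : a ⟶ a') (g : c' ⟶ c) : CompObj P Q a c → CompObj P Q a' c' :=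
  Quotient.map' (fun x => ⟨x.1, P.l f x.2.1, Q.r x.2.2 g⟩) (by
    rintro x y ⟨h, h₁, h₂⟩
    exact ⟨h, by simp only [h₁, l_r], by simp only [← h₂, l_r]⟩)

/-- The composite `Q ∘ P` of free profunctors `P : A ⇸ B` and `Q : B ⇸ C`. -/
def comp (P : FreeProfunctor A B) (Q : FreeProfunctor B C) : FreeProfunctor A C where
  obj a c := CompObj P Q a c
  map f g := ↾(compMap P Q f g)
  map_id a c := by
    ext x
    induction x using Quotient.ind with
    | _ x =>
      change Quotient.mk _ _ = Quotient.mk _ _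
      simp
  map_comp f f' g g' := by
    ext x
    induction x using Quotient.ind with
    | _ x =>
      change Quotient.mk _ _ = Quotient.mk _ _
      simp [l_l, r_r]
  finite a c := Quotient.finite _
  left_free f f' x h := by
    induction x using Quotient.ind with
    | _ x =>
      obtain ⟨b, p, q⟩ := x
      obtain ⟨g, h₁, h₂⟩ := Quotient.exact h
      simp only [r_id] at g h₁ h₂
      have : g = 𝟙 b := Q.left_free g (𝟙 b) q (h₂.trans (Q.l_id q).symm)
      subst this
      rw [r_id] at h₁
      exact P.left_free f f' p h₁
  right_free g g' x h := by
    induction x using Quotient.ind with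
    | _ x =>
      obtain ⟨b, p, q⟩ := x
      obtain ⟨k, h₁, h₂⟩ := Quotient.exact h
      simp only [l_id] at k h₁ h₂
      have : k = 𝟙 b := P.right_free k (𝟙 b) p (h₁.symm.trans (P.r_id p).symm)
      subst this
      rw [l_id] at h₂
      exact Q.right_free g g' q h₂

/-- The class `[p, q]`. -/
def cls (P : FreeProfunctor A B) (Q : FreeProfunctor B C) {a : A} {b : B} {c : C}
    (p : P.obj a b) (q : Q.obj b c) : (comp P Q).obj a c :=
  Quotient.mk (compSetoid P Q a c) ⟨b, p, q⟩

lemma cls_eq_cls_iff (P : FreeProfunctor A B) (Q : FreeProfunctor B C) {a : A} {b b' : B} {c : C}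
    {p : P.obj a b} {q : Q.obj b c} {p' : P.obj a b'} {q' : Q.obj b' c} :
    cls P Q p q = cls P Q p' q' ↔ ∃ f : b ⟶ b', p = P.r p' f ∧ Q.l f q = q' :=
  ⟨fun h => Quotient.exact h, fun h => Quotient.sound h⟩

lemma cls_r (P : FreeProfunctor A B) (Q : FreeProfunctor B C) {a : A} {b b' : B} {c : C}
    (p : P.obj a b') (f : b ⟶ b') (q : Q.obj b c) :
    cls P Q (P.r p f) q = cls P Q p (Q.l f q) :=
  (cls_eq_cls_iff P Q).2 ⟨f, rfl, rfl⟩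

lemma comp_ind {P : FreeProfunctor A B} {Q : FreeProfunctor B C} {a : A} {c : C}
    {motive : (comp P Q).obj a c → Prop}
    (h : ∀ (b : B) (p : P.obj a b) (q : Q.obj b c), motive (cls P Q p q)) (x) : motive x :=
  Quotient.ind (fun x => h x.1 x.2.1 x.2.2) x

lemma compMap_cls (P : FreeProfunctor A B) (Q : FreeProfunctor B C) {a a' : A} {b : B} {c c' : C}
    (f : a ⟶ a') (g : c' ⟶ c) (p : P.obj a b) (q : Q.obj b c) :
    (comp P Q).map f g (cls P Q p q) = cls P Q (P.l f p) (Q.r q g) := rfl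

@[simp] lemma comp_l (P : FreeProfunctor A B) (Q : FreeProfunctor B C) {a a' : A} {b : B} {c : C}
    (f : a ⟶ a') (p : P.obj a b) (q : Q.obj b c) :
    (comp P Q).l f (cls P Q p q) = cls P Q (P.l f p) q :=
  (compMap_cls P Q f (𝟙 c) p q).trans (by rw [r_id])

@[simp] lemma comp_r (P : FreeProfunctor A B) (Q : FreeProfunctor B C) {a : A} {b : B} {c c' : C}
    (g : c' ⟶ c) (p : P.obj a b) (q : Q.obj b c) :
    (comp P Q).r (cls P Q p q) g = cls P Q p (Q.r q g) :=
  (compMap_cls P Q (𝟙 a) g p q).trans (by rw [l_id])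

end FreeProfunctor

/-- A protransformation `σ : P ⇒ Q`: a natural transformation `P × Q ⇒ ℕ`, i.e. a family of
functions `P_{b,a} × Q_{b,a} → ℕ` that is invariant under the actions. -/
@[ext]
structure Protransformation {A B : Type u} [FiniteGroupoid A] [FiniteGroupoid B]
    (P Q : FreeProfunctor A B) where
  toFun : ∀ {a : A} {b : B}, P.obj a b → Q.obj a b → ℕ
  map_map : ∀ {a a' : A} {b b' : B} (f : a ⟶ a') (g : b' ⟶ b) (p : P.obj a b) (q : Q.obj a b),
    toFun (P.map f g p) (Q.map f g q) = toFun p q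

namespace Protransformation

variable {A B C D : Type u} [FiniteGroupoid A] [FiniteGroupoid B] [FiniteGroupoid C]
  [FiniteGroupoid D]

lemma ext' {P Q : FreeProfunctor A B} {σ τ : Protransformation P Q}
    (h : ∀ (a : A) (b : B) (p : P.obj a b) (q : Q.obj a b), σ.toFun p q = τ.toFun p q) : σ = τ := by
  ext a b p q; exact h a b p q

lemma l_l {P Q : FreeProfunctor A B} (σ : Protransformation P Q) {a a' : A} {b : B}
    (f : a ⟶ a') (p : P.obj a b) (q : Q.obj a b) : σ.toFun (P.l f p) (Q.l f q) = σ.toFun p q :=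
  σ.map_map f (𝟙 b) p q

lemma r_r {P Q : FreeProfunctor A B} (σ : Protransformation P Q) {a : A} {b b' : B}
    (g : b' ⟶ b) (p : P.obj a b) (q : Q.obj a b) : σ.toFun (P.r p g) (Q.r q g) = σ.toFun p q :=
  σ.map_map (𝟙 a) g p q

/-- A protransformation from invariance under the left and the right action. -/
def ofActions {P Q : FreeProfunctor A B}
    (s : ∀ {a : A} {b : B}, P.obj a b → Q.obj a b → ℕ)
    (hl : ∀ {a a' : A} {b : B} (f : a ⟶ a') (p : P.obj a b) (q : Q.obj a b),
      s (P.l f p) (Q.l f q) = s p q)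
    (hr : ∀ {a : A} {b b' : B} (g : b' ⟶ b) (p : P.obj a b) (q : Q.obj a b),
      s (P.r p g) (Q.r q g) = s p q) : Protransformation P Q where
  toFun := s
  map_map f g p q := by rw [P.map_eq, Q.map_eq, hr, hl]

/-- A natural transformation of profunctors, as a family of equivariant functions. -/
structure NatHom (P Q : FreeProfunctor A B) where
  app : ∀ {a : A} {b : B}, P.obj a b → Q.obj a b
  app_l : ∀ {a a' : A} {b : B} (f : a ⟶ a') (p : P.obj a b), app (P.l f p) = Q.l f (app p)
  app_r : ∀ {a : A} {b b' : B} (g : b' ⟶ b) (p : P.obj a b), app (P.r p g) = Q.r (app p) g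

open scoped Classical in
/-- The protransformation `δ_{φ(p), q}` of a natural transformation `φ`. -/
def graph {P Q : FreeProfunctor A B} (φ : NatHom P Q) : Protransformation P Q :=
  ofActions (fun {a b} p q => if φ.app p = q then 1 else 0)
    (fun {a a' b} f p q => by
      have : φ.app (P.l f p) = Q.l f q ↔ φ.app p = q := by
        rw [φ.app_l]
        refine ⟨fun h => ?_, fun h => by rw [h]⟩
        have := congrArg (Q.l (Groupoid.inv f)) h
        simpa [FreeProfunctor.l_l] using this
      simp only [this])
    (fun {a b b'} g p q => by
      have : φ.app (P.r p g) = Q.r q g ↔ φ.app p = q := by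
        rw [φ.app_r]
        refine ⟨fun h => ?_, fun h => by rw [h]⟩
        have := congrArg (fun x => Q.r x (Groupoid.inv g)) h
        simpa [FreeProfunctor.r_r] using this
      simp only [this])

lemma graph_apply {P Q : FreeProfunctor A B} (φ : NatHom P Q) {a : A} {b : B} (p : P.obj a b)
    (q : Q.obj a b) [Decidable (φ.app p = q)] :
    (graph φ).toFun p q = if φ.app p = q then 1 else 0 := by
  change @ite _ _ (_) _ _ = _
  congr

open scoped Classical in
/-- The identity protransformation `δ_{p,q}`. -/
def id (P : FreeProfunctor A B) : Protransformation P P :=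
  graph ⟨fun p => p, fun _ _ => rfl, fun _ _ => rfl⟩

/-- Vertical composition: `(τσ)(p, r) = ∑_q σ(p, q) τ(q, r)`. -/
def vcomp {P Q R : FreeProfunctor A B} (σ : Protransformation P Q) (τ : Protransformation Q R) :
    Protransformation P R where
  toFun {a b} p r := ∑ q : Q.obj a b, σ.toFun p q * τ.toFun q r
  map_map {a a' b b'} f g p r := by
    let e : Q.obj a b ≃ Q.obj a' b' :=
      { toFun := fun q => Q.map f g q
        invFun := fun q => Q.map (Groupoid.inv f) (Groupoid.inv g) q
        left_inv := fun q => by simp [FreeProfunctor.map_map, -ProfunctorCore.map_comp]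
        right_inv := fun q => by simp [FreeProfunctor.map_map, -ProfunctorCore.map_comp] }
    rw [← e.sum_comp]
    exact Finset.sum_congr rfl fun q _ => by
      rw [← σ.map_map f g p q, ← τ.map_map f g q r]; rfl

/-- The dagger `σ†(q, p) = σ(p, q)`. -/
def dagger {P Q : FreeProfunctor A B} (σ : Protransformation P Q) : Protransformation Q P where
  toFun q p := σ.toFun p q
  map_map f g q p := σ.map_map f g p q

/-- Horizontal composition of `σ : S ⇒ S'` and `τ : T ⇒ T'`:
`(τ ∘ σ)([s,t],[s',t']) = ∑_{f : b → b'} σ(s, s'.f) τ(f.t, t')`. -/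
def hcomp {S S' : FreeProfunctor A B} {T T' : FreeProfunctor B C}
    (σ : Protransformation S S') (τ : Protransformation T T') :
    Protransformation (S.comp T) (S'.comp T') :=
  ofActions
    (fun {a c} x y => Quotient.liftOn₂ (s₁ := FreeProfunctor.compSetoid S T a c)
      (s₂ := FreeProfunctor.compSetoid S' T' a c) x y
      (fun x y => ∑ f : x.1 ⟶ y.1, σ.toFun x.2.1 (S'.r y.2.1 f) * τ.toFun (T.l f x.2.2) y.2.2)
      (by
        rintro ⟨b, s, t⟩ ⟨b', s', t'⟩ ⟨d, v, w⟩ ⟨d', v', w'⟩ ⟨g, h₁, h₂⟩ ⟨g', h₃, h₄⟩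
        dsimp only at g g' h₁ h₂ h₃ h₄ ⊢
        subst h₁ h₂ h₃ h₄
        let e : (d ⟶ d') ≃ (b ⟶ b') :=
          { toFun := fun f => g ≫ f ≫ Groupoid.inv g'
            invFun := fun f => Groupoid.inv g ≫ f ≫ g'
            left_inv := fun f => by simp
            right_inv := fun f => by simp }
        rw [← e.sum_comp]
        refine Finset.sum_congr rfl fun f _ => ?_
        have h₁ : S'.r (S'.r v' g') (e f) = S'.r (S'.r v' f) g := by
          simp [FreeProfunctor.r_r, e]
        have h₂ : T.l f (T.l g t) = T.l g' (T.l (e f) t) := by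
          simp [FreeProfunctor.l_l, e]
        rw [h₁, h₂, σ.r_r, τ.l_l]))
    (fun {a a' c} f x y => by
      induction x using FreeProfunctor.comp_ind with
      | h b s t =>
      induction y using FreeProfunctor.comp_ind with
      | h b' s' t' =>
      rw [FreeProfunctor.comp_l, FreeProfunctor.comp_l]
      refine Finset.sum_congr rfl fun g _ => ?_
      dsimp only
      rw [← FreeProfunctor.l_r, σ.l_l])
    (fun {a c c'} f x y => by
      induction x using FreeProfunctor.comp_ind with
      | h b s t =>
      induction y using FreeProfunctor.comp_ind with
      | h b' s' t' =>
      rw [FreeProfunctor.comp_r, FreeProfunctor.comp_r]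
      refine Finset.sum_congr rfl fun g _ => ?_
      dsimp only
      rw [FreeProfunctor.l_r, τ.r_r])

lemma hcomp_cls {S S' : FreeProfunctor A B} {T T' : FreeProfunctor B C}
    (σ : Protransformation S S') (τ : Protransformation T T') {a : A} {b b' : B} {c : C}
    (s : S.obj a b) (t : T.obj b c) (s' : S'.obj a b') (t' : T'.obj b' c) :
    (hcomp σ τ).toFun (FreeProfunctor.cls S T s t) (FreeProfunctor.cls S' T' s' t') =
      ∑ f : b ⟶ b', σ.toFun s (S'.r s' f) * τ.toFun (T.l f t) t' := rfl

lemma id_apply {P : FreeProfunctor A B} {a : A} {b : B} (p q : P.obj a b) [Decidable (p = q)] :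
    (id P).toFun p q = if p = q then 1 else 0 := by
  rw [id, graph_apply]

lemma id_vcomp {P Q : FreeProfunctor A B} (σ : Protransformation P Q) : vcomp (id P) σ = σ := by
  classical
  exact ext' fun a b p q => by simp [vcomp, id_apply]

lemma vcomp_id {P Q : FreeProfunctor A B} (σ : Protransformation P Q) : vcomp σ (id Q) = σ := by
  classical
  exact ext' fun a b p q => by simp [vcomp, id_apply]

lemma vcomp_assoc {P Q R S : FreeProfunctor A B} (σ : Protransformation P Q)
    (τ : Protransformation Q R) (μ : Protransformation R S) :
    vcomp (vcomp σ τ) μ = vcomp σ (vcomp τ μ) :=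
  ext' fun a b p s => by
    simp only [vcomp, Finset.sum_mul, Finset.mul_sum, mul_assoc]
    exact Finset.sum_comm

lemma graph_vcomp_apply {P Q R : FreeProfunctor A B} (φ : NatHom P Q) (σ : Protransformation Q R)
    {a : A} {b : B} (p : P.obj a b) (q : R.obj a b) :
    (vcomp (graph φ) σ).toFun p q = σ.toFun (φ.app p) q := by
  classical
  simp [vcomp, graph_apply]

lemma vcomp_graph_apply {P Q R : FreeProfunctor A B} (σ : Protransformation P Q)
    (φ : NatHom Q R) {a : A} {b : B} (hφ : Function.Injective (φ.app (a := a) (b := b)))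
    (p : P.obj a b) (q : Q.obj a b) :
    (vcomp σ (graph φ)).toFun p (φ.app q) = σ.toFun p q := by
  classical
  simp [vcomp, graph_apply, hφ.eq_iff]

open scoped Classical in
/-- By freeness, horizontal composition is a sum over the representatives at a fixed object. -/
lemma hcomp_eq_sum_fiber {S S' : FreeProfunctor A B} {T T' : FreeProfunctor B C}
    (σ : Protransformation S S') (τ : Protransformation T T') {a : A} {b : B} {c : C}
    (s : S.obj a b) (t : T.obj b c) (y : (S'.comp T').obj a c) :
    (hcomp σ τ).toFun (FreeProfunctor.cls S T s t) y =
      ∑ w : S'.obj a b × T'.obj b c, if FreeProfunctor.cls S' T' w.1 w.2 = y then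
        σ.toFun s w.1 * τ.toFun t w.2 else 0 := by
  induction y using FreeProfunctor.comp_ind with
  | h b' s' t' =>
  rw [hcomp_cls, ← Finset.sum_filter]
  refine Finset.sum_bij (fun (f : b ⟶ b') _ => (S'.r s' f, T'.l (Groupoid.inv f) t')) ?_ ?_ ?_ ?_
  · intro f _
    rw [Finset.mem_filter]
    refine ⟨Finset.mem_univ _, ?_⟩
    rw [FreeProfunctor.cls_r, FreeProfunctor.l_l]
    simp
  · intro f _ g _ h
    exact S'.right_free f g s' (Prod.ext_iff.1 h).1
  · rintro ⟨v, w⟩ h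
    rw [Finset.mem_filter] at h
    obtain ⟨f, h₁, h₂⟩ := (FreeProfunctor.cls_eq_cls_iff S' T').1 h.2
    refine ⟨f, Finset.mem_univ _, ?_⟩
    dsimp only at h₁ h₂
    rw [h₁, ← h₂, FreeProfunctor.l_l]
    simp
  · intro f _
    dsimp only
    rw [← τ.l_l (Groupoid.inv f) (T.l f t) t', FreeProfunctor.l_l]
    simp

lemma hcomp_vcomp {S S' S'' : FreeProfunctor A B} {T T' T'' : FreeProfunctor B C}
    (σ : Protransformation S S') (σ' : Protransformation S' S'')
    (τ : Protransformation T T') (τ' : Protransformation T' T'') :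
    hcomp (vcomp σ σ') (vcomp τ τ') = vcomp (hcomp σ τ) (hcomp σ' τ') := by
  classical
  refine ext' fun a c x z => ?_
  induction x using FreeProfunctor.comp_ind with
  | h b s t =>
  induction z using FreeProfunctor.comp_ind with
  | h b'' s'' t'' =>
  have key : (vcomp (hcomp σ τ) (hcomp σ' τ')).toFun (FreeProfunctor.cls S T s t)
      (FreeProfunctor.cls S'' T'' s'' t'') = ∑ w : S'.obj a b × T'.obj b c,
        σ.toFun s w.1 * τ.toFun t w.2 * (hcomp σ' τ').toFun (FreeProfunctor.cls S' T' w.1 w.2)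
          (FreeProfunctor.cls S'' T'' s'' t'') := by
    simp only [vcomp, hcomp_eq_sum_fiber σ τ, Finset.sum_mul, ite_mul, zero_mul]
    rw [Finset.sum_comm]
    refine Finset.sum_congr rfl fun w _ => ?_
    rw [Finset.sum_eq_single (FreeProfunctor.cls S' T' w.1 w.2)]
    · rw [if_pos rfl]
    · intro y _ hy
      rw [if_neg (Ne.symm hy)]
    · intro h; exact absurd (Finset.mem_univ _) h
  rw [key, hcomp_cls]
  simp only [hcomp_cls, Finset.mul_sum]
  rw [Finset.sum_comm]
  refine Finset.sum_congr rfl fun f _ => ?_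
  let e : T'.obj b c ≃ T'.obj b'' c :=
    { toFun := fun q => T'.l f q
      invFun := fun q => T'.l (Groupoid.inv f) q
      left_inv := fun q => by simp [FreeProfunctor.l_l]
      right_inv := fun q => by simp [FreeProfunctor.l_l] }
  simp only [vcomp]
  rw [← e.sum_comp, Finset.sum_mul_sum, Fintype.sum_prod_type]
  refine Finset.sum_congr rfl fun v _ => Finset.sum_congr rfl fun w _ => ?_
  have : τ.toFun (T.l f t) (e w) = τ.toFun t w := τ.l_l f t w
  rw [this]
  change _ = σ.toFun s v * τ.toFun t w * (σ'.toFun v _ * τ'.toFun (e w) t'')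
  ring

lemma hcomp_graph {S S' : FreeProfunctor A B} {T T' : FreeProfunctor B C}
    (φ : NatHom S S') (ψ : NatHom T T')
    {a : A} {b : B} {c : C} (s : S.obj a b) (t : T.obj b c) (y : (S'.comp T').obj a c)
    [Decidable (FreeProfunctor.cls S' T' (φ.app s) (ψ.app t) = y)] :
    (hcomp (graph φ) (graph ψ)).toFun (FreeProfunctor.cls S T s t) y =
      if FreeProfunctor.cls S' T' (φ.app s) (ψ.app t) = y then 1 else 0 := by
  classical
  rw [hcomp_eq_sum_fiber, Finset.sum_eq_single (φ.app s, ψ.app t)]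
  · simp [graph_apply]
  · rintro ⟨v, w⟩ _ h
    by_cases h₁ : φ.app s = v
    · by_cases h₂ : ψ.app t = w
      · exact absurd (Prod.ext h₁.symm h₂.symm) h
      · simp [graph_apply, h₂]
    · simp [graph_apply, h₁]
  · intro h; exact absurd (Finset.mem_univ _) h

lemma hcomp_id (S : FreeProfunctor A B) (T : FreeProfunctor B C) :
    hcomp (id S) (id T) = id (S.comp T) := by
  classical
  refine ext' fun a c x z => ?_
  induction x using FreeProfunctor.comp_ind with
  | h b s t => rw [id, id, hcomp_graph, id_apply]

/-- Composition of natural transformations. -/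
def NatHom.vcomp {P Q R : FreeProfunctor A B} (φ : NatHom P Q) (ψ : NatHom Q R) : NatHom P R where
  app p := ψ.app (φ.app p)
  app_l f p := by rw [φ.app_l, ψ.app_l]
  app_r g p := by rw [φ.app_r, ψ.app_r]

/-- Horizontal composition of natural transformations. -/
def NatHom.hcomp {S S' : FreeProfunctor A B} {T T' : FreeProfunctor B C} (φ : NatHom S S')
    (ψ : NatHom T T') : NatHom (S.comp T) (S'.comp T') where
  app {a c} x := Quotient.liftOn (s := FreeProfunctor.compSetoid S T a c) x
    (fun x => FreeProfunctor.cls S' T' (φ.app x.2.1) (ψ.app x.2.2)) (by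
      rintro ⟨b, p, q⟩ ⟨b', p', q'⟩ ⟨f, h₁, h₂⟩
      dsimp only at f h₁ h₂ ⊢
      subst h₁ h₂
      rw [φ.app_r, ψ.app_l, FreeProfunctor.cls_r])
  app_l f x := by
    induction x using FreeProfunctor.comp_ind with
    | h b s t =>
    rw [FreeProfunctor.comp_l]
    change FreeProfunctor.cls S' T' _ _ = (S'.comp T').l f (FreeProfunctor.cls S' T' _ _)
    rw [φ.app_l, FreeProfunctor.comp_l]
  app_r f x := by
    induction x using FreeProfunctor.comp_ind with
    | h b s t =>
    rw [FreeProfunctor.comp_r]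
    change FreeProfunctor.cls S' T' _ _ = (S'.comp T').r (FreeProfunctor.cls S' T' _ _) f
    rw [ψ.app_r, FreeProfunctor.comp_r]

lemma vcomp_graph_graph {P Q R : FreeProfunctor A B} (φ : NatHom P Q) (ψ : NatHom Q R) :
    vcomp (graph φ) (graph ψ) = graph (φ.vcomp ψ) := by
  classical
  exact ext' fun a b p q => by rw [graph_vcomp_apply, graph_apply, graph_apply]; rfl

lemma hcomp_graph_graph {S S' : FreeProfunctor A B} {T T' : FreeProfunctor B C} (φ : NatHom S S')
    (ψ : NatHom T T') : hcomp (graph φ) (graph ψ) = graph (φ.hcomp ψ) := by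
  classical
  refine ext' fun a c x z => ?_
  induction x using FreeProfunctor.comp_ind with
  | h b s t => rw [hcomp_graph, graph_apply]; rfl

lemma graph_congr {P Q : FreeProfunctor A B} {φ ψ : NatHom P Q}
    (h : ∀ (a : A) (b : B) (p : P.obj a b), φ.app p = ψ.app p) : graph φ = graph ψ := by
  classical
  exact ext' fun a b p q => by rw [graph_apply, graph_apply, h]

lemma dagger_vcomp {P Q R : FreeProfunctor A B} (σ : Protransformation P Q)
    (τ : Protransformation Q R) : dagger (vcomp σ τ) = vcomp (dagger τ) (dagger σ) :=
  ext' fun _ _ _ _ => Finset.sum_congr rfl fun _ _ => mul_comm _ _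

lemma dagger_id (P : FreeProfunctor A B) : dagger (id P) = id P := by
  classical
  exact ext' fun _ _ p q => by
    change (id P).toFun q p = (id P).toFun p q
    rw [id_apply, id_apply]; simp only [eq_comm]

lemma dagger_hcomp {S S' : FreeProfunctor A B} {T T' : FreeProfunctor B C}
    (σ : Protransformation S S') (τ : Protransformation T T') :
    dagger (hcomp σ τ) = hcomp (dagger σ) (dagger τ) := by
  refine ext' fun a c x z => ?_
  induction x using FreeProfunctor.comp_ind with
  | h b' s' t' =>
  induction z using FreeProfunctor.comp_ind with
  | h b s t =>
  change (hcomp σ τ).toFun (FreeProfunctor.cls S T s t) (FreeProfunctor.cls S' T' s' t') = _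
  rw [hcomp_cls, hcomp_cls]
  let e : (b' ⟶ b) ≃ (b ⟶ b') :=
    { toFun := fun f => Groupoid.inv f
      invFun := fun f => Groupoid.inv f
      left_inv := fun f => by simp
      right_inv := fun f => by simp }
  rw [← e.sum_comp]
  refine Finset.sum_congr rfl fun f _ => ?_
  change σ.toFun s (S'.r s' (Groupoid.inv f)) * τ.toFun (T.l (Groupoid.inv f) t) t' =
    σ.toFun (S.r s f) s' * τ.toFun t (T'.l f t')
  rw [← σ.r_r f, FreeProfunctor.r_r, ← τ.l_l f, FreeProfunctor.l_l]
  simp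

instance : Category (FreeProfunctor A B) where
  Hom P Q := Protransformation P Q
  id P := id P
  comp σ τ := vcomp σ τ
  id_comp := id_vcomp
  comp_id := vcomp_id
  assoc := vcomp_assoc

/-- A natural isomorphism of free profunctors as an invertible protransformation. -/
def graphIso {P Q : FreeProfunctor A B} (φ : NatHom P Q)
    (hφ : ∀ a b, Function.Bijective (φ.app (a := a) (b := b))) : P ≅ Q where
  hom := graph φ
  inv := dagger (graph φ)
  hom_inv_id := ext' fun a b p p' => by
    classical
    refine (graph_vcomp_apply φ _ p p').trans ?_
    refine Eq.trans ?_ (id_apply p p').symm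
    simp [dagger, graph_apply, (hφ a b).1.eq_iff, eq_comm]
  inv_hom_id := ext' fun a b q q' => by
    classical
    obtain ⟨p, rfl⟩ := (hφ a b).2 q
    obtain ⟨p', rfl⟩ := (hφ a b).2 q'
    refine (vcomp_graph_apply _ φ (hφ a b).1 _ p').trans ?_
    refine Eq.trans ?_ (id_apply _ _).symm
    simp [dagger, graph_apply, (hφ a b).1.eq_iff, eq_comm]

/-! The coherence isomorphisms `[[p,q],r] ↦ [p,[q,r]]`, `[f,p] ↦ f.p` and `[p,g] ↦ p.g`. -/

/-- `[[p,q],r] ↦ [p,[q,r]]`. -/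
def assocFun (P : FreeProfunctor A B) (Q : FreeProfunctor B C) (R : FreeProfunctor C D) (a : A)
    (d : D) (x : ((P.comp Q).comp R).obj a d) : (P.comp (Q.comp R)).obj a d :=
  Quotient.liftOn (s := FreeProfunctor.compSetoid (P.comp Q) R a d) x
    (fun x => Quotient.liftOn (s := FreeProfunctor.compSetoid P Q a x.1) x.2.1
      (fun y => FreeProfunctor.cls P (Q.comp R) y.2.1 (FreeProfunctor.cls Q R y.2.2 x.2.2))
      (by
        rintro ⟨b, p, q⟩ ⟨b', p', q'⟩ ⟨f, h₁, h₂⟩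
        dsimp only at f h₁ h₂ ⊢
        subst h₁ h₂
        rw [FreeProfunctor.cls_r, FreeProfunctor.comp_l]))
    (by
      rintro ⟨c, x, q⟩ ⟨c', x', q'⟩ ⟨f, h₁, h₂⟩
      dsimp only at f h₁ h₂ ⊢
      subst h₁ h₂
      induction x' using FreeProfunctor.comp_ind with
      | h b p' q' =>
      rw [FreeProfunctor.comp_r]
      change FreeProfunctor.cls P (Q.comp R) _ (FreeProfunctor.cls Q R _ _) =
        FreeProfunctor.cls P (Q.comp R) _ (FreeProfunctor.cls Q R _ _)
      rw [FreeProfunctor.cls_r])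

lemma assocFun_cls (P : FreeProfunctor A B) (Q : FreeProfunctor B C) (R : FreeProfunctor C D)
    {a : A} {b : B} {c : C} {d : D} (p : P.obj a b) (q : Q.obj b c) (r : R.obj c d) :
    assocFun P Q R a d (FreeProfunctor.cls (P.comp Q) R (FreeProfunctor.cls P Q p q) r) =
      FreeProfunctor.cls P (Q.comp R) p (FreeProfunctor.cls Q R q r) := rfl

lemma assocFun_bijective (P : FreeProfunctor A B) (Q : FreeProfunctor B C)
    (R : FreeProfunctor C D) (a : A) (d : D) : Function.Bijective (assocFun P Q R a d) := by
  constructor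
  · intro x y h
    induction x using FreeProfunctor.comp_ind with
    | h c x r =>
    induction x using FreeProfunctor.comp_ind with
    | h b p q =>
    induction y using FreeProfunctor.comp_ind with
    | h c' y r' =>
    induction y using FreeProfunctor.comp_ind with
    | h b' p' q' =>
    rw [assocFun_cls, assocFun_cls] at h
    obtain ⟨f, h₁, h₂⟩ := (FreeProfunctor.cls_eq_cls_iff _ _).1 h
    rw [FreeProfunctor.comp_l] at h₂
    obtain ⟨g, h₃, h₄⟩ := (FreeProfunctor.cls_eq_cls_iff _ _).1 h₂
    subst h₁ h₄
    rw [FreeProfunctor.cls_r, h₃, ← FreeProfunctor.cls_r, FreeProfunctor.comp_r]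
  · intro y
    induction y using FreeProfunctor.comp_ind with
    | h b p y =>
    induction y using FreeProfunctor.comp_ind with
    | h c q r => exact ⟨_, assocFun_cls P Q R p q r⟩

/-- `[[p,q],r] ↦ [p,[q,r]]` as a natural transformation. -/
def assocHom (P : FreeProfunctor A B) (Q : FreeProfunctor B C) (R : FreeProfunctor C D) :
    NatHom ((P.comp Q).comp R) (P.comp (Q.comp R)) where
  app {a d} x := assocFun P Q R a d x
  app_l f x := by
    induction x using FreeProfunctor.comp_ind with
    | h c x r =>
    induction x using FreeProfunctor.comp_ind with
    | h b p q => simp [assocFun_cls]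
  app_r g x := by
    induction x using FreeProfunctor.comp_ind with
    | h c x r =>
    induction x using FreeProfunctor.comp_ind with
    | h b p q => simp [assocFun_cls]

/-- The associator. -/
def assoc (P : FreeProfunctor A B) (Q : FreeProfunctor B C) (R : FreeProfunctor C D) :
    (P.comp Q).comp R ≅ P.comp (Q.comp R) :=
  graphIso (assocHom P Q R) (assocFun_bijective P Q R)

/-- `[f,p] ↦ f.p`. -/
def leftUnitFun (P : FreeProfunctor A B) (a : A) (b : B)
    (x : ((FreeProfunctor.id A).comp P).obj a b) : P.obj a b :=
  Quotient.liftOn (s := FreeProfunctor.compSetoid (FreeProfunctor.id A) P a b) x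
    (fun x => P.l (FreeProfunctor.toHom x.2.1) x.2.2)
    (by
      rintro ⟨c, f, p⟩ ⟨c', f', p'⟩ ⟨g, h₁, h₂⟩
      dsimp only at g h₁ h₂ ⊢
      subst h₁ h₂
      rw [FreeProfunctor.l_l, FreeProfunctor.toHom_r])

lemma leftUnitFun_cls (P : FreeProfunctor A B) {a a' : A} {b : B}
    (f : (FreeProfunctor.id A).obj a a') (p : P.obj a' b) :
    leftUnitFun P a b (FreeProfunctor.cls (FreeProfunctor.id A) P f p) =
      P.l (FreeProfunctor.toHom f) p := rfl

lemma leftUnitFun_bijective (P : FreeProfunctor A B) (a : A) (b : B) :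
    Function.Bijective (leftUnitFun P a b) := by
  constructor
  · intro x y h
    induction x using FreeProfunctor.comp_ind with
    | h c f p =>
    induction y using FreeProfunctor.comp_ind with
    | h c' f' p' =>
    rw [leftUnitFun_cls, leftUnitFun_cls] at h
    refine (FreeProfunctor.cls_eq_cls_iff _ _).2
      ⟨FreeProfunctor.toHom f ≫ Groupoid.inv (FreeProfunctor.toHom f'), ?_, ?_⟩
    · apply FreeProfunctor.toHom_injective
      rw [FreeProfunctor.toHom_r]; simp
    · rw [← FreeProfunctor.l_l, h, FreeProfunctor.l_l]; simp
  · intro p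
    exact ⟨FreeProfunctor.cls (FreeProfunctor.id A) P (FreeProfunctor.ofHom (𝟙 a)) p, P.l_id p⟩

/-- `[f,p] ↦ f.p` as a natural transformation. -/
def leftUnitHom (P : FreeProfunctor A B) : NatHom ((FreeProfunctor.id A).comp P) P where
  app {a b} x := leftUnitFun P a b x
  app_l f x := by
    induction x using FreeProfunctor.comp_ind with
    | h c g p => simp [leftUnitFun_cls, FreeProfunctor.l_l]
  app_r f x := by
    induction x using FreeProfunctor.comp_ind with
    | h c g p => simp [leftUnitFun_cls, FreeProfunctor.l_r]

/-- The left unitor. -/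
def leftUnitor (P : FreeProfunctor A B) : (FreeProfunctor.id A).comp P ≅ P :=
  graphIso (leftUnitHom P) (leftUnitFun_bijective P)

/-- `[p,g] ↦ p.g`. -/
def rightUnitFun (P : FreeProfunctor A B) (a : A) (b : B)
    (x : (P.comp (FreeProfunctor.id B)).obj a b) : P.obj a b :=
  Quotient.liftOn (s := FreeProfunctor.compSetoid P (FreeProfunctor.id B) a b) x
    (fun x => P.r x.2.1 (FreeProfunctor.toHom x.2.2))
    (by
      rintro ⟨c, p, f⟩ ⟨c', p', f'⟩ ⟨g, h₁, h₂⟩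
      dsimp only at g h₁ h₂ ⊢
      subst h₁ h₂
      rw [FreeProfunctor.r_r, FreeProfunctor.toHom_l])

lemma rightUnitFun_cls (P : FreeProfunctor A B) {a : A} {b b' : B} (p : P.obj a b')
    (g : (FreeProfunctor.id B).obj b' b) :
    rightUnitFun P a b (FreeProfunctor.cls P (FreeProfunctor.id B) p g) =
      P.r p (FreeProfunctor.toHom g) := rfl

lemma rightUnitFun_bijective (P : FreeProfunctor A B) (a : A) (b : B) :
    Function.Bijective (rightUnitFun P a b) := by
  constructor
  · intro x y h
    induction x using FreeProfunctor.comp_ind with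
    | h c p f =>
    induction y using FreeProfunctor.comp_ind with
    | h c' p' f' =>
    rw [rightUnitFun_cls, rightUnitFun_cls] at h
    refine (FreeProfunctor.cls_eq_cls_iff _ _).2
      ⟨Groupoid.inv (FreeProfunctor.toHom f) ≫ FreeProfunctor.toHom f', ?_, ?_⟩
    · rw [← FreeProfunctor.r_r, ← h, FreeProfunctor.r_r]; simp
    · apply FreeProfunctor.toHom_injective
      rw [FreeProfunctor.toHom_l]; simp
  · intro p
    exact ⟨FreeProfunctor.cls P (FreeProfunctor.id B) p (FreeProfunctor.ofHom (𝟙 b)), P.r_id p⟩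

/-- `[p,g] ↦ p.g` as a natural transformation. -/
def rightUnitHom (P : FreeProfunctor A B) : NatHom (P.comp (FreeProfunctor.id B)) P where
  app {a b} x := rightUnitFun P a b x
  app_l f x := by
    induction x using FreeProfunctor.comp_ind with
    | h c g p => simp [rightUnitFun_cls, FreeProfunctor.l_r]
  app_r f x := by
    induction x using FreeProfunctor.comp_ind with
    | h c g p => simp [rightUnitFun_cls, FreeProfunctor.r_r]

/-- The right unitor. -/
def rightUnitor (P : FreeProfunctor A B) : P.comp (FreeProfunctor.id B) ≅ P :=
  graphIso (rightUnitHom P) (rightUnitFun_bijective P)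

lemma assoc_naturality {P P' : FreeProfunctor A B} {Q Q' : FreeProfunctor B C}
    {R R' : FreeProfunctor C D} (σ : Protransformation P P') (τ : Protransformation Q Q')
    (μ : Protransformation R R') :
    vcomp (hcomp (hcomp σ τ) μ) (assoc P' Q' R').hom =
      vcomp (assoc P Q R).hom (hcomp σ (hcomp τ μ)) := by
  refine ext' fun a d x y => ?_
  obtain ⟨y, rfl⟩ := (assocFun_bijective P' Q' R' a d).2 y
  refine (vcomp_graph_apply _ (assocHom P' Q' R') (assocFun_bijective P' Q' R' a d).1 x y).trans
    (Eq.trans ?_ (graph_vcomp_apply (assocHom P Q R) _ x _).symm)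
  change _ = (hcomp σ (hcomp τ μ)).toFun (assocFun P Q R a d x) (assocFun P' Q' R' a d y)
  induction x using FreeProfunctor.comp_ind with
  | h c x r =>
  induction x using FreeProfunctor.comp_ind with
  | h b p q =>
  induction y using FreeProfunctor.comp_ind with
  | h c' y r' =>
  induction y using FreeProfunctor.comp_ind with
  | h b' p' q' =>
  rw [assocFun_cls, assocFun_cls, hcomp_cls, hcomp_cls]
  simp only [FreeProfunctor.comp_r, FreeProfunctor.comp_l, hcomp_cls, Finset.sum_mul,
    Finset.mul_sum, mul_assoc]
  exact Finset.sum_comm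

lemma leftUnitor_naturality {P P' : FreeProfunctor A B} (σ : Protransformation P P') :
    vcomp (hcomp (id (FreeProfunctor.id A)) σ) (leftUnitor P').hom =
      vcomp (leftUnitor P).hom σ := by
  classical
  refine ext' fun a b x y => ?_
  have hy : y = leftUnitFun P' a b (FreeProfunctor.cls (FreeProfunctor.id A) P'
      (FreeProfunctor.ofHom (𝟙 a)) y) :=
    (P'.l_id y).symm
  rw [hy]
  refine (vcomp_graph_apply (hcomp (id (FreeProfunctor.id A)) σ) (leftUnitHom P')
    (leftUnitFun_bijective P' a b).1 x (FreeProfunctor.cls _ _ (FreeProfunctor.ofHom (𝟙 a)) y)).trans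
    (Eq.trans ?_ (graph_vcomp_apply (leftUnitHom P) σ x _).symm)
  change _ = σ.toFun (leftUnitFun P a b x) _
  rw [← hy]
  induction x using FreeProfunctor.comp_ind with
  | h c f p =>
  rw [hcomp_cls, leftUnitFun_cls]
  simp only [id_apply]
  rw [Finset.sum_eq_single (FreeProfunctor.toHom f)]
  · rw [if_pos (FreeProfunctor.toHom_injective (by simp)), one_mul]
  · intro g _ hg
    rw [if_neg (fun h => hg (by rw [h]; simp)), zero_mul]
  · intro h; exact absurd (Finset.mem_univ _) h

lemma rightUnitor_naturality {P P' : FreeProfunctor A B} (σ : Protransformation P P') :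
    vcomp (hcomp σ (id (FreeProfunctor.id B))) (rightUnitor P').hom =
      vcomp (rightUnitor P).hom σ := by
  classical
  refine ext' fun a b x y => ?_
  have hy : y = rightUnitFun P' a b (FreeProfunctor.cls P' (FreeProfunctor.id B) y
      (FreeProfunctor.ofHom (𝟙 b))) :=
    (P'.r_id y).symm
  rw [hy]
  refine (vcomp_graph_apply (hcomp σ (id (FreeProfunctor.id B))) (rightUnitHom P')
    (rightUnitFun_bijective P' a b).1 x (FreeProfunctor.cls _ _ y (FreeProfunctor.ofHom (𝟙 b)))).trans
    (Eq.trans ?_ (graph_vcomp_apply (rightUnitHom P) σ x _).symm)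
  change _ = σ.toFun (rightUnitFun P a b x) _
  rw [← hy]
  induction x using FreeProfunctor.comp_ind with
  | h c p f =>
  rw [hcomp_cls, rightUnitFun_cls]
  simp only [id_apply]
  rw [Finset.sum_eq_single (Groupoid.inv (FreeProfunctor.toHom f))]
  · rw [if_pos (FreeProfunctor.toHom_injective (by simp)), mul_one,
      ← σ.r_r (FreeProfunctor.toHom f),
      FreeProfunctor.r_r]
    simp
  · intro g _ hg
    rw [if_neg (fun h => hg ?_), mul_zero]
    have h' := congrArg FreeProfunctor.toHom h
    rw [FreeProfunctor.toHom_l, FreeProfunctor.toHom_ofHom] at h'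
    rw [← cancel_epi (FreeProfunctor.toHom f), h']; simp
  · intro h; exact absurd (Finset.mem_univ _) h

end Protransformation

/-- A bundled finite groupoid, as an object of the 2-category of finite groupoids, free profunctors
and protransformations. -/
structure GAf : Type (u + 1) where
  carrier : Type u
  [str : FiniteGroupoid carrier]

attribute [instance] GAf.str

namespace GAf

open Protransformation

instance : CategoryStruct.{u + 1} GAf.{u} where
  Hom A B := FreeProfunctor A.carrier B.carrier
  id A := FreeProfunctor.id A.carrier
  comp P Q := FreeProfunctor.comp P Q

instance (A B : GAf.{u}) : Category.{u} (A ⟶ B) :=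
  inferInstanceAs (Category (FreeProfunctor A.carrier B.carrier))

/-- The 2-category of finite groupoids, free profunctors and protransformations. -/
instance : Bicategory.{u, u + 1} GAf.{u} where
  whiskerLeft P _ _ τ := hcomp (Protransformation.id P) τ
  whiskerRight σ Q := hcomp σ (Protransformation.id Q)
  associator P Q R := Protransformation.assoc P Q R
  leftUnitor P := Protransformation.leftUnitor P
  rightUnitor P := Protransformation.rightUnitor P
  whiskerLeft_id P Q := hcomp_id P Q
  whiskerLeft_comp P _ _ _ τ τ' := by
    refine Eq.trans ?_ (hcomp_vcomp (Protransformation.id P) (Protransformation.id P) τ τ')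
    rw [id_vcomp]; rfl
  id_whiskerLeft {A B P Q} σ := 
    ((Iso.eq_comp_inv (Protransformation.leftUnitor Q)).2 (leftUnitor_naturality σ)).trans
      (Category.assoc _ _ _)
  comp_whiskerLeft P Q R R' τ := by
    refine ((Iso.eq_comp_inv (Protransformation.assoc P Q R')).2 ?_).trans (Category.assoc _ _ _)
    refine Eq.trans ?_ (assoc_naturality (Protransformation.id P) (Protransformation.id Q) τ)
    rw [hcomp_id]; rfl
  id_whiskerRight P Q := hcomp_id P Q
  comp_whiskerRight σ σ' Q := by
    refine Eq.trans ?_ (hcomp_vcomp σ σ' (Protransformation.id Q) (Protransformation.id Q))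
    rw [id_vcomp]; rfl
  whiskerRight_id {A B P Q} σ := 
    ((Iso.eq_comp_inv (Protransformation.rightUnitor Q)).2 (rightUnitor_naturality σ)).trans
      (Category.assoc _ _ _)
  whiskerRight_comp {A B C D P P'} σ Q R := by
    refine (Iso.eq_inv_comp (Protransformation.assoc P Q R)).2 ?_
    refine Eq.trans ?_ (assoc_naturality σ (Protransformation.id Q) (Protransformation.id R)).symm
    rw [hcomp_id]; rfl
  whisker_assoc P Q Q' τ R :=
    ((Iso.eq_comp_inv (Protransformation.assoc P Q' R)).2 <|
      assoc_naturality (Protransformation.id P) τ (Protransformation.id R)).trans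
        (Category.assoc _ _ _)
  whisker_exchange {A B C P P' Q Q'} σ τ := by
    refine (hcomp_vcomp (Protransformation.id P) σ τ (Protransformation.id Q')).symm.trans
      (Eq.trans ?_ (hcomp_vcomp σ (Protransformation.id P') (Protransformation.id Q) τ))
    rw [id_vcomp, id_vcomp, vcomp_id, vcomp_id]
  pentagon P Q R S := by
    change vcomp (hcomp (graph (assocHom P Q R)) (graph _)) (vcomp (graph (assocHom P (Q.comp R) S))
      (hcomp (graph _) (graph (assocHom Q R S)))) =
      vcomp (graph (assocHom (P.comp Q) R S)) (graph (assocHom P Q (R.comp S)))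
    simp only [hcomp_graph_graph, vcomp_graph_graph]
    refine graph_congr fun a e x => ?_
    induction x using FreeProfunctor.comp_ind with
    | h d x s =>
    induction x using FreeProfunctor.comp_ind with
    | h c x r =>
    induction x using FreeProfunctor.comp_ind with
    | h b p q => rfl
  triangle {A B C} P Q := by
    change vcomp (graph (assocHom P (FreeProfunctor.id B.carrier) Q))
      (hcomp (graph _) (graph (leftUnitHom Q))) = hcomp (graph (rightUnitHom P)) (graph _)
    simp only [hcomp_graph_graph, vcomp_graph_graph]
    refine graph_congr fun a c x => ?_
    induction x using FreeProfunctor.comp_ind with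
    | h b x q =>
    induction x using FreeProfunctor.comp_ind with
    | h b' p f => exact (FreeProfunctor.cls_r P Q p (FreeProfunctor.toHom f) q).symm

end GAf

/-! ### Finite-dimensional C*-algebras, Hilbert bimodules, intertwiners -/

section positivity

variable {B : Type*} [CStarAlgebra B]

/-- Positivity in a C*-algebra: being of the form `c* c`. -/
def IsPos (a : B) : Prop := ∃ c : B, a = star c * c

lemma isPos_sum {ι : Type*} (s : Finset ι) (f : ι → B) (h : ∀ i ∈ s, IsPos (f i)) :
    IsPos (∑ i ∈ s, f i) := by
  let _ := CStarAlgebra.spectralOrder B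
  have _ := CStarAlgebra.spectralOrderedRing B
  refine CStarAlgebra.nonneg_iff_eq_star_mul_self.1 (Finset.sum_nonneg fun i hi => ?_)
  exact CStarAlgebra.nonneg_iff_eq_star_mul_self.2 (h i hi)

lemma eq_zero_of_sum_star_mul_self {ι : Type*} (s : Finset ι) (f : ι → B)
    (h : IsPos (- ∑ i ∈ s, star (f i) * f i)) : ∀ i ∈ s, f i = 0 := by
  let _ := CStarAlgebra.spectralOrder B
  have _ := CStarAlgebra.spectralOrderedRing B
  intro i hi
  have h1 : (∑ i ∈ s, star (f i) * f i) = 0 := by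
    refine le_antisymm ?_ (Finset.sum_nonneg fun i _ => star_mul_self_nonneg (f i))
    exact neg_nonneg.1 (CStarAlgebra.nonneg_iff_eq_star_mul_self.2 h)
  have := (Finset.sum_eq_zero_iff_of_nonneg (fun i _ => star_mul_self_nonneg (f i))).1 h1 i hi
  exact CStarRing.star_mul_self_eq_zero_iff (f i) |>.1 this

lemma exists_pos_neg (x : B) (hx : star x = x) :
    ∃ p n : B, x = p - n ∧ IsPos p ∧ IsPos n ∧ p * n = 0 := by
  let _ := CStarAlgebra.spectralOrder B
  have _ := CStarAlgebra.spectralOrderedRing B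
  exact ⟨x⁺, x⁻, (CFC.posPart_sub_negPart x hx).symm,
    CStarAlgebra.nonneg_iff_eq_star_mul_self.1 (CFC.posPart_nonneg x),
    CStarAlgebra.nonneg_iff_eq_star_mul_self.1 (CFC.negPart_nonneg x),
    CFC.posPart_mul_negPart x⟩

lemma eq_zero_of_forall_isPos {a b : B} (h : ∀ n : ℕ, IsPos (a - (n : ℂ) • (star b * b))) :
    b = 0 := by
  let _ := CStarAlgebra.spectralOrder B
  have _ := CStarAlgebra.spectralOrderedRing B
  have hn : ∀ n : ℕ, (n : ℂ) • (star b * b) ≤ a := fun n =>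
    sub_nonneg.1 (CStarAlgebra.nonneg_iff_eq_star_mul_self.2 (h n))
  have h2 : ∀ n : ℕ, (n : ℝ) * ‖star b * b‖ ≤ ‖a‖ := fun n => by
    have h3 : (0 : B) ≤ (n : ℂ) • (star b * b) := by
      rw [Nat.cast_smul_eq_nsmul]
      exact nsmul_nonneg (star_mul_self_nonneg b) n
    have := CStarAlgebra.norm_le_norm_of_nonneg_of_le h3 (hn n)
    rwa [norm_smul, Complex.norm_natCast] at this
  have h0 : ‖star b * b‖ = 0 := by
    by_contra hne
    have hpos : 0 < ‖star b * b‖ := lt_of_le_of_ne (norm_nonneg _) (Ne.symm hne)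
    obtain ⟨n, hn⟩ := exists_nat_gt (‖a‖ / ‖star b * b‖)
    have := h2 n
    rw [div_lt_iff₀ hpos] at hn
    linarith
  exact (CStarRing.star_mul_self_eq_zero_iff b).1 (norm_eq_zero.1 h0)

/-- A matrix over a C*-algebra which is positive as a form is of the form `Y* Y`. -/
lemma exists_factorization {ι : Type*} [Fintype ι] (X : ι → ι → B)
    (hX : ∀ i j, star (X i j) = X j i)
    (hpos : ∀ c : ι → B, IsPos (∑ i, ∑ j, star (c i) * X i j * c j)) :
    ∃ Y : ι → ι → B, ∀ i j, X i j = ∑ k, star (Y k i) * Y k j := by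
  classical
  let _ := CStarAlgebra.spectralOrder B
  have _ := CStarAlgebra.spectralOrderedRing B
  let X' : CStarMatrix ι ι B := CStarMatrix.ofMatrix X
  have hsa : star X' = X' := by
    ext i j
    exact hX j i
  obtain ⟨P, N, hXN, ⟨Y, hY⟩, ⟨W, hW⟩, hPN⟩ := exists_pos_neg X' hsa
  have hNsa : star N = N := by rw [hW, star_mul, star_star]
  have hNXN : N * X' * N = -(star (W * N) * (W * N)) := by
    rw [hXN, mul_assoc, sub_mul, hPN, zero_sub, mul_neg, star_mul, hNsa, mul_assoc,
      ← mul_assoc (star W), ← hW]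
  have hWN : W * N = 0 := by
    have hdiag : ∀ i, ∀ k, (W * N) k i = 0 := by
      intro i
      have h1 : (N * X' * N) i i = ∑ j, ∑ k, star (N j i) * X j k * N k i := by
        simp only [CStarMatrix.mul_apply, Finset.sum_mul]
        rw [Finset.sum_comm]
        refine Finset.sum_congr rfl fun j _ => Finset.sum_congr rfl fun k _ => ?_
        have : N i j = star (N j i) := by
          conv_lhs => rw [← hNsa]
          rfl
        rw [this]; rfl
      have h2 : (star (W * N) * (W * N)) i i = ∑ k, star ((W * N) k i) * (W * N) k i := by
        rw [CStarMatrix.mul_apply]; rfl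
      have h3 : IsPos ((N * X' * N) i i) := by
        rw [h1]
        exact hpos fun k => N k i
      have h4 : IsPos (-∑ k, star ((W * N) k i) * (W * N) k i) := by
        rw [hNXN] at h3
        rw [← h2]
        exact h3
      intro k
      exact eq_zero_of_sum_star_mul_self _ _ h4 k (Finset.mem_univ k)
    ext k i
    exact hdiag i k
  have hNN : star N * N = 0 := by
    rw [hNsa]
    nth_rw 1 [hW]
    rw [mul_assoc, hWN, mul_zero]
  have hNz : N = 0 := (CStarRing.star_mul_self_eq_zero_iff N).1 hNN
  refine ⟨fun k i => Y k i, fun i j => ?_⟩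
  have : X i j = X' i j := rfl
  rw [this, hXN, hNz, sub_zero, hY, CStarMatrix.mul_apply]
  rfl

end positivity

/-- A finite-dimensional Hilbert bimodule (C*-correspondence) from `A` to `B`: a finite-dimensional
`A`-`B`-bimodule with a `B`-valued inner product (conjugate linear in the first variable) that is
right `B`-linear in the second variable, Hermitian, positive and definite, and such that `A` acts by
adjointable operators, `a*` being adjoint to `a`. -/
structure HilbertBimodule (A B : Type u) [CStarAlgebra A] [CStarAlgebra B] where
  carrier : Type u
  [addCommGroup : AddCommGroup carrier]
  [module : Module ℂ carrier]
  [finite : FiniteDimensional ℂ carrier]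
  left : A →ₐ[ℂ] Module.End ℂ carrier
  right : Bᵐᵒᵖ →ₐ[ℂ] Module.End ℂ carrier
  left_right : ∀ (a : A) (b : Bᵐᵒᵖ) (x : carrier), left a (right b x) = right b (left a x)
  inner : carrier → carrier → B
  inner_add : ∀ x y z, inner x (y + z) = inner x y + inner x z
  inner_right : ∀ x y b, inner x (right (MulOpposite.op b) y) = inner x y * b
  star_inner : ∀ x y, star (inner x y) = inner y x
  inner_self_isPos : ∀ x, IsPos (inner x x)
  inner_definite : ∀ x, inner x x = 0 → x = 0
  inner_left : ∀ a x y, inner (left a x) y = inner x (left (star a) y)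

attribute [instance] HilbertBimodule.addCommGroup HilbertBimodule.module HilbertBimodule.finite

namespace HilbertBimodule

section basic

variable {A B : Type u} [CStarAlgebra A] [CStarAlgebra B] (E : HilbertBimodule A B)

/-- The right action `x.b`. -/
def r (x : E.carrier) (b : B) : E.carrier := E.right (MulOpposite.op b) x

lemma inner_r (x y : E.carrier) (b : B) : E.inner x (E.r y b) = E.inner x y * b :=
  E.inner_right x y b

lemma r_smul_one (x : E.carrier) (c : ℂ) : E.r x (c • 1) = c • x := by
  simp [r]

lemma inner_smul (x y : E.carrier) (c : ℂ) : E.inner x (c • y) = c • E.inner x y := by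
  rw [← E.r_smul_one, inner_r, mul_smul_comm, mul_one]

lemma add_inner (x y z : E.carrier) : E.inner (x + y) z = E.inner x z + E.inner y z := by
  rw [← E.star_inner, E.inner_add, star_add, E.star_inner, E.star_inner]

lemma smul_inner (x y : E.carrier) (c : ℂ) :
    E.inner (c • x) y = (starRingEnd ℂ) c • E.inner x y := by
  rw [← E.star_inner, E.inner_smul, star_smul, E.star_inner]; rfl

/-- The inner product as a sesquilinear map. -/
def innerₛₗ : E.carrier →ₛₗ[starRingEnd ℂ] E.carrier →ₗ[ℂ] B :=
  LinearMap.mk₂'ₛₗ (starRingEnd ℂ) (RingHom.id ℂ) E.inner E.add_inner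
    (fun c x y => E.smul_inner x y c) E.inner_add (fun c x y => E.inner_smul x y c)

@[simp] lemma innerₛₗ_apply (x y : E.carrier) : E.innerₛₗ x y = E.inner x y := rfl

lemma r_inner (x y : E.carrier) (b : B) : E.inner (E.r x b) y = star b * E.inner x y := by
  rw [← E.star_inner, inner_r, star_mul, E.star_inner]

@[simp] lemma inner_zero (x : E.carrier) : E.inner x 0 = 0 := (E.innerₛₗ x).map_zero

lemma inner_neg (x y : E.carrier) : E.inner x (-y) = -E.inner x y := (E.innerₛₗ x).map_neg y

lemma inner_sub (x y z : E.carrier) : E.inner x (y - z) = E.inner x y - E.inner x z :=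
  (E.innerₛₗ x).map_sub y z

lemma inner_sum {ι : Type*} (s : Finset ι) (x : E.carrier) (f : ι → E.carrier) :
    E.inner x (∑ i ∈ s, f i) = ∑ i ∈ s, E.inner x (f i) := map_sum (E.innerₛₗ x) f s

lemma sum_inner {ι : Type*} (s : Finset ι) (x : E.carrier) (f : ι → E.carrier) :
    E.inner (∑ i ∈ s, f i) x = ∑ i ∈ s, E.inner (f i) x := by
  rw [← E.star_inner, inner_sum, star_sum]
  simp only [E.star_inner]

lemma r_add (x : E.carrier) (b b' : B) : E.r x (b + b') = E.r x b + E.r x b' := by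
  simp [r]

lemma r_r (x : E.carrier) (b b' : B) : E.r (E.r x b) b' = E.r x (b * b') := by
  simp [r]

lemma r_one (x : E.carrier) : E.r x 1 = x := by simp [r]

lemma left_left (x : E.carrier) (a a' : A) : E.left a (E.left a' x) = E.left (a * a') x := by
  simp

lemma r_sum {ι : Type*} (s : Finset ι) (x : E.carrier) (f : ι → B) :
    E.r x (∑ i ∈ s, f i) = ∑ i ∈ s, E.r x (f i) := by
  simp [r, LinearMap.sum_apply]

lemma ext_inner {x y : E.carrier} (h : ∀ z, E.inner z x = E.inner z y) : x = y := by
  rw [← sub_eq_zero]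
  apply E.inner_definite
  rw [inner_sub, h, sub_self]

lemma inner_left' (a : A) (x y : E.carrier) :
    E.inner x (E.left a y) = E.inner (E.left (star a) x) y := by
  rw [E.inner_left, star_star]

/-- Every right `B`-linear map between finite-dimensional Hilbert bimodules is adjointable. -/
lemma exists_adjoint {A' : Type u} [CStarAlgebra A'] (F : HilbertBimodule A' B)
    (T : E.carrier →ₗ[ℂ] F.carrier)
    (hT : ∀ x b, T (E.r x b) = F.r (T x) b) (y : F.carrier) :
    ∃ z : E.carrier, ∀ x, F.inner (T x) y = E.inner x z := by
  classical
  let e := Module.finBasis ℂ E.carrier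
  let S : E.carrier →ₗ[ℂ] E.carrier :=
    { toFun := fun x => ∑ i, E.r (e i) (E.inner (e i) x)
      map_add' := fun x y => by simp [E.inner_add, E.r_add, Finset.sum_add_distrib]
      map_smul' := fun c x => by simp [E.inner_smul, r, Finset.smul_sum] }
  have hS : ∀ x, S x = ∑ i, E.r (e i) (E.inner (e i) x) := fun _ => rfl
  have hsymm : ∀ x y, E.inner (S x) y = E.inner x (S y) := by
    intro x y
    rw [hS, hS, E.sum_inner, E.inner_sum]
    refine Finset.sum_congr rfl fun i _ => ?_
    rw [r_inner, inner_r, E.star_inner]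
  have hinj : Function.Injective S := by
    rw [injective_iff_map_eq_zero]
    intro x hx
    have h1 : ∑ i, star (E.inner (e i) x) * E.inner (e i) x = 0 := by
      have : E.inner x (S x) = ∑ i, star (E.inner (e i) x) * E.inner (e i) x := by
        rw [hS, E.inner_sum]
        refine Finset.sum_congr rfl fun i _ => ?_
        rw [inner_r, E.star_inner]
      rw [← this, hx, inner_zero]
    have h2 := eq_zero_of_sum_star_mul_self Finset.univ (fun i => E.inner (e i) x)
      ⟨0, by rw [h1]; simp⟩
    apply E.ext_inner
    intro z
    rw [inner_zero, ← e.sum_repr z, E.sum_inner]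
    refine Finset.sum_eq_zero fun i hi => ?_
    rw [smul_inner, h2 i hi, smul_zero]
  have hsurj := LinearMap.injective_iff_surjective.1 hinj
  obtain ⟨z, hz⟩ := hsurj (∑ i, E.r (e i) (F.inner (T (e i)) y))
  refine ⟨z, fun x => ?_⟩
  obtain ⟨x, rfl⟩ := hsurj x
  rw [hsymm, hz, hS, map_sum, F.sum_inner, E.inner_sum]
  refine Finset.sum_congr rfl fun i _ => ?_
  rw [hT, r_inner, inner_r, E.star_inner]

end basic

end HilbertBimodule

/-- An intertwiner of Hilbert bimodules: a linear map commuting with both actions. -/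
@[ext]
structure Intertwiner {A B : Type u} [CStarAlgebra A] [CStarAlgebra B]
    (E F : HilbertBimodule A B) where
  toLin : E.carrier →ₗ[ℂ] F.carrier
  map_left : ∀ (a : A) (x : E.carrier), toLin (E.left a x) = F.left a (toLin x)
  map_right : ∀ (b : Bᵐᵒᵖ) (x : E.carrier), toLin (E.right b x) = F.right b (toLin x)

namespace Intertwiner

open HilbertBimodule

section

variable {A B : Type u} [CStarAlgebra A] [CStarAlgebra B] {E F G : HilbertBimodule A B}

lemma map_r (T : Intertwiner E F) (x : E.carrier) (b : B) :
    T.toLin (E.r x b) = F.r (T.toLin x) b := T.map_right _ _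

lemma ext' {S T : Intertwiner E F} (h : ∀ x, S.toLin x = T.toLin x) : S = T :=
  Intertwiner.ext (LinearMap.ext h)

/-- The identity intertwiner. -/
def id (E : HilbertBimodule A B) : Intertwiner E E := ⟨LinearMap.id, fun _ _ => rfl, fun _ _ => rfl⟩

/-- Composition of intertwiners. -/
def vcomp (S : Intertwiner E F) (T : Intertwiner F G) : Intertwiner E G where
  toLin := T.toLin ∘ₗ S.toLin
  map_left a x := by simp [S.map_left, T.map_left]
  map_right b x := by simp [S.map_right, T.map_right]

/-- The adjoint `S†` of an intertwiner, `⟨S x, y⟩ = ⟨x, S† y⟩`. -/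
def dagger (S : Intertwiner E F) : Intertwiner F E :=
  let f : F.carrier → E.carrier := fun y => Classical.choose (E.exists_adjoint F S.toLin S.map_r y)
  have hf : ∀ x y, F.inner (S.toLin x) y = E.inner x (f y) := fun x y =>
    Classical.choose_spec (E.exists_adjoint F S.toLin S.map_r y) x
  { toLin :=
      { toFun := f
        map_add' := fun y z => E.ext_inner fun x => by
          rw [E.inner_add, ← hf, ← hf, ← hf, F.inner_add]
        map_smul' := fun c y => E.ext_inner fun x => by
          rw [RingHom.id_apply, E.inner_smul, ← hf, ← hf, F.inner_smul] }
    map_left := fun a y => E.ext_inner fun x => by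
      change E.inner x (f _) = E.inner x (E.left a (f y))
      rw [← hf, E.inner_left', F.inner_left', ← S.map_left, hf]
    map_right := fun b y => E.ext_inner fun x => by
      change E.inner x (f _) = E.inner x (E.right (MulOpposite.op b.unop) (f y))
      rw [← hf, E.inner_right, ← hf]
      exact F.inner_right _ _ b.unop }

lemma inner_dagger (S : Intertwiner E F) (x : E.carrier) (y : F.carrier) :
    F.inner (S.toLin x) y = E.inner x (S.dagger.toLin y) :=
  Classical.choose_spec (E.exists_adjoint F S.toLin S.map_r y) x

lemma dagger_inner (S : Intertwiner E F) (x : E.carrier) (y : F.carrier) :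
    F.inner y (S.toLin x) = E.inner (S.dagger.toLin y) x := by
  rw [← F.star_inner, inner_dagger, E.star_inner]

lemma dagger_unique {S : Intertwiner E F} {T : Intertwiner F E}
    (h : ∀ x y, F.inner (S.toLin x) y = E.inner x (T.toLin y)) : S.dagger = T :=
  ext' fun y => E.ext_inner fun x => by rw [← h, inner_dagger]

lemma dagger_dagger (S : Intertwiner E F) : S.dagger.dagger = S :=
  dagger_unique fun x y => (dagger_inner S y x).symm

lemma dagger_id (E : HilbertBimodule A B) : (id E).dagger = id E :=
  dagger_unique fun _ _ => rfl

lemma dagger_vcomp (S : Intertwiner E F) (T : Intertwiner F G) :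
    (vcomp S T).dagger = vcomp T.dagger S.dagger :=
  dagger_unique fun _ _ => (inner_dagger T _ _).trans (inner_dagger S _ _)

instance : Category (HilbertBimodule A B) where
  Hom E F := Intertwiner E F
  id E := id E
  comp S T := vcomp S T
  id_comp _ := rfl
  comp_id _ := rfl
  assoc _ _ _ := rfl

end

end Intertwiner

namespace HilbertBimodule

open Intertwiner

section gram

variable {A B : Type u} [CStarAlgebra A] [CStarAlgebra B] (E F : HilbertBimodule A B)
  {ι : Type*} (h : ι → E.carrier) (k : ι → F.carrier)

lemma inner_linearCombination (s t : ι →₀ ℂ) (a : A) :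
    E.inner (Finsupp.linearCombination ℂ h s) (E.left a (Finsupp.linearCombination ℂ h t)) =
      s.sum fun i c => t.sum fun j d => ((starRingEnd ℂ) c * d) • E.inner (h i) (E.left a (h j)) := by
  simp only [Finsupp.linearCombination_apply, Finsupp.sum, map_sum, E.sum_inner, E.inner_sum,
    map_smul, E.inner_smul, E.smul_inner, smul_smul]
  refine Finset.sum_congr rfl fun i _ => Finset.sum_congr rfl fun j _ => ?_
  rw [mul_comm]

variable {E F h k}

lemma gram_aux (hk : ∀ a i j, E.inner (h i) (E.left a (h j)) = F.inner (k i) (F.left a (k j)))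
    (s t : ι →₀ ℂ) (a : A) :
    E.inner (Finsupp.linearCombination ℂ h s) (E.left a (Finsupp.linearCombination ℂ h t)) =
      F.inner (Finsupp.linearCombination ℂ k s) (F.left a (Finsupp.linearCombination ℂ k t)) := by
  simp only [inner_linearCombination, hk]

lemma exists_gram (hh : Submodule.span ℂ (Set.range h) = ⊤) (hk : Submodule.span ℂ (Set.range k) = ⊤)
    (hhk : ∀ a i j, E.inner (h i) (E.left a (h j)) = F.inner (k i) (F.left a (k j))) :
    ∃ U : Intertwiner E F, ∀ i, U.toLin (h i) = k i := by
  have hs : Function.Surjective (Finsupp.linearCombination ℂ h) := by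
    rw [← LinearMap.range_eq_top, Finsupp.range_linearCombination, hh]
  have ks : Function.Surjective (Finsupp.linearCombination ℂ k) := by
    rw [← LinearMap.range_eq_top, Finsupp.range_linearCombination, hk]
  have key := gram_aux hhk
  have key1 : ∀ s t : ι →₀ ℂ,
      E.inner (Finsupp.linearCombination ℂ h s) (Finsupp.linearCombination ℂ h t) =
      F.inner (Finsupp.linearCombination ℂ k s) (Finsupp.linearCombination ℂ k t) := by
    intro s t
    simpa using key s t 1
  let L := (Finsupp.linearCombination ℂ h)
  have hker : LinearMap.ker L ≤ LinearMap.ker (Finsupp.linearCombination ℂ k) := by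
    intro s h0
    rw [LinearMap.mem_ker] at h0 ⊢
    apply F.inner_definite
    rw [← key1, h0, E.inner_zero]
  let U : E.carrier →ₗ[ℂ] F.carrier :=
    (LinearMap.ker L).liftQ (Finsupp.linearCombination ℂ k) hker ∘ₗ
      (L.quotKerEquivOfSurjective hs).symm.toLinearMap
  have hU : ∀ s, U (L s) = Finsupp.linearCombination ℂ k s := by
    intro s
    have : (L.quotKerEquivOfSurjective hs).symm (L s) = Submodule.Quotient.mk s := by
      rw [LinearEquiv.symm_apply_eq]; rfl
    simp only [U, LinearMap.comp_apply, LinearEquiv.coe_coe, this]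
    rfl
  refine ⟨⟨U, fun a x => ?_, fun b x => ?_⟩, fun i => ?_⟩
  · obtain ⟨s, rfl⟩ := hs x
    obtain ⟨t, ht⟩ := hs (E.left a (L s))
    rw [← ht, hU, hU]
    apply F.ext_inner
    intro z
    obtain ⟨w, rfl⟩ := ks z
    rw [← key, ← key1, ht]
  · obtain ⟨s, rfl⟩ := hs x
    obtain ⟨t, ht⟩ := hs (E.right b (L s))
    rw [← ht, hU, hU]
    apply F.ext_inner
    intro z
    obtain ⟨w, rfl⟩ := ks z
    rw [← MulOpposite.op_unop b, F.inner_right, ← key1, ← key1, ht, ← MulOpposite.op_unop b,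
      E.inner_right]
    rfl
  · have := hU (Finsupp.single i 1)
    simpa [L] using this

lemma ext_span (hh : Submodule.span ℂ (Set.range h) = ⊤) {S T : Intertwiner E F}
    (h' : ∀ i, S.toLin (h i) = T.toLin (h i)) : S = T :=
  Intertwiner.ext (LinearMap.ext_on_range hh h')

/-- If two families span Hilbert bimodules and have the same Gram matrices, there is a unique
(automatically unitary) isomorphism of Hilbert bimodules that maps one to the other. -/
def gramIso (h : ι → E.carrier) (k : ι → F.carrier)
    (hh : Submodule.span ℂ (Set.range h) = ⊤) (hk : Submodule.span ℂ (Set.range k) = ⊤)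
    (hhk : ∀ a i j, E.inner (h i) (E.left a (h j)) = F.inner (k i) (F.left a (k j))) : E ≅ F where
  hom := Classical.choose (exists_gram hh hk hhk)
  inv := Classical.choose (exists_gram hk hh fun a i j => (hhk a i j).symm)
  hom_inv_id := ext_span hh fun i => by
    have h1 := Classical.choose_spec (exists_gram hh hk hhk) i
    have h2 := Classical.choose_spec (exists_gram hk hh fun a i j => (hhk a i j).symm) i
    exact (congrArg _ h1).trans h2
  inv_hom_id := ext_span hk fun i => by
    have h1 := Classical.choose_spec (exists_gram hh hk hhk) i
    have h2 := Classical.choose_spec (exists_gram hk hh fun a i j => (hhk a i j).symm) i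
    exact (congrArg _ h2).trans h1

variable (hh : Submodule.span ℂ (Set.range h) = ⊤) (hk : Submodule.span ℂ (Set.range k) = ⊤)
    (hhk : ∀ a i j, E.inner (h i) (E.left a (h j)) = F.inner (k i) (F.left a (k j)))

lemma gramIso_hom (i : ι) : (gramIso h k hh hk hhk).hom.toLin (h i) = k i :=
  Classical.choose_spec (exists_gram hh hk hhk) i

lemma gramIso_inv (i : ι) : (gramIso h k hh hk hhk).inv.toLin (k i) = h i :=
  Classical.choose_spec (exists_gram hk hh fun a i j => (hhk a i j).symm) i

lemma gramIso_dagger :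
    (gramIso h k hh hk hhk).hom.dagger = (gramIso h k hh hk hhk).inv := by
  refine ext_span hk fun j => ?_
  rw [gramIso_inv]
  apply E.ext_inner
  intro z
  have : E.innerₛₗ.flip ((gramIso h k hh hk hhk).hom.dagger.toLin (k j)) = E.innerₛₗ.flip (h j) := by
    refine LinearMap.ext_on_range hh fun i => ?_
    change E.inner (h i) _ = E.inner (h i) (h j)
    rw [← inner_dagger, gramIso_hom]
    simpa using (hhk 1 i j).symm
  exact LinearMap.congr_fun this z

end gram

end HilbertBimodule

namespace HilbertBimodule

open Intertwiner

section tensor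

variable {A B C D : Type u} [CStarAlgebra A] [CStarAlgebra B] [CStarAlgebra C] [CStarAlgebra D]

/-- The sesquilinear form `⟨x ⊗ y, x' ⊗ y'⟩ = ⟨y, ⟨x, x'⟩.y'⟩` on the vector space `E ⊗ F`. -/
def form (E : HilbertBimodule A B) (F : HilbertBimodule B C) :
    (E.carrier ⊗[ℂ] F.carrier) →ₛₗ[starRingEnd ℂ] (E.carrier ⊗[ℂ] F.carrier) →ₗ[ℂ] C :=
  TensorProduct.lift <| LinearMap.mk₂'ₛₗ (starRingEnd ℂ) (starRingEnd ℂ)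
    (fun x y => TensorProduct.lift <| LinearMap.mk₂ ℂ
      (fun x' y' => F.inner y (F.left (E.inner x x') y'))
      (fun x' x'' y' => by simp [E.inner_add, F.inner_add])
      (fun c x' y' => by simp [E.inner_smul, F.inner_smul])
      (fun x' y' y'' => by simp [F.inner_add])
      (fun c x' y' => by simp [F.inner_smul]))
    (fun x x' y => by ext; simp [E.add_inner, F.inner_add])
    (fun c x y => by ext; simp [E.smul_inner, F.inner_smul])
    (fun x y y' => by ext; simp [F.add_inner])
    (fun c x y => by ext; simp [F.smul_inner])

variable (E : HilbertBimodule A B) (F : HilbertBimodule B C)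

lemma form_tmul (x x' : E.carrier) (y y' : F.carrier) :
    form E F (x ⊗ₜ y) (x' ⊗ₜ y') = F.inner y (F.left (E.inner x x') y') := rfl

lemma star_form (z w : E.carrier ⊗[ℂ] F.carrier) : star (form E F z w) = form E F w z := by
  induction z using TensorProduct.induction_on with
  | zero => simp
  | add z z' h h' => simp [star_add, h, h']
  | tmul x y =>
    induction w using TensorProduct.induction_on with
    | zero => simp
    | add z z' h h' => simp [star_add, h, h']
    | tmul x' y' =>
      rw [form_tmul, form_tmul, F.star_inner, F.inner_left, E.star_inner]

/-- The left action on the vector space `E ⊗ F`. -/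
def preLeft : A →ₐ[ℂ] Module.End ℂ (E.carrier ⊗[ℂ] F.carrier) :=
  (Module.End.rTensorAlgHom ℂ E.carrier F.carrier).comp E.left

/-- The right action on the vector space `E ⊗ F`. -/
def preRight : Cᵐᵒᵖ →ₐ[ℂ] Module.End ℂ (E.carrier ⊗[ℂ] F.carrier) :=
  (Module.End.lTensorAlgHom ℂ F.carrier E.carrier).comp F.right

lemma preLeft_tmul (a : A) (x : E.carrier) (y : F.carrier) :
    preLeft E F a (x ⊗ₜ y) = E.left a x ⊗ₜ y := rfl

lemma preRight_tmul (c : Cᵐᵒᵖ) (x : E.carrier) (y : F.carrier) :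
    preRight E F c (x ⊗ₜ y) = x ⊗ₜ F.right c y := rfl

lemma form_preLeft (a : A) (z w : E.carrier ⊗[ℂ] F.carrier) :
    form E F (preLeft E F a z) w = form E F z (preLeft E F (star a) w) := by
  induction z using TensorProduct.induction_on with
  | zero => simp
  | add z z' h h' => simp only [map_add, LinearMap.add_apply, h, h']
  | tmul x y =>
    induction w using TensorProduct.induction_on with
    | zero => simp
    | add z z' h h' => simp only [map_add, h, h']
    | tmul x' y' => simp only [preLeft_tmul, form_tmul, E.inner_left]

lemma form_preRight (c : C) (z w : E.carrier ⊗[ℂ] F.carrier) :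
    form E F z (preRight E F (MulOpposite.op c) w) = form E F z w * c := by
  induction z using TensorProduct.induction_on with
  | zero => simp
  | add z z' h h' => simp only [map_add, LinearMap.add_apply, h, h', add_mul]
  | tmul x y =>
    induction w using TensorProduct.induction_on with
    | zero => simp
    | add z z' h h' => simp only [map_add, h, h', add_mul]
    | tmul x' y' => rw [preRight_tmul, form_tmul, form_tmul, F.left_right, F.inner_right]

lemma form_preRight_left (c : C) (z w : E.carrier ⊗[ℂ] F.carrier) :
    form E F (preRight E F (MulOpposite.op c) z) w = star c * form E F z w := by
  rw [← star_form, form_preRight, star_mul, star_form]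

lemma form_self_isPos (z : E.carrier ⊗[ℂ] F.carrier) : IsPos (form E F z z) := by
  obtain ⟨ι, _, x, y, rfl⟩ : ∃ (ι : Type u) (_ : Fintype ι) (x : ι → E.carrier) (y : ι → F.carrier),
      z = ∑ i, x i ⊗ₜ[ℂ] y i := by
    obtain ⟨S, rfl⟩ := TensorProduct.exists_finset z
    exact ⟨S, inferInstance, fun i => i.1.1, fun i => i.1.2, (Finset.sum_coe_sort S _).symm⟩
  obtain ⟨Y, hY⟩ := exists_factorization (fun i j => E.inner (x i) (x j))
    (fun i j => E.star_inner _ _) (fun c => by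
      have : ∑ i, ∑ j, star (c i) * E.inner (x i) (x j) * c j =
          E.inner (∑ i, E.r (x i) (c i)) (∑ i, E.r (x i) (c i)) := by
        rw [E.sum_inner]
        refine Finset.sum_congr rfl fun i _ => ?_
        rw [E.inner_sum]
        refine Finset.sum_congr rfl fun j _ => ?_
        rw [E.inner_r, E.r_inner]
      rw [this]
      exact E.inner_self_isPos _)
  have h1 : form E F (∑ i, x i ⊗ₜ[ℂ] y i) (∑ i, x i ⊗ₜ[ℂ] y i) =
      ∑ k, F.inner (∑ i, F.left (Y k i) (y i)) (∑ i, F.left (Y k i) (y i)) := by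
    have h2 : ∀ k, F.inner (∑ i, F.left (Y k i) (y i)) (∑ i, F.left (Y k i) (y i)) =
        ∑ i, ∑ j, F.inner (y i) (F.left (star (Y k i) * Y k j) (y j)) := by
      intro k
      rw [F.sum_inner]
      refine Finset.sum_congr rfl fun i _ => ?_
      rw [F.inner_sum]
      refine Finset.sum_congr rfl fun j _ => ?_
      rw [F.inner_left, F.left_left]
    simp only [h2, map_sum, LinearMap.sum_apply, form_tmul]
    conv_rhs => rw [Finset.sum_comm]
    rw [Finset.sum_comm]
    refine Finset.sum_congr rfl fun i _ => ?_
    rw [Finset.sum_comm]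
    refine Finset.sum_congr rfl fun j _ => ?_
    rw [hY, map_sum, LinearMap.sum_apply, F.inner_sum]
  rw [h1]
  exact isPos_sum _ _ fun k _ => F.inner_self_isPos _

lemma form_eq_zero (z : E.carrier ⊗[ℂ] F.carrier) (hz : form E F z z = 0)
    (w : E.carrier ⊗[ℂ] F.carrier) : form E F z w = 0 := by
  refine eq_zero_of_forall_isPos (a := form E F w w) fun n => ?_
  have := form_self_isPos E F
    (w - ((n : ℂ) / 2) • preRight E F (MulOpposite.op (form E F z w)) z)
  convert this using 1
  simp only [map_sub, LinearMap.sub_apply, map_smulₛₗ, LinearMap.smul_apply, form_preRight,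
    form_preRight_left, hz, zero_mul, mul_zero, smul_zero, sub_zero, RingHom.id_apply,
    star_form]
  rw [← star_form E F z w]
  have hc : (starRingEnd ℂ) ((n : ℂ) / 2) = (n : ℂ) / 2 := by
    rw [map_div₀, map_natCast, map_ofNat]
  rw [hc, sub_sub, ← add_smul, add_halves]

/-- The null vectors of the sesquilinear form on `E ⊗ F`. -/
def null : Submodule ℂ (E.carrier ⊗[ℂ] F.carrier) := LinearMap.ker (form E F)

lemma mem_null {z : E.carrier ⊗[ℂ] F.carrier} : z ∈ null E F ↔ ∀ w, form E F z w = 0 := by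
  rw [null, LinearMap.mem_ker]
  exact ⟨fun h w => by rw [h]; rfl, fun h => LinearMap.ext h⟩

lemma form_congr {z z' w w' : E.carrier ⊗[ℂ] F.carrier} (h : z - z' ∈ null E F)
    (h' : w - w' ∈ null E F) : form E F z w = form E F z' w' := by
  have h1 := (mem_null E F).1 h w
  have h2 := (mem_null E F).1 h' z'
  rw [map_sub, LinearMap.sub_apply, sub_eq_zero] at h1
  rw [← star_form, star_eq_zero, map_sub, sub_eq_zero] at h2
  rw [h1, h2]

/-- An algebra of operators that preserve a subspace acts on the quotient. -/
def quotAction {R V : Type*} [Ring R] [Algebra ℂ R] [AddCommGroup V] [Module ℂ V]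
    (p : Submodule ℂ V) (φ : R →ₐ[ℂ] Module.End ℂ V) (h : ∀ r, p ≤ p.comap (φ r)) :
    R →ₐ[ℂ] Module.End ℂ (V ⧸ p) where
  toFun r := p.mapQ p (φ r) (h r)
  map_one' := by ext; simp
  map_mul' r s := by ext; simp
  map_zero' := by ext; simp
  map_add' r s := by ext; simp
  commutes' c := by ext; simp [Algebra.algebraMap_eq_smul_one]

/-- The (interior) tensor product `E ⊗_B F` of Hilbert bimodules: the vector space `E ⊗ F` modulo
the null vectors of the form `⟨x ⊗ y, x' ⊗ y'⟩ = ⟨y, ⟨x, x'⟩.y'⟩`. -/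
def comp : HilbertBimodule A C where
  carrier := (E.carrier ⊗[ℂ] F.carrier) ⧸ null E F
  left := quotAction (null E F) (preLeft E F) fun a z hz => by
    rw [Submodule.mem_comap, mem_null]
    intro w
    rw [form_preLeft, (mem_null E F).1 hz]
  right := quotAction (null E F) (preRight E F) fun c z hz => by
    rw [Submodule.mem_comap, mem_null]
    intro w
    rw [← MulOpposite.op_unop c, form_preRight_left, (mem_null E F).1 hz, mul_zero]
  left_right a c x := by
    induction x using Submodule.Quotient.induction_on with
    | H z =>
      change Submodule.Quotient.mk _ = Submodule.Quotient.mk _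
      congr 1
      induction z using TensorProduct.induction_on with
      | zero => simp
      | add z z' h h' => simp only [map_add, h, h']
      | tmul x y => rfl
  inner x y := Quotient.liftOn₂' x y (fun z w => form E F z w) fun z w z' w' h h' =>
    form_congr E F ((Submodule.quotientRel_def _).1 h) ((Submodule.quotientRel_def _).1 h')
  inner_add x y z := by
    induction x using Submodule.Quotient.induction_on
    induction y using Submodule.Quotient.induction_on
    induction z using Submodule.Quotient.induction_on
    exact map_add (form E F _) _ _
  inner_right x y c := by
    induction x using Submodule.Quotient.induction_on
    induction y using Submodule.Quotient.induction_on
    exact form_preRight E F _ _ _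
  star_inner x y := by
    induction x using Submodule.Quotient.induction_on
    induction y using Submodule.Quotient.induction_on
    exact star_form E F _ _
  inner_self_isPos x := by
    induction x using Submodule.Quotient.induction_on
    exact form_self_isPos E F _
  inner_definite x := by
    induction x using Submodule.Quotient.induction_on
    intro h
    rw [Submodule.Quotient.mk_eq_zero, mem_null]
    exact form_eq_zero E F _ h
  inner_left a x y := by
    induction x using Submodule.Quotient.induction_on
    induction y using Submodule.Quotient.induction_on
    exact form_preLeft E F _ _ _

/-- The class of `x ⊗ y` in `E ⊗_B F`. -/
def tmul (x : E.carrier) (y : F.carrier) : (E.comp F).carrier :=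
  Submodule.Quotient.mk (x ⊗ₜ[ℂ] y)

variable {E F}

lemma inner_tmul (x x' : E.carrier) (y y' : F.carrier) :
    (E.comp F).inner (tmul E F x y) (tmul E F x' y') = F.inner y (F.left (E.inner x x') y') := rfl

lemma left_tmul (a : A) (x : E.carrier) (y : F.carrier) :
    (E.comp F).left a (tmul E F x y) = tmul E F (E.left a x) y := rfl

lemma right_tmul (c : Cᵐᵒᵖ) (x : E.carrier) (y : F.carrier) :
    (E.comp F).right c (tmul E F x y) = tmul E F x (F.right c y) := rfl

lemma tmul_ind {motive : (E.comp F).carrier → Prop} (zero : motive 0)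
    (tmul : ∀ x y, motive (tmul E F x y))
    (add : ∀ z w, motive z → motive w → motive (z + w)) (z) : motive z := by
  induction z using Submodule.Quotient.induction_on with
  | H z =>
    induction z using TensorProduct.induction_on with
    | zero => exact zero
    | tmul x y => exact tmul x y
    | add z w h h' => exact add _ _ h h'

variable (E F) in
/-- `tmul` as a bilinear map. -/
def tmulₗ : E.carrier →ₗ[ℂ] F.carrier →ₗ[ℂ] (E.comp F).carrier :=
  LinearMap.mk₂ ℂ (tmul E F)
    (fun x x' y => congrArg Submodule.Quotient.mk (TensorProduct.add_tmul x x' y))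
    (fun c x y => congrArg Submodule.Quotient.mk (TensorProduct.smul_tmul' c x y).symm)
    (fun x y y' => congrArg Submodule.Quotient.mk (TensorProduct.tmul_add x y y'))
    (fun c x y => congrArg Submodule.Quotient.mk (TensorProduct.tmul_smul c x y))

lemma tmulₗ_apply (x : E.carrier) (y : F.carrier) : tmulₗ E F x y = tmul E F x y := rfl

lemma span_tmul' {ι κ : Type*} {h : ι → E.carrier} {k : κ → F.carrier}
    (hh : Submodule.span ℂ (Set.range h) = ⊤) (hk : Submodule.span ℂ (Set.range k) = ⊤) :
    Submodule.span ℂ (Set.range fun p : ι × κ => tmul E F (h p.1) (k p.2)) = ⊤ := by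
  let T := tmulₗ E F
  rw [eq_top_iff]
  rintro z -
  induction z using tmul_ind with
  | zero => exact zero_mem _
  | add z w h h' => exact add_mem h h'
  | tmul x y =>
    have hx : x ∈ Submodule.span ℂ (Set.range h) := hh ▸ Submodule.mem_top
    have hy : y ∈ Submodule.span ℂ (Set.range k) := hk ▸ Submodule.mem_top
    have := Submodule.apply_mem_map₂ T hx hy
    rw [Submodule.map₂_span_span] at this
    refine Submodule.span_mono ?_ this
    rintro _ ⟨_, ⟨i, rfl⟩, _, ⟨j, rfl⟩, rfl⟩
    exact ⟨(i, j), rfl⟩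

lemma span_id (E : HilbertBimodule A B) :
    Submodule.span ℂ (Set.range fun x : E.carrier => x) = ⊤ := by
  simp

lemma span_tmul : Submodule.span ℂ (Set.range fun p : E.carrier × F.carrier => tmul E F p.1 p.2) = ⊤ :=
  span_tmul' (h := fun x => x) (k := fun y => y) (span_id E) (span_id F)

lemma ext_tmul {G : HilbertBimodule A C} {S T : Intertwiner (E.comp F) G}
    (h : ∀ x y, S.toLin (tmul E F x y) = T.toLin (tmul E F x y)) : S = T :=
  ext_span span_tmul fun p => h p.1 p.2

lemma form_map {E' : HilbertBimodule A B} {F' : HilbertBimodule B C} (S : Intertwiner E E')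
    (T : Intertwiner F F') (z : E.carrier ⊗[ℂ] F.carrier) (w : E'.carrier ⊗[ℂ] F'.carrier) :
    form E' F' (TensorProduct.map S.toLin T.toLin z) w =
      form E F z (TensorProduct.map S.dagger.toLin T.dagger.toLin w) := by
  induction z using TensorProduct.induction_on with
  | zero => simp
  | add z z' h h' => simp only [map_add, LinearMap.add_apply, h, h']
  | tmul x y =>
    induction w using TensorProduct.induction_on with
    | zero => simp
    | add z z' h h' => simp only [map_add, h, h']
    | tmul x' y' =>
      simp only [TensorProduct.map_tmul, form_tmul]
      rw [inner_dagger, inner_dagger, T.dagger.map_left]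

end tensor

end HilbertBimodule

namespace Intertwiner

open HilbertBimodule

variable {A B C D : Type u} [CStarAlgebra A] [CStarAlgebra B] [CStarAlgebra C] [CStarAlgebra D]

/-- The linear map underlying the horizontal composite. -/
def hcompLin {E E' : HilbertBimodule A B} {F F' : HilbertBimodule B C} (S : Intertwiner E E')
    (T : Intertwiner F F') : (E.comp F).carrier →ₗ[ℂ] (E'.comp F').carrier :=
  (null E F).mapQ (null E' F') (TensorProduct.map S.toLin T.toLin) (by
    intro z hz
    rw [Submodule.mem_comap, mem_null]
    intro w
    rw [form_map, (mem_null E F).1 hz])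

/-- The horizontal composite (tensor product) `S ⊗_B T` of intertwiners. -/
def hcomp {E E' : HilbertBimodule A B} {F F' : HilbertBimodule B C} (S : Intertwiner E E')
    (T : Intertwiner F F') : Intertwiner (E.comp F) (E'.comp F') where
  toLin := hcompLin S T
  map_left a z := by
    induction z using tmul_ind with
    | zero => simp only [map_zero]
    | add z w h h' => simp only [map_add, h, h']
    | tmul x y =>
      exact congrArg (fun u => tmul E' F' u (T.toLin y)) (S.map_left a x)
  map_right c z := by
    induction z using tmul_ind with
    | zero => simp only [map_zero]
    | add z w h h' => simp only [map_add, h, h']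
    | tmul x y =>
      exact congrArg (fun u => tmul E' F' (S.toLin x) u) (T.map_right c y)

lemma hcomp_tmul {E E' : HilbertBimodule A B} {F F' : HilbertBimodule B C} (S : Intertwiner E E')
    (T : Intertwiner F F') (x : E.carrier) (y : F.carrier) :
    (hcomp S T).toLin (tmul E F x y) = tmul E' F' (S.toLin x) (T.toLin y) := rfl

lemma hcomp_id (E : HilbertBimodule A B) (F : HilbertBimodule B C) :
    hcomp (id E) (id F) = id (E.comp F) := ext_tmul fun _ _ => rfl

lemma hcomp_vcomp {E E' E'' : HilbertBimodule A B} {F F' F'' : HilbertBimodule B C}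
    (S : Intertwiner E E') (S' : Intertwiner E' E'') (T : Intertwiner F F')
    (T' : Intertwiner F' F'') :
    hcomp (vcomp S S') (vcomp T T') = vcomp (hcomp S T) (hcomp S' T') := ext_tmul fun _ _ => rfl

lemma dagger_hcomp {E E' : HilbertBimodule A B} {F F' : HilbertBimodule B C} (S : Intertwiner E E')
    (T : Intertwiner F F') : (hcomp S T).dagger = hcomp S.dagger T.dagger := by
  refine dagger_unique fun z w => ?_
  induction z using Submodule.Quotient.induction_on
  induction w using Submodule.Quotient.induction_on
  exact form_map S T _ _

end Intertwiner

namespace HilbertBimodule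

open Intertwiner

variable {A B C D : Type u} [CStarAlgebra A] [CStarAlgebra B] [CStarAlgebra C] [CStarAlgebra D]

/-- The identity Hilbert bimodule: `B` with multiplication and `⟨x, y⟩ = x* y`. -/
def id (B : Type u) [CStarAlgebra B] [FiniteDimensional ℂ B] : HilbertBimodule B B where
  carrier := B
  left := Algebra.lmul ℂ B
  right :=
    { toFun := fun b => LinearMap.mulRight ℂ b.unop
      map_one' := by ext; simp
      map_mul' := fun b c => by ext; simp [mul_assoc]
      map_zero' := by ext; simp
      map_add' := fun b c => by ext; simp [mul_add]
      commutes' := fun c => by ext; simp [Algebra.algebraMap_eq_smul_one] }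
  left_right a b x := (mul_assoc a x b.unop).symm
  inner x y := star x * y
  inner_add x y z := mul_add _ _ _
  inner_right x y b := (mul_assoc _ _ _).symm
  star_inner x y := by simp
  inner_self_isPos x := ⟨x, rfl⟩
  inner_definite x h := (CStarRing.star_mul_self_eq_zero_iff x).1 h
  inner_left a x y := by simp [mul_assoc]

end HilbertBimodule

namespace Intertwiner

variable {A B : Type u} [CStarAlgebra A] [CStarAlgebra B] {E F : HilbertBimodule A B}

lemma id_vcomp (S : Intertwiner E F) : vcomp (id E) S = S := rfl

lemma vcomp_id (S : Intertwiner E F) : vcomp S (id F) = S := rfl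

lemma exchange {A B C : Type u} [CStarAlgebra A] [CStarAlgebra B] [CStarAlgebra C]
    {E E' : HilbertBimodule A B} {F F' : HilbertBimodule B C} (S : Intertwiner E E')
    (T : Intertwiner F F') :
    vcomp (hcomp (id E) T) (hcomp S (id F')) = vcomp (hcomp S (id F)) (hcomp (id E') T) := by
  rw [← hcomp_vcomp, ← hcomp_vcomp, id_vcomp, id_vcomp, vcomp_id, vcomp_id]

end Intertwiner

namespace HilbertBimodule

open Intertwiner

variable {A B C D : Type u} [CStarAlgebra A] [CStarAlgebra B] [CStarAlgebra C] [CStarAlgebra D]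

/-- The associator `(x ⊗ y) ⊗ z ↦ x ⊗ (y ⊗ z)`. -/
def assoc (E : HilbertBimodule A B) (F : HilbertBimodule B C) (G : HilbertBimodule C D) :
    (E.comp F).comp G ≅ E.comp (F.comp G) :=
  gramIso (fun p : (E.carrier × F.carrier) × G.carrier => tmul _ _ (tmul _ _ p.1.1 p.1.2) p.2)
    (fun p => tmul _ _ p.1.1 (tmul _ _ p.1.2 p.2))
    (span_tmul' (h := fun p : E.carrier × F.carrier => tmul E F p.1 p.2)
      (k := fun z : G.carrier => z) span_tmul (span_id G))
    (by
      have := span_tmul' (E := E) (F := F.comp G) (h := fun x : E.carrier => x)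
        (k := fun p : F.carrier × G.carrier => tmul F G p.1 p.2) (span_id E) span_tmul
      rw [← this]
      congr 1
      ext z
      constructor
      · rintro ⟨⟨⟨x, y⟩, z⟩, rfl⟩
        exact ⟨⟨x, y, z⟩, rfl⟩
      · rintro ⟨⟨x, y, z⟩, rfl⟩
        exact ⟨⟨⟨x, y⟩, z⟩, rfl⟩)
    (fun a i j => by
      rw [left_tmul, left_tmul, inner_tmul, inner_tmul, left_tmul, inner_tmul, left_tmul,
        inner_tmul])

lemma assoc_hom (E : HilbertBimodule A B) (F : HilbertBimodule B C) (G : HilbertBimodule C D)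
    (x : E.carrier) (y : F.carrier) (z : G.carrier) :
    (assoc E F G).hom.toLin (tmul _ _ (tmul _ _ x y) z) = tmul _ _ x (tmul _ _ y z) :=
  gramIso_hom _ _ _ (((x, y), z) : (E.carrier × F.carrier) × G.carrier)

lemma assoc_inv (E : HilbertBimodule A B) (F : HilbertBimodule B C) (G : HilbertBimodule C D)
    (x : E.carrier) (y : F.carrier) (z : G.carrier) :
    (assoc E F G).inv.toLin (tmul _ _ x (tmul _ _ y z)) = tmul _ _ (tmul _ _ x y) z :=
  gramIso_inv _ _ _ (((x, y), z) : (E.carrier × F.carrier) × G.carrier)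

/-- An element of the identity bimodule as an element of the algebra. -/
def ofId [FiniteDimensional ℂ A] (x : (id A).carrier) : A := x

/-- An element of the algebra as an element of the identity bimodule. -/
def toId [FiniteDimensional ℂ A] (x : A) : (id A).carrier := x

@[simp] lemma ofId_toId [FiniteDimensional ℂ A] (x : A) : ofId (toId x) = x := rfl

lemma inner_id [FiniteDimensional ℂ A] (x y : (id A).carrier) :
    (id A).inner x y = star (ofId x) * ofId y := rfl

lemma ofId_left [FiniteDimensional ℂ A] (a : A) (x : (id A).carrier) :
    ofId ((id A).left a x) = a * ofId x := rfl

lemma ofId_r [FiniteDimensional ℂ A] (a : A) (x : (id A).carrier) :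
    ofId ((id A).r x a) = ofId x * a := rfl

/-- The left unitor `a ⊗ x ↦ a.x`. -/
def leftUnitor [FiniteDimensional ℂ A] (E : HilbertBimodule A B) : (id A).comp E ≅ E :=
  gramIso (fun p : (id A).carrier × E.carrier => tmul (id A) E p.1 p.2)
    (fun p => E.left (ofId p.1) p.2)
    span_tmul
    (by
      rw [eq_top_iff]
      rintro x -
      exact Submodule.subset_span ⟨(toId 1, x), by simp⟩)
    (fun a i j => by
      rw [left_tmul, inner_tmul, left_left, E.inner_left, left_left, inner_id, ofId_left])

lemma leftUnitor_hom [FiniteDimensional ℂ A] (E : HilbertBimodule A B) (a : (id A).carrier)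
    (x : E.carrier) : (leftUnitor E).hom.toLin (tmul (id A) E a x) = E.left (ofId a) x :=
  gramIso_hom _ _ _ ((a, x) : (id A).carrier × E.carrier)

/-- The right unitor `x ⊗ b ↦ x.b`. -/
def rightUnitor [FiniteDimensional ℂ B] (E : HilbertBimodule A B) : E.comp (id B) ≅ E :=
  gramIso (fun p : E.carrier × (id B).carrier => tmul E (id B) p.1 p.2)
    (fun p => E.r p.1 (ofId p.2))
    span_tmul
    (by
      rw [eq_top_iff]
      rintro x -
      exact Submodule.subset_span ⟨(x, toId 1), E.r_one x⟩)
    (fun a i j => by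
      have : E.left a (E.r j.1 (ofId j.2)) = E.r (E.left a j.1) (ofId j.2) := E.left_right _ _ _
      rw [left_tmul, inner_tmul, r_inner, this, inner_r, inner_id, ofId_left])

lemma rightUnitor_hom [FiniteDimensional ℂ B] (E : HilbertBimodule A B) (x : E.carrier)
    (b : (id B).carrier) : (rightUnitor E).hom.toLin (tmul E (id B) x b) = E.r x (ofId b) :=
  gramIso_hom _ _ _ ((x, b) : E.carrier × (id B).carrier)

lemma assoc_dagger (E : HilbertBimodule A B) (F : HilbertBimodule B C) (G : HilbertBimodule C D) :
    (assoc E F G).hom.dagger = (assoc E F G).inv := by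
  unfold assoc
  exact gramIso_dagger ..

lemma leftUnitor_dagger [FiniteDimensional ℂ A] (E : HilbertBimodule A B) :
    (leftUnitor E).hom.dagger = (leftUnitor E).inv := by
  unfold leftUnitor
  exact gramIso_dagger ..

lemma rightUnitor_dagger [FiniteDimensional ℂ B] (E : HilbertBimodule A B) :
    (rightUnitor E).hom.dagger = (rightUnitor E).inv := by
  unfold rightUnitor
  exact gramIso_dagger ..

lemma ext_tmul₃ {E : HilbertBimodule A B} {F : HilbertBimodule B C} {G : HilbertBimodule C D}
    {H : HilbertBimodule A D} {S T : Intertwiner ((E.comp F).comp G) H}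
    (h : ∀ x y z, S.toLin (tmul _ _ (tmul _ _ x y) z) = T.toLin (tmul _ _ (tmul _ _ x y) z)) :
    S = T :=
  ext_span (span_tmul' (h := fun p : E.carrier × F.carrier => tmul E F p.1 p.2)
      (k := fun z : G.carrier => z) span_tmul (span_id G)) fun p => h p.1.1 p.1.2 p.2

lemma assoc_naturality {E E' : HilbertBimodule A B} {F F' : HilbertBimodule B C}
    {G G' : HilbertBimodule C D} (S : Intertwiner E E') (T : Intertwiner F F')
    (R : Intertwiner G G') :
    vcomp (hcomp (hcomp S T) R) (assoc E' F' G').hom =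
      vcomp (assoc E F G).hom (hcomp S (hcomp T R)) := by
  refine ext_tmul₃ fun x y z => ?_
  change (assoc E' F' G').hom.toLin (tmul _ _ (tmul _ _ (S.toLin x) (T.toLin y)) (R.toLin z)) =
    (hcomp S (hcomp T R)).toLin ((assoc E F G).hom.toLin _)
  rw [assoc_hom, assoc_hom]
  rfl

lemma leftUnitor_naturality [FiniteDimensional ℂ A] {E E' : HilbertBimodule A B}
    (S : Intertwiner E E') :
    vcomp (hcomp (Intertwiner.id (id A)) S) (leftUnitor E').hom = vcomp (leftUnitor E).hom S := by
  refine ext_tmul fun a x => ?_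
  change (leftUnitor E').hom.toLin (tmul (id A) E' a (S.toLin x)) =
    S.toLin ((leftUnitor E).hom.toLin _)
  rw [leftUnitor_hom, leftUnitor_hom, S.map_left]

lemma rightUnitor_naturality [FiniteDimensional ℂ B] {E E' : HilbertBimodule A B}
    (S : Intertwiner E E') :
    vcomp (hcomp S (Intertwiner.id (id B))) (rightUnitor E').hom = vcomp (rightUnitor E).hom S := by
  refine ext_tmul fun x b => ?_
  change (rightUnitor E').hom.toLin (tmul E' (id B) (S.toLin x) b) =
    S.toLin ((rightUnitor E).hom.toLin _)
  rw [rightUnitor_hom, rightUnitor_hom, S.map_r]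

lemma tmul_r (E : HilbertBimodule A B) (F : HilbertBimodule B C) (x : E.carrier) (b : B)
    (y : F.carrier) : tmul E F (E.r x b) y = tmul E F x (F.left b y) := by
  apply (E.comp F).ext_inner
  intro z
  induction z using tmul_ind with
  | zero =>
    have h0 : ∀ w, (E.comp F).inner 0 w = 0 := fun w => by
      rw [← (E.comp F).star_inner, inner_zero, star_zero]
    rw [h0, h0]
  | add z w h h' => rw [add_inner, add_inner, h, h']
  | tmul x' y' => rw [inner_tmul, inner_tmul, inner_r, left_left]

lemma pentagon {A B C D K : Type u} [CStarAlgebra A] [CStarAlgebra B] [CStarAlgebra C]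
    [CStarAlgebra D] [CStarAlgebra K] (E : HilbertBimodule A B) (F : HilbertBimodule B C)
    (G : HilbertBimodule C D) (H : HilbertBimodule D K) :
    vcomp (hcomp (assoc E F G).hom (Intertwiner.id H)) (vcomp (assoc E (F.comp G) H).hom
      (hcomp (Intertwiner.id E) (assoc F G H).hom)) =
      vcomp (assoc (E.comp F) G H).hom (assoc E F (G.comp H)).hom := by
  have hs := span_tmul' (E := (E.comp F).comp G) (F := H)
    (span_tmul' (h := fun p : E.carrier × F.carrier => tmul E F p.1 p.2)
      (k := fun z : G.carrier => z) span_tmul (span_id G)) (span_id H)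
  refine ext_span hs fun p => ?_
  obtain ⟨⟨⟨x, y⟩, z⟩, w⟩ := p
  change (hcomp (Intertwiner.id E) (assoc F G H).hom).toLin
      ((assoc E (F.comp G) H).hom.toLin (tmul _ _
        ((assoc E F G).hom.toLin (tmul _ _ (tmul _ _ x y) z)) w)) =
      (assoc E F (G.comp H)).hom.toLin
        ((assoc (E.comp F) G H).hom.toLin (tmul _ _ (tmul _ _ (tmul _ _ x y) z) w))
  rw [assoc_hom, assoc_hom, assoc_hom, assoc_hom, hcomp_tmul, assoc_hom]
  rfl

lemma triangle [FiniteDimensional ℂ B] (E : HilbertBimodule A B) (F : HilbertBimodule B C) :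
    vcomp (assoc E (id B) F).hom (hcomp (Intertwiner.id E) (leftUnitor F).hom) =
      hcomp (rightUnitor E).hom (Intertwiner.id F) := by
  refine ext_tmul₃ fun x b y => ?_
  change (hcomp (Intertwiner.id E) (leftUnitor F).hom).toLin ((assoc E (id B) F).hom.toLin _) =
      tmul _ _ ((rightUnitor E).hom.toLin _) y
  rw [assoc_hom, hcomp_tmul, leftUnitor_hom, rightUnitor_hom, tmul_r]
  rfl

end HilbertBimodule

/-- Finite-dimensional C*-algebras, as the objects of a bicategory. -/
structure CStarAlg : Type (u + 1) where
  carrier : Type u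
  [cstarAlgebra : CStarAlgebra carrier]
  [finite : FiniteDimensional ℂ carrier]

attribute [instance] CStarAlg.cstarAlgebra CStarAlg.finite

namespace CStarAlg

open Intertwiner

instance : CategoryStruct.{u + 1} CStarAlg.{u} where
  Hom A B := HilbertBimodule A.carrier B.carrier
  id A := HilbertBimodule.id A.carrier
  comp E F := HilbertBimodule.comp E F

instance (A B : CStarAlg.{u}) : Category.{u} (A ⟶ B) :=
  inferInstanceAs (Category (HilbertBimodule A.carrier B.carrier))

/-- The bicategory of finite-dimensional C*-algebras, Hilbert bimodules and intertwiners. -/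
instance : Bicategory.{u, u + 1} CStarAlg.{u} where
  whiskerLeft E _ _ T := hcomp (Intertwiner.id E) T
  whiskerRight S F := hcomp S (Intertwiner.id F)
  associator E F G := HilbertBimodule.assoc E F G
  leftUnitor E := HilbertBimodule.leftUnitor E
  rightUnitor E := HilbertBimodule.rightUnitor E
  whiskerLeft_id E F := hcomp_id E F
  whiskerLeft_comp E _ _ _ T T' := hcomp_vcomp (Intertwiner.id E) (Intertwiner.id E) T T'
  id_whiskerLeft {A B E F} S :=
    ((Iso.eq_comp_inv (HilbertBimodule.leftUnitor F)).2
      (HilbertBimodule.leftUnitor_naturality S)).trans (Category.assoc _ _ _)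
  comp_whiskerLeft E F G G' T := by
    refine ((Iso.eq_comp_inv (HilbertBimodule.assoc E F G')).2 ?_).trans (Category.assoc _ _ _)
    refine Eq.trans ?_
      (HilbertBimodule.assoc_naturality (Intertwiner.id E) (Intertwiner.id F) T)
    rw [hcomp_id]; rfl
  id_whiskerRight E F := hcomp_id E F
  comp_whiskerRight S S' F := hcomp_vcomp S S' (Intertwiner.id F) (Intertwiner.id F)
  whiskerRight_id {A B E F} S :=
    ((Iso.eq_comp_inv (HilbertBimodule.rightUnitor F)).2
      (HilbertBimodule.rightUnitor_naturality S)).trans (Category.assoc _ _ _)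
  whiskerRight_comp {A B C D E E'} S F G := by
    refine (Iso.eq_inv_comp (HilbertBimodule.assoc E F G)).2 ?_
    refine Eq.trans ?_
      (HilbertBimodule.assoc_naturality S (Intertwiner.id F) (Intertwiner.id G)).symm
    rw [hcomp_id]; rfl
  whisker_assoc E F F' T G :=
    ((Iso.eq_comp_inv (HilbertBimodule.assoc E F' G)).2 <|
      HilbertBimodule.assoc_naturality (Intertwiner.id E) T (Intertwiner.id G)).trans
        (Category.assoc _ _ _)
  whisker_exchange {A B C E E' F F'} S T :=
    Intertwiner.exchange S T
  pentagon E F G H := by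
    exact HilbertBimodule.pentagon E F G H
  triangle {A B C} E F := HilbertBimodule.triangle E F

end CStarAlg

/-! ### Dagger bicategories and dagger pseudofunctors -/

/-- A dagger bicategory: an identity-on-objects, involutive, contravariant operation on 2-cells that
is compatible with horizontal composition and for which the coherence isomorphisms are unitary. -/
class DaggerBicategory (K : Type*) [Bicategory K] where
  dagger : ∀ {a b : K} {f g : a ⟶ b}, (f ⟶ g) → (g ⟶ f)
  dagger_dagger : ∀ {a b : K} {f g : a ⟶ b} (σ : f ⟶ g), dagger (dagger σ) = σ
  dagger_id : ∀ {a b : K} (f : a ⟶ b), dagger (𝟙 f) = 𝟙 f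
  dagger_comp : ∀ {a b : K} {f g h : a ⟶ b} (σ : f ⟶ g) (τ : g ⟶ h),
    dagger (σ ≫ τ) = dagger τ ≫ dagger σ
  dagger_whiskerLeft : ∀ {a b c : K} (f : a ⟶ b) {g h : b ⟶ c} (σ : g ⟶ h),
    dagger (f ◁ σ) = f ◁ dagger σ
  dagger_whiskerRight : ∀ {a b c : K} {f g : a ⟶ b} (σ : f ⟶ g) (h : b ⟶ c),
    dagger (σ ▷ h) = dagger σ ▷ h
  dagger_associator : ∀ {a b c d : K} (f : a ⟶ b) (g : b ⟶ c) (h : c ⟶ d),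
    dagger (α_ f g h).hom = (α_ f g h).inv
  dagger_leftUnitor : ∀ {a b : K} (f : a ⟶ b), dagger (λ_ f).hom = (λ_ f).inv
  dagger_rightUnitor : ∀ {a b : K} (f : a ⟶ b), dagger (ρ_ f).hom = (ρ_ f).inv

/-- A dagger pseudofunctor: a pseudofunctor that preserves the dagger of 2-cells and whose
coherence isomorphisms are unitary. -/
structure IsDaggerPseudofunctor {K L : Type*} [Bicategory K] [Bicategory L] [DaggerBicategory K]
    [DaggerBicategory L] (F : K ⥤ᵖ L) : Prop where
  map_dagger : ∀ {a b : K} {f g : a ⟶ b} (σ : f ⟶ g),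
    F.map₂ (DaggerBicategory.dagger σ) = DaggerBicategory.dagger (F.map₂ σ)
  dagger_mapId : ∀ a : K, DaggerBicategory.dagger (F.mapId a).hom = (F.mapId a).inv
  dagger_mapComp : ∀ {a b c : K} (f : a ⟶ b) (g : b ⟶ c),
    DaggerBicategory.dagger (F.mapComp f g).hom = (F.mapComp f g).inv

/-- The dagger of `GAf` is `σ†(q, p) = σ(p, q)`. -/
instance : DaggerBicategory GAf.{u} where
  dagger σ := Protransformation.dagger σ
  dagger_dagger _ := rfl
  dagger_id f := Protransformation.dagger_id f
  dagger_comp σ τ := Protransformation.dagger_vcomp σ τ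
  dagger_whiskerLeft f _ _ σ :=
    (Protransformation.dagger_hcomp (Protransformation.id f) σ).trans
      (congrArg (fun x => Protransformation.hcomp x _) (Protransformation.dagger_id f))
  dagger_whiskerRight σ h :=
    (Protransformation.dagger_hcomp σ (Protransformation.id h)).trans
      (congrArg (fun x => Protransformation.hcomp _ x) (Protransformation.dagger_id h))
  dagger_associator _ _ _ := rfl
  dagger_leftUnitor _ := rfl
  dagger_rightUnitor _ := rfl

/-- The dagger of the bicategory of C*-algebras is the adjoint of intertwiners. -/
instance : DaggerBicategory CStarAlg.{u} where
  dagger S := Intertwiner.dagger S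
  dagger_dagger S := Intertwiner.dagger_dagger S
  dagger_id f := Intertwiner.dagger_id f
  dagger_comp S T := Intertwiner.dagger_vcomp S T
  dagger_whiskerLeft f _ _ S :=
    (Intertwiner.dagger_hcomp (Intertwiner.id f) S).trans
      (congrArg (fun x => Intertwiner.hcomp x _) (Intertwiner.dagger_id f))
  dagger_whiskerRight S h :=
    (Intertwiner.dagger_hcomp S (Intertwiner.id h)).trans
      (congrArg (fun x => Intertwiner.hcomp _ x) (Intertwiner.dagger_id h))
  dagger_associator E F G := HilbertBimodule.assoc_dagger E F G
  dagger_leftUnitor E := HilbertBimodule.leftUnitor_dagger E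
  dagger_rightUnitor E := HilbertBimodule.rightUnitor_dagger E

/-! ### Quantization -/

section sums

variable {A : Type u} [FiniteGroupoid A] {M : Type*} [AddCommMonoid M]

lemma sum_precomp {a b c : A} (f : a ⟶ b) (F : (a ⟶ c) → M) :
    ∑ g : b ⟶ c, F (f ≫ g) = ∑ g : a ⟶ c, F g :=
  Equiv.sum_comp (⟨fun g => f ≫ g, fun g => Groupoid.inv f ≫ g, fun g => by simp,
    fun g => by simp⟩ : (b ⟶ c) ≃ (a ⟶ c)) F

lemma sum_postcomp {a b c : A} (f : b ⟶ c) (F : (a ⟶ c) → M) :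
    ∑ g : a ⟶ b, F (g ≫ f) = ∑ g : a ⟶ c, F g :=
  Equiv.sum_comp (⟨fun g => g ≫ f, fun g => g ≫ Groupoid.inv f, fun g => by simp,
    fun g => by simp⟩ : (a ⟶ b) ≃ (a ⟶ c)) F

lemma sum_inv {a b : A} (F : (a ⟶ b) → M) :
    ∑ g : b ⟶ a, F (Groupoid.inv g) = ∑ g : a ⟶ b, F g :=
  Equiv.sum_comp (⟨fun g => Groupoid.inv g, fun g => Groupoid.inv g, fun g => by simp,
    fun g => by simp⟩ : (b ⟶ a) ≃ (a ⟶ b)) F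

lemma sum_l {B : Type u} [FiniteGroupoid B] (P : FreeProfunctor A B) {a a' : A} {b : B}
    (f : a ⟶ a') (F : P.obj a' b → M) : ∑ p : P.obj a b, F (P.l f p) = ∑ p : P.obj a' b, F p :=
  Equiv.sum_comp (⟨fun p => P.l f p, fun p => P.l (Groupoid.inv f) p,
    fun p => by simp [FreeProfunctor.l_l], fun p => by simp [FreeProfunctor.l_l]⟩ :
    P.obj a b ≃ P.obj a' b) F

lemma sum_r {B : Type u} [FiniteGroupoid B] (P : FreeProfunctor A B) {a : A} {b b' : B}
    (g : b' ⟶ b) (F : P.obj a b' → M) : ∑ p : P.obj a b, F (P.r p g) = ∑ p : P.obj a b', F p :=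
  Equiv.sum_comp (⟨fun p => P.r p g, fun p => P.r p (Groupoid.inv g),
    fun p => by simp [FreeProfunctor.r_r], fun p => by simp [FreeProfunctor.r_r]⟩ :
    P.obj a b ≃ P.obj a b') F

lemma sum_swap {ι κ : Type*} [Fintype ι] [Fintype κ] {α : ι → Type*} {β : κ → Type*}
    [∀ i, Fintype (α i)] [∀ k, Fintype (β k)] (F : ∀ i, α i → ∀ k, β k → M) :
    ∑ i, ∑ x : α i, ∑ k, ∑ y : β k, F i x k y = ∑ k, ∑ y : β k, ∑ i, ∑ x : α i, F i x k y := by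
  calc _ = ∑ i, ∑ x : α i, ∑ k : Sigma β, F i x k.1 k.2 := by simp only [Fintype.sum_sigma]
    _ = ∑ i : Sigma α, ∑ k : Sigma β, F i.1 i.2 k.1 k.2 := by rw [Fintype.sum_sigma]
    _ = ∑ k : Sigma β, ∑ i : Sigma α, F i.1 i.2 k.1 k.2 := Finset.sum_comm
    _ = _ := by simp only [Fintype.sum_sigma]

end sums

/-- The groupoid algebra `ℂA`: the vector space generated by the morphisms of `A`, an element `x`
being given by its coefficients `x a b f` at the morphisms `f : b ⟶ a`. -/
def GroupoidAlgebra (A : Type u) [FiniteGroupoid A] : Type u := ∀ a b : A, (b ⟶ a) → ℂ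

namespace GroupoidAlgebra

variable {A : Type u} [FiniteGroupoid A]

instance : AddCommGroup (GroupoidAlgebra A) :=
  inferInstanceAs (AddCommGroup (∀ a b : A, (b ⟶ a) → ℂ))

instance : Module ℂ (GroupoidAlgebra A) :=
  inferInstanceAs (Module ℂ (∀ a b : A, (b ⟶ a) → ℂ))

instance : FiniteDimensional ℂ (GroupoidAlgebra A) :=
  inferInstanceAs (FiniteDimensional ℂ (∀ a b : A, (b ⟶ a) → ℂ))

@[ext] lemma ext {x y : GroupoidAlgebra A} (h : ∀ a b (f : b ⟶ a), x a b f = y a b f) : x = y :=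
  funext fun a => funext fun b => funext fun f => h a b f

@[simp] lemma add_apply (x y : GroupoidAlgebra A) {a b : A} (f : b ⟶ a) :
    (x + y) a b f = x a b f + y a b f := rfl

@[simp] lemma smul_apply (c : ℂ) (x : GroupoidAlgebra A) {a b : A} (f : b ⟶ a) :
    (c • x) a b f = c * x a b f := rfl

@[simp] lemma zero_apply {a b : A} (f : b ⟶ a) : (0 : GroupoidAlgebra A) a b f = 0 := rfl

open scoped Classical in
/-- The basis element `f` of `ℂA`. -/
def single {a₀ b₀ : A} (f₀ : b₀ ⟶ a₀) : GroupoidAlgebra A := fun a b f =>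
  if (⟨a, b, f⟩ : Σ a b : A, (b ⟶ a)) = ⟨a₀, b₀, f₀⟩ then 1 else 0

/-- The product, the bilinear extension of `f ⋆ g = fg` (which is `g ≫ f` in diagrammatic order) for
composable `f`, `g`, and `f ⋆ g = 0` otherwise. -/
instance : Mul (GroupoidAlgebra A) :=
  ⟨fun x y a c h => ∑ b, ∑ f : b ⟶ a, x a b f * y b c (h ≫ Groupoid.inv f)⟩

/-- The unit, the sum of all identity morphisms. -/
instance : One (GroupoidAlgebra A) := ⟨∑ a : A, single (𝟙 a)⟩

/-- The involution, the conjugate linear extension of `f* = f⁻¹`. -/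
instance : Star (GroupoidAlgebra A) :=
  ⟨fun x a b f => (starRingEnd ℂ) (x b a (Groupoid.inv f))⟩

lemma mul_apply (x y : GroupoidAlgebra A) {a c : A} (h : c ⟶ a) :
    (x * y) a c h = ∑ b, ∑ f : b ⟶ a, x a b f * y b c (h ≫ Groupoid.inv f) := rfl

lemma star_apply (x : GroupoidAlgebra A) {a b : A} (f : b ⟶ a) :
    (star x) a b f = (starRingEnd ℂ) (x b a (Groupoid.inv f)) := rfl

lemma sum_apply {ι : Type*} (s : Finset ι) (x : ι → GroupoidAlgebra A) {a b : A} (f : b ⟶ a) :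
    (∑ i ∈ s, x i) a b f = ∑ i ∈ s, x i a b f := by
  have h1 : (∑ i ∈ s, x i) a = ∑ i ∈ s, x i a := Finset.sum_apply a s x
  rw [h1, Finset.sum_apply, Finset.sum_apply]

open scoped Classical in
lemma one_apply_self {a : A} (f : a ⟶ a) :
    (1 : GroupoidAlgebra A) a a f = if f = 𝟙 a then 1 else 0 := by
  change (∑ a : A, single (𝟙 a)) a a f = _
  rw [sum_apply, Finset.sum_eq_single a]
  · simp [single]
  · intro b _ hb
    simp [single, Ne.symm hb]
  · simp

lemma one_apply_ne {a b : A} (f : b ⟶ a) (h : b ≠ a) : (1 : GroupoidAlgebra A) a b f = 0 := by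
  change (∑ a : A, single (𝟙 a)) a b f = _
  rw [sum_apply]
  refine Finset.sum_eq_zero fun c _ => ?_
  rw [single, if_neg]
  intro h'
  simp only [Sigma.mk.injEq] at h'
  obtain ⟨rfl, h'⟩ := h'
  have := congrArg Sigma.fst (eq_of_heq h')
  exact h this

lemma sum_one_mul {M : Type*} [AddCommGroup M] [Module ℂ M] (a : A) (F : ∀ b : A, (b ⟶ a) → M) :
    ∑ b, ∑ f : b ⟶ a, (1 : GroupoidAlgebra A) a b f • F b f = F a (𝟙 a) := by
  classical
  rw [Finset.sum_eq_single a]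
  · simp [one_apply_self]
  · intro b _ hb
    simp [one_apply_ne _ hb]
  · simp

lemma sum_mul_one {M : Type*} [AddCommGroup M] [Module ℂ M] (b : A) (F : ∀ a : A, (b ⟶ a) → M) :
    ∑ a, ∑ f : b ⟶ a, (1 : GroupoidAlgebra A) a b f • F a f = F b (𝟙 b) := by
  classical
  rw [Finset.sum_eq_single b]
  · simp [one_apply_self]
  · intro a _ ha
    simp [one_apply_ne _ (Ne.symm ha)]
  · simp

/-- The product as a sum over the second factor. -/
lemma mul_apply' (x y : GroupoidAlgebra A) {a c : A} (h : c ⟶ a) :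
    (x * y) a c h = ∑ b, ∑ g : c ⟶ b, x a b (Groupoid.inv g ≫ h) * y b c g := by
  rw [mul_apply]
  refine Finset.sum_congr rfl fun b _ => ?_
  rw [← sum_inv (fun f : b ⟶ a => x a b f * y b c (h ≫ Groupoid.inv f)),
    ← sum_precomp h]
  simp

instance : Ring (GroupoidAlgebra A) where
  __ := (inferInstance : AddCommGroup (GroupoidAlgebra A))
  left_distrib x y z := by
    ext a b f
    simp only [mul_apply, add_apply, mul_add, Finset.sum_add_distrib]
  right_distrib x y z := by
    ext a b f
    simp only [mul_apply, add_apply, add_mul, Finset.sum_add_distrib]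
  zero_mul x := by ext; simp [mul_apply]
  mul_zero x := by ext; simp [mul_apply]
  mul_assoc x y z := by
    ext a d h
    rw [mul_apply' (x * y), mul_apply x]
    simp only [mul_apply x y, mul_apply' y z, Finset.sum_mul, Finset.mul_sum]
    rw [sum_swap]
    simp only [mul_assoc, Category.assoc]
  one_mul x := by
    ext a b f
    rw [mul_apply]
    have := sum_one_mul a (fun c g => x c b (f ≫ Groupoid.inv g))
    simpa using this
  mul_one x := by
    ext a b f
    rw [mul_apply']
    have := sum_mul_one b (fun c g => x a c (Groupoid.inv g ≫ f))
    simpa [mul_comm] using this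

instance : Algebra ℂ (GroupoidAlgebra A) :=
  Algebra.ofModule
    (fun c x y => by ext; simp [mul_apply, Finset.mul_sum, mul_assoc])
    (fun c x y => by ext; simp [mul_apply, Finset.mul_sum, mul_left_comm])

instance : StarRing (GroupoidAlgebra A) where
  star_involutive x := by ext; simp [star_apply]
  star_mul x y := by
    ext a c h
    rw [star_apply, mul_apply, mul_apply']
    simp only [map_sum, map_mul, star_apply]
    refine Finset.sum_congr rfl fun b _ => ?_
    rw [← sum_inv]
    refine Finset.sum_congr rfl fun f _ => ?_
    rw [mul_comm]
    simp
  star_add x y := by ext; simp [star_apply]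

instance : StarModule ℂ (GroupoidAlgebra A) where
  star_smul c x := by ext; simp [star_apply]

/-- The matrices of the regular representation. -/
def regularFun (x : GroupoidAlgebra A) (c : A) : Matrix (Σ a : A, c ⟶ a) (Σ a : A, c ⟶ a) ℂ :=
  Matrix.of fun p q => x p.1 q.1 (Groupoid.inv q.2 ≫ p.2)

lemma regularFun_one [DecidableEq A] [∀ a b : A, DecidableEq (a ⟶ b)] :
    regularFun (1 : GroupoidAlgebra A) = 1 := by
  ext c ⟨a, f⟩ ⟨b, g⟩
  rw [Pi.one_apply, Matrix.one_apply]
  change (1 : GroupoidAlgebra A) a b (Groupoid.inv g ≫ f) = _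
  by_cases hab : a = b
  · subst hab
    simp only [one_apply_self, Sigma.mk.injEq, heq_eq_eq, true_and]
    have : Groupoid.inv g ≫ f = 𝟙 a ↔ f = g := by
      refine ⟨fun h => ?_, fun h => by simp [h]⟩
      have := congrArg (g ≫ ·) h
      simpa using this
    simp only [this]
  · rw [one_apply_ne _ (Ne.symm hab), if_neg]
    intro h
    exact hab (congrArg Sigma.fst h)

/-- The regular representation of `ℂA`, on the direct sum over `c` of the spaces spanned by the
morphisms with source `c`. -/
def regular (A : Type u) [FiniteGroupoid A] [DecidableEq A] [∀ a b : A, DecidableEq (a ⟶ b)] :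
    GroupoidAlgebra A →⋆ₐ[ℂ] ∀ c : A, Matrix (Σ a : A, c ⟶ a) (Σ a : A, c ⟶ a) ℂ where
  toFun := regularFun
  map_zero' := rfl
  map_add' _ _ := rfl
  map_one' := regularFun_one
  map_mul' x y := by
    ext c ⟨a, f⟩ ⟨b, g⟩
    rw [Pi.mul_apply, Matrix.mul_apply, Fintype.sum_sigma]
    change (x * y) a b (Groupoid.inv g ≫ f) = ∑ d, ∑ m : c ⟶ d,
      x a d (Groupoid.inv m ≫ f) * y d b (Groupoid.inv g ≫ m)
    rw [mul_apply]
    refine Finset.sum_congr rfl fun d _ => ?_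
    rw [← sum_postcomp f, ← sum_inv]
    simp
  commutes' r := by
    rw [Algebra.algebraMap_eq_smul_one, Algebra.algebraMap_eq_smul_one, ← regularFun_one]
    rfl
  map_star' x := by
    ext c ⟨a, f⟩ ⟨b, g⟩
    rw [Pi.star_apply, Matrix.star_apply]
    change (star x) a b (Groupoid.inv g ≫ f) = star (x b a (Groupoid.inv f ≫ g))
    simp [star_apply]

lemma regular_injective [DecidableEq A] [∀ a b : A, DecidableEq (a ⟶ b)] :
    Function.Injective (regular A) := by
  intro x y h
  ext a b f
  have := congrFun (congrFun (congrFun h b) ⟨a, f⟩) ⟨b, 𝟙 b⟩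
  change x a b (Groupoid.inv (𝟙 b) ≫ f) = y a b (Groupoid.inv (𝟙 b) ≫ f) at this
  simpa using this

open scoped Classical Matrix.Norms.L2Operator in
/-- The C*-norm of `ℂA`, the operator norm in the regular representation. -/
instance : NormedRing (GroupoidAlgebra A) :=
  NormedRing.induced (GroupoidAlgebra A) (∀ c : A, Matrix (Σ a : A, c ⟶ a) (Σ a : A, c ⟶ a) ℂ)
    (regular A) regular_injective

open scoped Classical Matrix.Norms.L2Operator in
instance : NormedAlgebra ℂ (GroupoidAlgebra A) :=
  NormedAlgebra.induced ℂ (GroupoidAlgebra A)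
    (∀ c : A, Matrix (Σ a : A, c ⟶ a) (Σ a : A, c ⟶ a) ℂ) (regular A)

open scoped Classical Matrix.Norms.L2Operator in
instance : CStarRing (GroupoidAlgebra A) where
  norm_mul_self_le x := by
    have h : ‖regular A x‖ * ‖regular A x‖ ≤ ‖star (regular A x) * regular A x‖ :=
      CStarRing.norm_mul_self_le _
    rw [← map_star, ← map_mul] at h
    exact h

instance : CompleteSpace (GroupoidAlgebra A) := FiniteDimensional.complete ℂ _

instance : CStarAlgebra (GroupoidAlgebra A) where

end GroupoidAlgebra

/-- The vector space `⊕_{b,a} ℂP_{b,a}`, an element `ξ` being given by its coefficients `ξ a b p` at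
the elements `p ∈ P_{b,a}`. -/
def ProfunctorSpace {A B : Type u} [FiniteGroupoid A] [FiniteGroupoid B]
    (P : FreeProfunctor A B) : Type u := ∀ (a : A) (b : B), P.obj a b → ℂ

namespace ProfunctorSpace

open GroupoidAlgebra FreeProfunctor

variable {A B : Type u} [FiniteGroupoid A] [FiniteGroupoid B] (P : FreeProfunctor A B)

instance : AddCommGroup (ProfunctorSpace P) :=
  inferInstanceAs (AddCommGroup (∀ (a : A) (b : B), P.obj a b → ℂ))

instance : Module ℂ (ProfunctorSpace P) :=
  inferInstanceAs (Module ℂ (∀ (a : A) (b : B), P.obj a b → ℂ))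

instance : FiniteDimensional ℂ (ProfunctorSpace P) :=
  inferInstanceAs (FiniteDimensional ℂ (∀ (a : A) (b : B), P.obj a b → ℂ))

variable {P}

@[ext] lemma ext {ξ η : ProfunctorSpace P} (h : ∀ a b (p : P.obj a b), ξ a b p = η a b p) :
    ξ = η :=
  funext fun a => funext fun b => funext fun p => h a b p

@[simp] lemma add_apply (ξ η : ProfunctorSpace P) {a : A} {b : B} (p : P.obj a b) :
    (ξ + η) a b p = ξ a b p + η a b p := rfl

@[simp] lemma smul_apply (c : ℂ) (ξ : ProfunctorSpace P) {a : A} {b : B} (p : P.obj a b) :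
    (c • ξ) a b p = c * ξ a b p := rfl

@[simp] lemma zero_apply {a : A} {b : B} (p : P.obj a b) :
    (0 : ProfunctorSpace P) a b p = 0 := rfl

open scoped Classical in
/-- The basis element `p`. -/
def single {a₀ : A} {b₀ : B} (p₀ : P.obj a₀ b₀) : ProfunctorSpace P := fun a b p =>
  if (⟨a, b, p⟩ : Σ (a : A) (b : B), P.obj a b) = ⟨a₀, b₀, p₀⟩ then 1 else 0

/-- The left action, the bilinear extension of the action `f.p` of morphisms (and zero if `f.p` is
not defined). -/
def lact (x : GroupoidAlgebra A) (ξ : ProfunctorSpace P) : ProfunctorSpace P :=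
  fun a b p => ∑ a', ∑ f : a' ⟶ a, x a a' f * ξ a' b (P.l (Groupoid.inv f) p)

/-- The right action, the bilinear extension of the action `p.g` of morphisms (and zero if `p.g` is
not defined). -/
def ract (ξ : ProfunctorSpace P) (y : GroupoidAlgebra B) : ProfunctorSpace P :=
  fun a b' p => ∑ b, ∑ g : b' ⟶ b, ξ a b (P.r p (Groupoid.inv g)) * y b b' g

/-- The `ℂB`-valued inner product, the sesquilinear extension of `⟨p, p.g⟩ = g`, and `⟨p, p'⟩ = 0` if
`p'` is not of the form `p.g`. -/
def inner (ξ η : ProfunctorSpace P) : GroupoidAlgebra B :=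
  fun b b' g => ∑ a, ∑ p : P.obj a b, (starRingEnd ℂ) (ξ a b p) * η a b' (P.r p g)

lemma lact_apply (x : GroupoidAlgebra A) (ξ : ProfunctorSpace P) {a : A} {b : B} (p : P.obj a b) :
    lact x ξ a b p = ∑ a', ∑ f : a' ⟶ a, x a a' f * ξ a' b (P.l (Groupoid.inv f) p) := rfl

lemma ract_apply (ξ : ProfunctorSpace P) (y : GroupoidAlgebra B) {a : A} {b : B} (p : P.obj a b) :
    ract ξ y a b p = ∑ b', ∑ g : b ⟶ b', ξ a b' (P.r p (Groupoid.inv g)) * y b' b g := rfl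

lemma inner_apply (ξ η : ProfunctorSpace P) {b b' : B} (g : b' ⟶ b) :
    inner ξ η b b' g = ∑ a, ∑ p : P.obj a b, (starRingEnd ℂ) (ξ a b p) * η a b' (P.r p g) := rfl

lemma one_lact (ξ : ProfunctorSpace P) : lact 1 ξ = ξ := by
  ext a b p
  rw [lact_apply]
  have := sum_one_mul a (fun a' f => ξ a' b (P.l (Groupoid.inv f) p))
  simpa using this

lemma ract_one (ξ : ProfunctorSpace P) : ract ξ 1 = ξ := by
  ext a b p
  rw [ract_apply]
  have := sum_mul_one b (fun b' g => ξ a b' (P.r p (Groupoid.inv g)))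
  simpa [mul_comm] using this

lemma mul_lact (x y : GroupoidAlgebra A) (ξ : ProfunctorSpace P) :
    lact (x * y) ξ = lact x (lact y ξ) := by
  ext a b p
  rw [lact_apply, lact_apply]
  simp only [lact_apply, mul_apply, Finset.mul_sum, Finset.sum_mul]
  rw [sum_swap]
  refine Finset.sum_congr rfl fun d _ => Finset.sum_congr rfl fun f _ =>
    Finset.sum_congr rfl fun c _ => ?_
  rw [← sum_postcomp f]
  refine Finset.sum_congr rfl fun g _ => ?_
  simp [P.l_l, mul_assoc]

lemma ract_mul (ξ : ProfunctorSpace P) (x y : GroupoidAlgebra B) :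
    ract ξ (x * y) = ract (ract ξ x) y := by
  ext a b p
  rw [ract_apply, ract_apply]
  simp only [ract_apply, mul_apply', Finset.mul_sum, Finset.sum_mul]
  rw [sum_swap]
  refine Finset.sum_congr rfl fun d _ => Finset.sum_congr rfl fun f _ =>
    Finset.sum_congr rfl fun c _ => ?_
  rw [← sum_precomp f]
  refine Finset.sum_congr rfl fun g _ => ?_
  simp [P.r_r, mul_assoc]

lemma lact_ract (x : GroupoidAlgebra A) (ξ : ProfunctorSpace P) (y : GroupoidAlgebra B) :
    lact x (ract ξ y) = ract (lact x ξ) y := by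
  ext a b p
  rw [lact_apply, ract_apply]
  simp only [lact_apply, ract_apply, Finset.mul_sum, Finset.sum_mul]
  rw [sum_swap]
  simp only [P.l_r, mul_assoc]

lemma inner_ract (ξ η : ProfunctorSpace P) (y : GroupoidAlgebra B) :
    inner ξ (ract η y) = inner ξ η * y := by
  ext b b' g
  rw [inner_apply, mul_apply']
  simp only [inner_apply, ract_apply, Finset.mul_sum, Finset.sum_mul]
  rw [sum_swap]
  simp only [P.r_r, mul_assoc]

lemma star_inner (ξ η : ProfunctorSpace P) : star (inner ξ η) = inner η ξ := by
  ext b b' g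
  rw [star_apply, inner_apply, inner_apply, map_sum]
  refine Finset.sum_congr rfl fun a _ => ?_
  rw [map_sum, ← sum_r P g]
  refine Finset.sum_congr rfl fun p _ => ?_
  simp [P.r_r, mul_comm]

lemma inner_lact (x : GroupoidAlgebra A) (ξ η : ProfunctorSpace P) :
    inner (lact x ξ) η = inner ξ (lact (star x) η) := by
  ext b b' g
  rw [inner_apply, inner_apply]
  simp only [lact_apply, map_sum, Finset.mul_sum, Finset.sum_mul, map_mul, star_apply]
  have h : ∀ (F : ∀ a a' : A, (a' ⟶ a) → ℂ), (∑ a, ∑ a', ∑ f : a' ⟶ a, F a a' f) =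
      ∑ a, ∑ a', ∑ f : a' ⟶ a, F a' a (Groupoid.inv f) := fun F => by
    rw [Finset.sum_comm]
    simp only [sum_inv]
  have h1 : ∀ (F : ∀ (a : A) (p : P.obj a b) (a' : A), (a' ⟶ a) → ℂ),
      (∑ a, ∑ p, ∑ a', ∑ f : a' ⟶ a, F a p a' f) = ∑ a, ∑ a', ∑ f : a' ⟶ a, ∑ p, F a p a' f :=
    fun F => by
    refine Finset.sum_congr rfl fun a _ => ?_
    rw [Finset.sum_comm]
    refine Finset.sum_congr rfl fun a' _ => ?_
    rw [Finset.sum_comm]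
  rw [h1, h1, h]
  refine Finset.sum_congr rfl fun a _ => Finset.sum_congr rfl fun a' _ =>
    Finset.sum_congr rfl fun f _ => ?_
  rw [← sum_l P (Groupoid.inv f)]
  refine Finset.sum_congr rfl fun p _ => ?_
  simp [P.l_l, P.l_r]
  ring

lemma inner_definite (ξ : ProfunctorSpace P) (h : inner ξ ξ = 0) : ξ = 0 := by
  ext a b p
  have h1 : inner ξ ξ b b (𝟙 b) = 0 := by rw [h]; rfl
  have h2 : ∑ a, ∑ p : P.obj a b, ‖ξ a b p‖ ^ 2 = 0 := by
    rw [inner_apply] at h1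
    have h3 : ∀ z : ℂ, (starRingEnd ℂ) z * z = ((‖z‖ ^ 2 : ℝ) : ℂ) := fun z => by
      rw [mul_comm, Complex.mul_conj, Complex.normSq_eq_norm_sq]
    simp only [P.r_id, h3] at h1
    exact_mod_cast h1
  rw [Finset.sum_eq_zero_iff_of_nonneg
    (fun _ _ => Finset.sum_nonneg fun _ _ => by positivity)] at h2
  have h3 := h2 a (Finset.mem_univ a)
  rw [Finset.sum_eq_zero_iff_of_nonneg (fun _ _ => by positivity)] at h3
  have h4 := h3 p (Finset.mem_univ p)
  simpa using h4

open scoped Classical in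
/-- The element `w ∑_k ξ(p₀.k) k`, the sum being over the morphisms `k` with target `b₀`. -/
def cut (ξ : ProfunctorSpace P) (w : ℝ) {a : A} {b₀ : B} (p₀ : P.obj a b₀) : GroupoidAlgebra B :=
  fun b b' k => if h : b = b₀ then (w : ℂ) * ξ a b' (P.r p₀ (k ≫ eqToHom h)) else 0

lemma cut_self (ξ : ProfunctorSpace P) (w : ℝ) {a : A} {b₀ b : B} (p₀ : P.obj a b₀)
    (k : b ⟶ b₀) : cut ξ w p₀ b₀ b k = (w : ℂ) * ξ a b (P.r p₀ k) := by
  simp [cut]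

lemma cut_ne (ξ : ProfunctorSpace P) (w : ℝ) {a : A} {b₀ b b' : B} (p₀ : P.obj a b₀)
    (k : b' ⟶ b) (h : b ≠ b₀) : cut ξ w p₀ b b' k = 0 := by
  simp [cut, h]

lemma isPos_inner_self (ξ : ProfunctorSpace P) : IsPos (inner ξ ξ) := by
  classical
  -- the number of morphisms with source `b`
  let n : B → ℝ := fun b => ∑ b', ∑ _k : b ⟶ b', 1
  have hn : ∀ {b b' : B} (_ : b ⟶ b'), n b = n b' := fun k =>
    Finset.sum_congr rfl fun b' _ => (sum_precomp k (fun _ => (1 : ℝ))).symm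
  have hn0 : ∀ b, n b ≠ 0 := fun b => by
    have : 0 < n b := by
      refine Finset.sum_pos' (fun _ _ => Finset.sum_nonneg fun _ _ => zero_le_one) ⟨b, by simp, ?_⟩
      exact Finset.sum_pos (fun _ _ => zero_lt_one) ⟨𝟙 b, by simp⟩
    exact this.ne'
  have hnn : ∀ b, 0 ≤ n b := fun b =>
    Finset.sum_nonneg fun _ _ => Finset.sum_nonneg fun _ _ => zero_le_one
  let w : B → ℝ := fun b => Real.sqrt (n b)⁻¹
  have hw : ∀ b, w b * w b = (n b)⁻¹ := fun b => Real.mul_self_sqrt (inv_nonneg.2 (hnn b))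
  have key : inner ξ ξ = ∑ a, ∑ b₀, ∑ p₀ : P.obj a b₀, star (cut ξ (w b₀) p₀) * cut ξ (w b₀) p₀ := by
    ext b b' g
    have hc : ∀ (a : A) (b₀ : B) (p₀ : P.obj a b₀), (star (cut ξ (w b₀) p₀) * cut ξ (w b₀) p₀) b b' g =
        ∑ k : b ⟶ b₀, ((n b₀)⁻¹ : ℂ) *
          ((starRingEnd ℂ) (ξ a b (P.r p₀ k)) * ξ a b' (P.r p₀ (g ≫ k))) := by
      intro a b₀ p₀
      rw [mul_apply]
      rw [Finset.sum_eq_single b₀]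
      · rw [← sum_inv]
        refine Finset.sum_congr rfl fun k _ => ?_
        have h1 : Groupoid.inv (Groupoid.inv k) = k := by simp
        rw [star_apply, h1, cut_self, cut_self, map_mul, Complex.conj_ofReal,
          ← Complex.ofReal_inv, ← hw]
        push_cast
        ring
      · intro d _ hd
        refine Finset.sum_eq_zero fun k _ => ?_
        rw [star_apply, cut_ne _ _ _ _ hd, map_zero, zero_mul]
      · simp
    simp only [GroupoidAlgebra.sum_apply, hc]
    rw [inner_apply]
    refine Finset.sum_congr rfl fun a _ => ?_
    have h1 : ∀ b₀ : B, (∑ p₀ : P.obj a b₀, ∑ k : b ⟶ b₀, ((n b₀)⁻¹ : ℂ) *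
          ((starRingEnd ℂ) (ξ a b (P.r p₀ k)) * ξ a b' (P.r p₀ (g ≫ k)))) =
        (∑ k : b ⟶ b₀, ((n b)⁻¹ : ℂ)) *
          ∑ p : P.obj a b, (starRingEnd ℂ) (ξ a b p) * ξ a b' (P.r p g) := by
      intro b₀
      rw [Finset.sum_comm, Finset.sum_mul]
      refine Finset.sum_congr rfl fun k _ => ?_
      rw [← Finset.mul_sum, hn k]
      congr 1
      rw [← sum_r P k]
      simp only [P.r_r]
    simp only [h1]
    rw [← Finset.sum_mul]
    have h2 : (∑ b₀ : B, ∑ _k : b ⟶ b₀, ((n b)⁻¹ : ℂ)) = 1 := by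
      have h3 : (∑ b₀ : B, ∑ _k : b ⟶ b₀, (n b)⁻¹) = 1 := by
        calc _ = (n b)⁻¹ * n b := by simp only [n, Finset.mul_sum, mul_one]
          _ = 1 := inv_mul_cancel₀ (hn0 b)
      exact_mod_cast h3
    rw [h2, one_mul]
  rw [key]
  exact isPos_sum _ _ fun a _ => isPos_sum _ _ fun b _ => isPos_sum _ _ fun p _ => ⟨_, rfl⟩

end ProfunctorSpace

namespace FreeProfunctor

open ProfunctorSpace

variable {A B : Type u} [FiniteGroupoid A] [FiniteGroupoid B]

/-- The Hilbert bimodule `⊕_{b,a} ℂP_{b,a}` of a free profunctor `P`. -/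
def quantize (P : FreeProfunctor A B) :
    HilbertBimodule (GroupoidAlgebra A) (GroupoidAlgebra B) where
  carrier := ProfunctorSpace P
  left := AlgHom.ofLinearMap
    (LinearMap.mk₂ ℂ lact
      (fun x y ξ => by ext; simp [lact_apply, add_mul, Finset.sum_add_distrib])
      (fun c x ξ => by ext; simp [lact_apply, mul_assoc, Finset.mul_sum])
      (fun x ξ η => by ext; simp [lact_apply, mul_add, Finset.sum_add_distrib])
      (fun c x ξ => by ext; simp [lact_apply, mul_left_comm, Finset.mul_sum]))
    (LinearMap.ext one_lact) (fun x y => LinearMap.ext (mul_lact x y))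
  right := AlgHom.ofLinearMap
    (LinearMap.mk₂ ℂ (fun y ξ => ract ξ y.unop)
      (fun x y ξ => by ext; simp [ract_apply, mul_add, Finset.sum_add_distrib])
      (fun c x ξ => by ext; simp [ract_apply, mul_left_comm, Finset.mul_sum])
      (fun x ξ η => by ext; simp [ract_apply, add_mul, Finset.sum_add_distrib])
      (fun c x ξ => by ext; simp [ract_apply, mul_assoc, Finset.mul_sum]))
    (LinearMap.ext ract_one) (fun x y => LinearMap.ext fun ξ => ract_mul ξ y.unop x.unop)
  left_right x y ξ := lact_ract x ξ y.unop
  inner := inner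
  inner_add ξ η ζ := by
    ext
    simp [ProfunctorSpace.inner_apply, mul_add, Finset.sum_add_distrib]
  inner_right ξ η y := inner_ract ξ η y
  star_inner := star_inner
  inner_self_isPos := isPos_inner_self
  inner_definite := inner_definite
  inner_left x ξ η := inner_lact x ξ η

end FreeProfunctor

namespace Protransformation

open ProfunctorSpace

variable {A B : Type u} [FiniteGroupoid A] [FiniteGroupoid B] {P R : FreeProfunctor A B}

/-- The linear extension of `p ↦ ∑_q σ(p, q) q`, as a function. -/
def quantizeFun (σ : Protransformation P R) (ξ : ProfunctorSpace P) : ProfunctorSpace R :=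
  fun a b q => ∑ p : P.obj a b, ξ a b p * (σ.toFun p q : ℂ)

lemma quantizeFun_apply (σ : Protransformation P R) (ξ : ProfunctorSpace P) {a : A} {b : B}
    (q : R.obj a b) : σ.quantizeFun ξ a b q = ∑ p : P.obj a b, ξ a b p * (σ.toFun p q : ℂ) := rfl

lemma quantizeFun_add (σ : Protransformation P R) (ξ η : ProfunctorSpace P) :
    σ.quantizeFun (ξ + η) = σ.quantizeFun ξ + σ.quantizeFun η := by
  ext a b q
  rw [ProfunctorSpace.add_apply]
  simp only [quantizeFun_apply]
  rw [← Finset.sum_add_distrib]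
  exact Finset.sum_congr rfl fun p _ => add_mul _ _ _

lemma quantizeFun_smul (σ : Protransformation P R) (c : ℂ) (ξ : ProfunctorSpace P) :
    σ.quantizeFun (c • ξ) = c • σ.quantizeFun ξ := by
  ext a b q
  rw [ProfunctorSpace.smul_apply]
  simp only [quantizeFun_apply]
  rw [Finset.mul_sum]
  exact Finset.sum_congr rfl fun p _ => mul_assoc _ _ _

lemma quantizeFun_lact (σ : Protransformation P R) (x : GroupoidAlgebra A)
    (ξ : ProfunctorSpace P) : σ.quantizeFun (lact x ξ) = lact x (σ.quantizeFun ξ) := by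
  ext a b q
  simp only [quantizeFun_apply, lact_apply, Finset.sum_mul, Finset.mul_sum]
  rw [Finset.sum_comm]
  refine Finset.sum_congr rfl fun a' _ => ?_
  rw [Finset.sum_comm]
  refine Finset.sum_congr rfl fun f _ => ?_
  rw [← sum_l P f]
  refine Finset.sum_congr rfl fun p _ => ?_
  have := σ.l_l f p (R.l (Groupoid.inv f) q)
  simp only [R.l_l, P.l_l, Groupoid.inv_comp, Groupoid.comp_inv, R.l_id, P.l_id] at this ⊢
  rw [this, mul_assoc]

lemma quantizeFun_ract (σ : Protransformation P R) (ξ : ProfunctorSpace P)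
    (y : GroupoidAlgebra B) : σ.quantizeFun (ract ξ y) = ract (σ.quantizeFun ξ) y := by
  ext a b q
  simp only [quantizeFun_apply, ract_apply, Finset.sum_mul]
  rw [Finset.sum_comm]
  refine Finset.sum_congr rfl fun b' _ => ?_
  rw [Finset.sum_comm]
  refine Finset.sum_congr rfl fun g _ => ?_
  rw [← sum_r P g]
  refine Finset.sum_congr rfl fun p _ => ?_
  have := σ.r_r g p (R.r q (Groupoid.inv g))
  simp only [R.r_r, P.r_r, Groupoid.inv_comp, Groupoid.comp_inv, R.r_id, P.r_id] at this ⊢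
  rw [this]
  ring

/-- The intertwiner `p ↦ ∑_q σ(p, q) q` of a protransformation `σ`. -/
def quantize (σ : Protransformation P R) : Intertwiner P.quantize R.quantize where
  toLin :=
    { toFun := σ.quantizeFun
      map_add' := σ.quantizeFun_add
      map_smul' := σ.quantizeFun_smul }
  map_left x ξ := quantizeFun_lact σ x ξ
  map_right y ξ := quantizeFun_ract σ ξ y.unop

end Protransformation

/-- The data of the quantization `GAf → C*Alg`: its values on objects, morphisms and 2-morphisms. -/
def quantization : PrelaxFunctorStruct GAf.{u} CStarAlg.{u} where
  obj A := ⟨GroupoidAlgebra A.carrier⟩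
  map P := FreeProfunctor.quantize P
  map₂ σ := Protransformation.quantize σ

namespace ProfunctorSpace

open GroupoidAlgebra FreeProfunctor

variable {A B : Type u} [FiniteGroupoid A] [FiniteGroupoid B] {P : FreeProfunctor A B}

open scoped Classical in
lemma single_apply {a : A} {b : B} (p q : P.obj a b) :
    (single p : ProfunctorSpace P) a b q = if q = p then 1 else 0 := by
  simp [single]

lemma single_apply_ne_left {a a' : A} {b b' : B} (p : P.obj a b) (q : P.obj a' b') (h : a' ≠ a) :
    (single p : ProfunctorSpace P) a' b' q = 0 := by
  simp [single, h]

lemma single_apply_ne_right {a a' : A} {b b' : B} (p : P.obj a b) (q : P.obj a' b') (h : b' ≠ b) :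
    (single p : ProfunctorSpace P) a' b' q = 0 := by
  rw [single, if_neg]
  intro h'
  simp only [Sigma.mk.injEq] at h'
  obtain ⟨rfl, h'⟩ := h'
  exact h (congrArg Sigma.fst (eq_of_heq h'))

lemma gsingle_eq {a b : A} (f : b ⟶ a) :
    GroupoidAlgebra.single f = (single (ofHom f) : ProfunctorSpace (FreeProfunctor.id A)) := rfl

lemma gsingle_apply_ne_left {a a' b b' : A} (f : b ⟶ a) (g : b' ⟶ a') (h : a' ≠ a) :
    GroupoidAlgebra.single f a' b' g = 0 :=
  single_apply_ne_left (P := FreeProfunctor.id A) f g h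

lemma gsingle_apply_ne_right {a a' b b' : A} (f : b ⟶ a) (g : b' ⟶ a') (h : b' ≠ b) :
    GroupoidAlgebra.single f a' b' g = 0 :=
  single_apply_ne_right (P := FreeProfunctor.id A) f g h

open scoped Classical in
lemma gsingle_apply {a b : A} (f g : b ⟶ a) :
    GroupoidAlgebra.single f a b g = if g = f then 1 else 0 :=
  single_apply (P := FreeProfunctor.id A) f g

lemma lact_single {a a' : A} {b : B} (f : a ⟶ a') (p : P.obj a b) :
    lact (GroupoidAlgebra.single f) (single p) = single (P.l f p) := by
  classical
  ext a₁ b₁ q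
  rw [lact_apply]
  by_cases hb : b₁ = b
  swap
  · rw [single_apply_ne_right _ _ hb]
    exact Finset.sum_eq_zero fun _ _ => Finset.sum_eq_zero fun _ _ => by
      rw [single_apply_ne_right _ _ hb, mul_zero]
  by_cases ha : a₁ = a'
  swap
  · rw [single_apply_ne_left _ _ ha]
    exact Finset.sum_eq_zero fun _ _ => Finset.sum_eq_zero fun _ _ => by
      rw [gsingle_apply_ne_left _ _ ha, zero_mul]
  subst ha hb
  rw [Finset.sum_eq_single a (fun c _ hc => Finset.sum_eq_zero fun _ _ => by
    rw [gsingle_apply_ne_right _ _ hc, zero_mul]) (by simp)]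
  rw [Finset.sum_eq_single f (fun g _ hg => by rw [gsingle_apply, if_neg hg, zero_mul]) (by simp)]
  simp only [gsingle_apply, single_apply]
  have : P.l (Groupoid.inv f) q = p ↔ q = P.l f p := by
    constructor
    · rintro rfl; simp [P.l_l]
    · rintro rfl; simp [P.l_l]
  simp [-Groupoid.inv_eq_inv, this]

lemma ract_single {a : A} {b b' : B} (g : b' ⟶ b) (p : P.obj a b) :
    ract (single p) (GroupoidAlgebra.single g) = single (P.r p g) := by
  classical
  ext a₁ b₁ q
  rw [ract_apply]
  by_cases hb : b₁ = b'
  swap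
  · rw [single_apply_ne_right _ _ hb]
    exact Finset.sum_eq_zero fun _ _ => Finset.sum_eq_zero fun _ _ => by
      rw [gsingle_apply_ne_right _ _ hb, mul_zero]
  by_cases ha : a₁ = a
  swap
  · rw [single_apply_ne_left _ _ ha]
    exact Finset.sum_eq_zero fun _ _ => Finset.sum_eq_zero fun _ _ => by
      rw [single_apply_ne_left _ _ ha, zero_mul]
  subst ha hb
  rw [Finset.sum_eq_single b (fun c _ hc => Finset.sum_eq_zero fun _ _ => by
    rw [gsingle_apply_ne_left _ _ hc, mul_zero]) (by simp)]
  simp only [gsingle_apply, single_apply]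
  have : P.r q (Groupoid.inv g) = p ↔ q = P.r p g := by
    constructor
    · rintro rfl; simp [P.r_r]
    · rintro rfl; simp [P.r_r]
  simp [-Groupoid.inv_eq_inv, this]

lemma lact_id (x : GroupoidAlgebra A) (ξ : ProfunctorSpace (FreeProfunctor.id A)) :
    lact x ξ = (HMul.hMul (α := GroupoidAlgebra A) (β := GroupoidAlgebra A)
      (γ := GroupoidAlgebra A) x ξ) := by
  ext a b h
  rw [lact_apply]
  refine Finset.sum_congr rfl fun c _ => Finset.sum_congr rfl fun f _ => ?_
  congr 2
  exact toHom_l _ _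

/-- `f ⋆ g = fg` for composable `f` and `g`. -/
lemma gsingle_mul_gsingle {a b c : A} (f : b ⟶ a) (g : c ⟶ b) :
    GroupoidAlgebra.single f * GroupoidAlgebra.single g = GroupoidAlgebra.single (g ≫ f) := by
  have := lact_single (P := FreeProfunctor.id A) f (ofHom g)
  rw [lact_id] at this
  refine Eq.trans this ?_
  rw [gsingle_eq]
  congr 1
  exact toHom_l _ _

/-- `f ⋆ g = 0` for non-composable `f` and `g`. -/
lemma gsingle_mul_gsingle_of_ne {a b b' c : A} (f : b ⟶ a) (g : c ⟶ b') (h : b ≠ b') :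
    GroupoidAlgebra.single f * GroupoidAlgebra.single g = 0 := by
  ext a₁ c₁ k
  rw [mul_apply]
  refine Finset.sum_eq_zero fun d _ => Finset.sum_eq_zero fun l _ => ?_
  by_cases hd : d = b
  · rw [gsingle_apply_ne_left g _ (hd ▸ h), mul_zero]
  · rw [gsingle_apply_ne_right f _ hd, zero_mul]

/-- `f* = f⁻¹`. -/
lemma star_gsingle {a b : A} (f : b ⟶ a) :
    star (GroupoidAlgebra.single f) = GroupoidAlgebra.single (Groupoid.inv f) := by
  classical
  ext a₁ b₁ g
  rw [star_apply]
  by_cases hb : a₁ = b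
  swap
  · rw [gsingle_apply_ne_right _ _ hb, gsingle_apply_ne_left _ _ hb, map_zero]
  by_cases ha : b₁ = a
  swap
  · rw [gsingle_apply_ne_left _ _ ha, gsingle_apply_ne_right _ _ ha, map_zero]
  subst ha hb
  rw [gsingle_apply, gsingle_apply]
  have : Groupoid.inv g = f ↔ g = Groupoid.inv f := by
    constructor
    · rintro rfl; simp
    · rintro rfl; simp
  simp only [this]
  split_ifs <;> simp

/-- `⟨p, p.g⟩ = g`. -/
lemma inner_single {a : A} {b b' : B} (p : P.obj a b) (g : b' ⟶ b) :
    inner (single p) (single (P.r p g)) = GroupoidAlgebra.single g := by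
  classical
  ext b₁ b₂ h
  rw [inner_apply]
  by_cases hb : b₁ = b
  swap
  · rw [gsingle_apply_ne_left _ _ hb]
    exact Finset.sum_eq_zero fun _ _ => Finset.sum_eq_zero fun _ _ => by
      rw [single_apply_ne_right _ _ hb, map_zero, zero_mul]
  by_cases hb' : b₂ = b'
  swap
  · rw [gsingle_apply_ne_right _ _ hb']
    exact Finset.sum_eq_zero fun _ _ => Finset.sum_eq_zero fun _ _ => by
      rw [single_apply_ne_right _ _ hb', mul_zero]
  subst hb hb'
  rw [Finset.sum_eq_single a (fun c _ hc => Finset.sum_eq_zero fun _ _ => by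
    rw [single_apply_ne_left _ _ hc, map_zero, zero_mul]) (by simp)]
  rw [Finset.sum_eq_single p (fun q _ hq => by
    rw [single_apply, if_neg hq, map_zero, zero_mul]) (by simp)]
  rw [gsingle_apply, single_apply, single_apply]
  have : P.r p h = P.r p g ↔ h = g := ⟨fun e => P.right_free _ _ _ e, fun e => by rw [e]⟩
  simp [this]

/-- `⟨p, q⟩ = 0` if `q` is not in the orbit of `p`. -/
lemma inner_single_of_ne {a a' : A} {b b' : B} (p : P.obj a b) (q : P.obj a' b')
    (h : ¬ ∃ g : b' ⟶ b, (⟨a, P.r p g⟩ : Σ a, P.obj a b') = ⟨a', q⟩) :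
    inner (single p) (single q) = 0 := by
  classical
  ext b₁ b₂ k
  rw [inner_apply]
  refine Finset.sum_eq_zero fun a₁ _ => Finset.sum_eq_zero fun p₁ _ => ?_
  by_cases hb : b₁ = b
  swap
  · rw [single_apply_ne_right _ _ hb, map_zero, zero_mul]
  by_cases ha : a₁ = a
  swap
  · rw [single_apply_ne_left _ _ ha, map_zero, zero_mul]
  by_cases hb' : b₂ = b'
  swap
  · rw [single_apply_ne_right _ _ hb', mul_zero]
  by_cases ha' : a₁ = a'
  swap
  · rw [single_apply_ne_left _ _ ha', mul_zero]
  subst ha hb hb' ha'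
  rw [single_apply, single_apply]
  by_cases hp : p₁ = p
  · subst hp
    have : ¬ P.r p₁ k = q := fun e => h ⟨k, by rw [e]⟩
    rw [if_neg this, mul_zero]
  · simp [hp]

end ProfunctorSpace

open ProfunctorSpace in
lemma Protransformation.quantize_single {A B : Type u} [FiniteGroupoid A] [FiniteGroupoid B]
    {P R : FreeProfunctor A B} (σ : Protransformation P R) {a : A} {b : B} (p : P.obj a b) :
    σ.quantizeFun (single p) = ∑ q : R.obj a b, (σ.toFun p q : ℂ) • single q := by
  classical
  have hs : ∀ (s : Finset (R.obj a b)) (c : R.obj a b → ℂ) (a' : A) (b' : B) (r : R.obj a' b'),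
      (∑ q ∈ s, c q • (single q : ProfunctorSpace R)) a' b' r = ∑ q ∈ s, c q * single q a' b' r := by
    intro s c a' b' r
    induction s using Finset.induction_on with
    | empty => rfl
    | insert x s hx ih =>
      rw [Finset.sum_insert hx, Finset.sum_insert hx, ← ih]; rfl
  ext a' b' r
  rw [quantizeFun_apply, hs]
  by_cases hb : b' = b
  swap
  · rw [Finset.sum_eq_zero, Finset.sum_eq_zero]
    · intro q _; rw [single_apply_ne_right _ _ hb, mul_zero]
    · intro q _; rw [single_apply_ne_right _ _ hb, zero_mul]
  by_cases ha : a' = a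
  swap
  · rw [Finset.sum_eq_zero, Finset.sum_eq_zero]
    · intro q _; rw [single_apply_ne_left _ _ ha, mul_zero]
    · intro q _; rw [single_apply_ne_left _ _ ha, zero_mul]
  subst ha hb
  simp [single_apply]

end

end GroupoidQuantization

open GroupoidQuantization

/-! The only substantial point is that Q(P) ⊗ Q(S) and Q(S ∘ P) are the same Hilbert bimodule;
everything else is then checked on basis elements. The tool is `gramIso`: two spanning families h, k
of Hilbert bimodules with the same Gram matrices ⟨h_i, x.h_j⟩ = ⟨k_i, x.k_j⟩, for every x in the
algebra acting on the left, are carried into each other by a unitary intertwiner. Definiteness of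
the inner products makes this map well defined and injective, so neither family has to be
independent. That suits the present case, where (p.f, s) ∼ (p, f.s) makes both the tensors p ⊗ s and
the classes [p, s] redundant.

The Gram matrices are compared in `inner_cls`. The tensor side is ⟨s, ⟨p, p'⟩.s'⟩. It is nonzero
only if p' = p.g and g.s' = s.k for some g and k, and then it equals k. In that case [p', s'] =
[p.g, s'] = [p, g.s'] = [p, s.k] = [p, s].k, so the inner product of the classes is k as well.
Conversely, [p', s'] = [p, s].k means that some g satisfies p' = p.g and g.s' = s.k. Freeness of the
right actions makes g and k unique. Linearity in x extends the comparison to all left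
multiplications (`inner_lact_cls`). Tensors of non-composable elements vanish (`tmul_ket_of_ne`), so
the composable pairs can index both families.

Naturality of the unitary in protransformations (`quantize_hcomp`) explains the formula for
horizontal composition. By freeness, the sum over f : b → b' runs exactly once over the
representatives (v, w) of a class with middle object b (`hcomp_eq_sum_fiber`), and these index
exactly the terms of Q(σ)(p) ⊗ Q(τ)(s) that are mapped to this class.

On 2-morphisms, vertical composition is matrix multiplication. The matrix entries are natural
numbers, hence fixed by conjugation, and they are invariant under the actions; therefore the adjoint
is given by the transposed matrix, which is the dagger (`quantize_dagger`). The coherence 2-cells of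
`GAf` are graphs of functions, which Q turns into these functions on basis elements
(`quantize_graph_ket`). Each coherence axiom thus compares two images of one basis tensor, and both
are [p, [s, t]], f.p or p.g respectively. The statement about R is formal: dagger pseudofunctors are
closed under composition. -/

namespace GroupoidQuantization

noncomputable section

/-! ### Bases of the groupoid algebra and of the spaces ℂP -/

namespace ProfunctorSpace

open GroupoidAlgebra FreeProfunctor

variable {A B C : Type u} [FiniteGroupoid A] [FiniteGroupoid B] [FiniteGroupoid C]

lemma sum_apply {P : FreeProfunctor A B} {ι : Type*} (s : Finset ι) (ξ : ι → ProfunctorSpace P)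
    {a : A} {b : B} (p : P.obj a b) : (∑ i ∈ s, ξ i) a b p = ∑ i ∈ s, ξ i a b p := by
  have h : (∑ i ∈ s, ξ i) a = ∑ i ∈ s, ξ i a := Finset.sum_apply a s ξ
  rw [h, Finset.sum_apply, Finset.sum_apply]

lemma eq_sum_single {P : FreeProfunctor A B} (ξ : ProfunctorSpace P) :
    ξ = ∑ i : Σ (a : A) (b : B), P.obj a b, ξ i.1 i.2.1 i.2.2 • single i.2.2 := by
  classical
  ext a b p
  rw [sum_apply, Finset.sum_eq_single ⟨a, b, p⟩]
  · rw [smul_apply, single_apply, if_pos rfl, mul_one]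
  · rintro ⟨a', b', q⟩ _ h
    rw [smul_apply, single, if_neg (Ne.symm h), mul_zero]
  · simp

/-- Combined with `ext_span`, this reduces an identity between intertwiners out of Q(P) to basis
elements. For the identity profunctor it says that the morphisms span ℂA. -/
lemma span_single (P : FreeProfunctor A B) :
    Submodule.span ℂ (Set.range fun i : Σ (a : A) (b : B), P.obj a b =>
      (single i.2.2 : ProfunctorSpace P)) = ⊤ := by
  rw [eq_top_iff]
  rintro ξ -
  rw [eq_sum_single ξ]
  exact sum_mem fun i _ => Submodule.smul_mem _ _ (Submodule.subset_span ⟨i, rfl⟩)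

/-- Linear maps out of the groupoid algebra agree if they agree on morphisms. -/
lemma gext {M : Type*} [AddCommGroup M] [Module ℂ M] {S T : GroupoidAlgebra A →ₗ[ℂ] M}
    (h : ∀ (a b : A) (f : b ⟶ a), S (GroupoidAlgebra.single f) = T (GroupoidAlgebra.single f)) :
    S = T :=
  -- As a vector space, ℂA is the space of the identity profunctor, and the basis elements coincide.
  LinearMap.ext_on_range (span_single (FreeProfunctor.id A)) fun i => h i.1 i.2.1 i.2.2

/-- `f.p = 0` if the action is not defined. -/
lemma lact_single_of_ne {P : FreeProfunctor A B} {a a' a'' : A} {b : B} (f : a ⟶ a')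
    (p : P.obj a'' b) (h : a'' ≠ a) : lact (GroupoidAlgebra.single f) (single p) = 0 := by
  ext a₁ b₁ q
  rw [lact_apply]
  refine Finset.sum_eq_zero fun d _ => Finset.sum_eq_zero fun k _ => ?_
  -- The term of k : d ⟶ a₁ is the coefficient of f at k times the coefficient of p at k⁻¹.q. The
  -- first needs d = a, the second d = a''.
  by_cases hd : d = a
  · rw [single_apply_ne_left p _ (fun e => h (e.symm.trans hd)), mul_zero]
  · rw [gsingle_apply_ne_right f _ hd, zero_mul]

lemma zero_lact {P : FreeProfunctor A B} (ξ : ProfunctorSpace P) : lact 0 ξ = 0 := by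
  ext; simp [lact_apply]

lemma inner_zero_right {P : FreeProfunctor A B} (ξ : ProfunctorSpace P) : inner ξ 0 = 0 := by
  ext; simp [inner_apply]

/-- The inner product of the identity profunctor is `⟨x, y⟩ = x* y`. -/
lemma inner_id (ξ η : ProfunctorSpace (FreeProfunctor.id A)) :
    inner ξ η = (HMul.hMul (α := GroupoidAlgebra A) (β := GroupoidAlgebra A)
      (γ := GroupoidAlgebra A) (star (R := GroupoidAlgebra A) ξ) η) := by
  ext b b' g
  refine Eq.trans ?_ (mul_apply (A := A) _ _ g).symm
  refine Finset.sum_congr rfl fun a _ => ?_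
  -- The product of star ξ and η sums over morphisms a ⟶ b, the inner product over elements b ⟶ a.
  -- Passing to inverses aligns the two, and leaves only double inverses to be removed.
  rw [← sum_inv]
  refine Finset.sum_congr rfl fun f _ => ?_
  have h : ∀ k : b ⟶ a, (starRingEnd ℂ) (ξ a b k) * η a b' (g ≫ k) =
      (starRingEnd ℂ) (ξ a b (Groupoid.inv (Groupoid.inv k))) *
        η a b' (g ≫ Groupoid.inv (Groupoid.inv k)) := fun k => by
    rw [show Groupoid.inv (Groupoid.inv k) = k by simp]
  exact (congrArg (fun k => (starRingEnd ℂ) (ξ a b f) * η a b' k) (toHom_r g f)).trans (h f)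

/-! ### Equality of the Gram matrices of the tensors p ⊗ s and the classes [p, s] -/

variable (P : FreeProfunctor A B) (S : FreeProfunctor B C)

/-- The left side is the inner product of p ⊗ s and p' ⊗ s'. Either p' = p.g, and moving g across
the class reduces the claim to s and g.s' over the same p; or p' is not in the orbit of p, and then
[p', s'] is not in the orbit of [p, s] either, so both sides vanish. -/
lemma inner_cls {a a' : A} {b b' : B} {c c' : C} (p : P.obj a b) (s : S.obj b c)
    (p' : P.obj a' b') (s' : S.obj b' c') :
    inner (single s) (lact (inner (single p) (single p')) (single s')) =
      inner (single (cls P S p s)) (single (cls P S p' s')) := by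
  by_cases h : ∃ g : b' ⟶ b, (⟨a, P.r p g⟩ : Σ a, P.obj a b') = ⟨a', p'⟩
  · obtain ⟨g, h⟩ := h
    cases h
    rw [inner_single, lact_single, cls_r]
    -- Only t = g.s' matters from here on: ⟨s, t⟩ is to be compared with ⟨[p, s], [p, t]⟩.
    generalize S.l g s' = t
    by_cases h : ∃ k : c' ⟶ c, S.r s k = t
    · obtain ⟨k, rfl⟩ := h
      rw [inner_single, ← comp_r, inner_single]
    · rw [inner_single_of_ne, inner_single_of_ne]
      · rintro ⟨k, e⟩
        rw [comp_r] at e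
        obtain ⟨f, h₁, h₂⟩ := (cls_eq_cls_iff P S).1 (eq_of_heq (Sigma.mk.inj e).2)
        -- The morphism f that witnesses [p, s.k] = [p, t] fixes p from the right, so freeness makes
        -- it an identity. Hence t ↦ [p, t] is injective, and t would lie in the orbit of s.
        have : f = 𝟙 b := P.right_free f (𝟙 b) p (h₁.symm.trans (P.r_id p).symm)
        subst this
        rw [S.l_id] at h₂
        exact h ⟨k, h₂⟩
      · rintro ⟨k, e⟩
        exact h ⟨k, eq_of_heq (Sigma.mk.inj e).2⟩
  · rw [inner_single_of_ne _ _ h, zero_lact, inner_zero_right, inner_single_of_ne]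
    rintro ⟨k, e⟩
    rw [comp_r] at e
    obtain ⟨rfl, e⟩ := Sigma.mk.inj e
    -- The equality is read from [p', s'] to [p, s.k], so that its witness f : b' ⟶ b exhibits p' as
    -- p.f, contrary to `h`.
    obtain ⟨f, h₁, h₂⟩ := (cls_eq_cls_iff P S).1 (eq_of_heq e).symm
    exact h ⟨f, by rw [h₁]⟩

/-- `gramIso` needs the Gram matrices with every x inserted, since this makes the resulting map
commute with the left action. Both sides are linear in x, so x may be taken to be a morphism f.
Either f.p' is defined, and f.[p', s'] = [f.p', s'] reduces to `inner_cls`, or f annihilates both p'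
and [p', s']. -/
lemma inner_lact_cls (x : GroupoidAlgebra A) {a a' : A} {b b' : B} {c c' : C} (p : P.obj a b)
    (s : S.obj b c) (p' : P.obj a' b') (s' : S.obj b' c') :
    inner (single s) (lact (inner (single p) (lact x (single p'))) (single s')) =
      inner (single (cls P S p s)) (lact x (single (cls P S p' s'))) := by
  -- The two sides as linear functions of x. The flipped left action, applied to a vector, is the
  -- map x ↦ x.v; the inner product enters linearly because x stands in its second variable.
  let L : GroupoidAlgebra A →ₗ[ℂ] GroupoidAlgebra C :=
    S.quantize.innerₛₗ (single s) ∘ₗ S.quantize.left.toLinearMap.flip (single s') ∘ₗ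
      P.quantize.innerₛₗ (single p) ∘ₗ P.quantize.left.toLinearMap.flip (single p')
  let R : GroupoidAlgebra A →ₗ[ℂ] GroupoidAlgebra C :=
    (P.comp S).quantize.innerₛₗ (single (cls P S p s)) ∘ₗ
      (P.comp S).quantize.left.toLinearMap.flip (single (cls P S p' s'))
  have h : L = R := by
    refine gext fun a₁ a₂ f => ?_
    change inner (single s) (lact (inner (single p) (lact (GroupoidAlgebra.single f) (single p')))
      (single s')) = inner (single (cls P S p s))
        (lact (GroupoidAlgebra.single f) (single (cls P S p' s')))
    by_cases hf : a' = a₂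
    · subst hf
      rw [lact_single, lact_single, comp_l, inner_cls]
    · rw [lact_single_of_ne _ _ hf, lact_single_of_ne _ _ hf, inner_zero_right, inner_zero_right,
        zero_lact, inner_zero_right]
  exact LinearMap.congr_fun h x

end ProfunctorSpace

/-! ### The coherence unitaries -/

namespace FreeProfunctor

open ProfunctorSpace HilbertBimodule

variable {A B C D : Type u} [FiniteGroupoid A] [FiniteGroupoid B] [FiniteGroupoid C]
  [FiniteGroupoid D]

/-- The basis element `p` of the Hilbert bimodule `Q(P)`. -/
def ket (P : FreeProfunctor A B) {a : A} {b : B} (p : P.obj a b) : P.quantize.carrier :=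
  single p

lemma span_ket (P : FreeProfunctor A B) :
    Submodule.span ℂ (Set.range fun i : Σ (a : A) (b : B), P.obj a b => P.ket i.2.2) = ⊤ :=
  span_single P

lemma left_ket (P : FreeProfunctor A B) {a a' : A} {b : B} (f : a ⟶ a') (p : P.obj a b) :
    P.quantize.left (GroupoidAlgebra.single f) (P.ket p) = P.ket (P.l f p) :=
  lact_single f p

lemma r_ket (P : FreeProfunctor A B) {a : A} {b b' : B} (g : b' ⟶ b) (p : P.obj a b) :
    P.quantize.r (P.ket p) (GroupoidAlgebra.single g) = P.ket (P.r p g) :=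
  ract_single g p

/-- The pairs `(p, s)` with `p ∈ P_{b,a}` and `s ∈ S_{c,b}`. -/
abbrev Composable (P : FreeProfunctor A B) (S : FreeProfunctor B C) : Type u :=
  Σ (b : B), (Σ a, P.obj a b) × (Σ c, S.obj b c)

variable (P : FreeProfunctor A B) (S : FreeProfunctor B C)

/-- The identity of b can be inserted: p ⊗ s = p.1_b ⊗ s = p ⊗ 1_b.s, and 1_b acts as zero on s,
which lives over b' ≠ b. -/
lemma tmul_ket_of_ne {a : A} {b b' : B} {c : C} (p : P.obj a b) (s : S.obj b' c)
    (h : b' ≠ b) : tmul P.quantize S.quantize (P.ket p) (S.ket s) = 0 := by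
  have h1 : S.quantize.left (GroupoidAlgebra.single (𝟙 b)) (S.ket s) = 0 :=
    lact_single_of_ne _ _ h
  rw [← P.r_id p, ← r_ket, tmul_r, h1]
  exact (tmulₗ P.quantize S.quantize (P.ket p)).map_zero

/-- Restricting to composable pairs discards only zero vectors. It is necessary because one index
set has to serve both families of `gramIso`, and [p, s] makes sense for composable pairs only. -/
lemma span_tmul_ket :
    Submodule.span ℂ (Set.range fun i : Composable P S =>
      tmul P.quantize S.quantize (P.ket i.2.1.2) (S.ket i.2.2.2)) = ⊤ := by
  have h := HilbertBimodule.span_tmul' (E := P.quantize) (F := S.quantize) (span_ket P)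
    (span_ket S)
  rw [eq_top_iff, ← h, Submodule.span_le]
  rintro _ ⟨⟨⟨a, b, p⟩, ⟨b', c, s⟩⟩, rfl⟩
  by_cases hb : b' = b
  · subst hb
    exact Submodule.subset_span ⟨⟨b', ⟨a, p⟩, ⟨c, s⟩⟩, rfl⟩
  · change tmul P.quantize S.quantize (P.ket p) (S.ket s) ∈ _
    rw [tmul_ket_of_ne P S p s hb]
    exact zero_mem _

/-- Each basis element of Q(S ∘ P) occurs in this family once for every representative of the class.
Such repetitions are harmless for `gramIso`, which asks for spanning families and not for bases. -/
lemma span_ket_cls :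
    Submodule.span ℂ (Set.range fun i : Composable P S =>
      (P.comp S).ket (cls P S i.2.1.2 i.2.2.2)) = ⊤ := by
  rw [← span_ket (P.comp S)]
  congr 1
  ext x
  constructor
  · rintro ⟨i, rfl⟩
    exact ⟨⟨_, _, cls P S i.2.1.2 i.2.2.2⟩, rfl⟩
  · rintro ⟨⟨a, c, y⟩, rfl⟩
    induction y using comp_ind with
    | h b p s => exact ⟨⟨b, ⟨a, p⟩, ⟨c, s⟩⟩, rfl⟩

/-- The unitary `Q(P) ⊗ Q(S) ≅ Q(S ∘ P)`, `p ⊗ s ↦ [p, s]`. -/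
def quantizeComp : P.quantize.comp S.quantize ≅ (P.comp S).quantize :=
  gramIso (fun i : Composable P S => tmul P.quantize S.quantize (P.ket i.2.1.2) (S.ket i.2.2.2))
    (fun i => (P.comp S).ket (cls P S i.2.1.2 i.2.2.2)) (span_tmul_ket P S) (span_ket_cls P S)
    fun x i j => inner_lact_cls P S x i.2.1.2 i.2.2.2 j.2.1.2 j.2.2.2

/-- Since the composable tensors span, this formula characterizes the unitary. Apart from
invertibility and `quantizeComp_dagger`, nothing else about it enters the coherence proofs. -/
lemma quantizeComp_hom {a : A} {b : B} {c : C} (p : P.obj a b) (s : S.obj b c) :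
    (quantizeComp P S).hom.toLin (tmul P.quantize S.quantize (P.ket p) (S.ket s)) =
      (P.comp S).ket (cls P S p s) :=
  gramIso_hom _ _ _ (⟨b, ⟨a, p⟩, ⟨c, s⟩⟩ : Composable P S)

lemma quantizeComp_dagger : (quantizeComp P S).hom.dagger = (quantizeComp P S).inv := by
  unfold quantizeComp
  exact gramIso_dagger ..

/-- The unitary `Q(id) ≅ ℂA`, `f ↦ f`. -/
def quantizeId (A : Type u) [FiniteGroupoid A] :
    (FreeProfunctor.id A).quantize ≅ HilbertBimodule.id (GroupoidAlgebra A) :=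
  gramIso (E := (FreeProfunctor.id A).quantize) (F := HilbertBimodule.id (GroupoidAlgebra A))
    -- The underlying vector spaces agree, so all vectors can serve as the spanning family. The Gram
    -- condition becomes ⟨ξ, x.η⟩ = ξ* (x η), the left action being multiplication.
    (fun ξ => ξ) (fun ξ => toId (A := GroupoidAlgebra A) ξ)
    (HilbertBimodule.span_id _) (HilbertBimodule.span_id _)
    fun x ξ η => (ProfunctorSpace.inner_id ξ (lact x η)).trans
      (congrArg (HMul.hMul (star (R := GroupoidAlgebra A) ξ)) (lact_id x η))

lemma quantizeId_hom (ξ : (FreeProfunctor.id A).quantize.carrier) :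
    (quantizeId A).hom.toLin ξ = toId (A := GroupoidAlgebra A) ξ :=
  gramIso_hom (E := (FreeProfunctor.id A).quantize)
    (F := HilbertBimodule.id (GroupoidAlgebra A)) _ _ _ ξ

lemma quantizeId_dagger : (quantizeId A).hom.dagger = (quantizeId A).inv := by
  unfold quantizeId
  exact gramIso_dagger ..

end FreeProfunctor

/-! ### Functoriality on 2-morphisms, daggers, naturality and coherence -/

namespace Protransformation

open ProfunctorSpace HilbertBimodule FreeProfunctor

variable {A B C D : Type u} [FiniteGroupoid A] [FiniteGroupoid B] [FiniteGroupoid C]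
  [FiniteGroupoid D]

lemma quantize_ket {P R : FreeProfunctor A B} (σ : Protransformation P R) {a : A} {b : B}
    (p : P.obj a b) : σ.quantize.toLin (P.ket p) =
      ∑ q : R.obj a b, (σ.toFun p q : ℂ) • R.ket q :=
  quantize_single σ p

/-- The row of p in the matrix of a graph has a single entry 1, at φ(p). Identities, associators and
unitors of `GAf` are all graphs, so on basis elements Q replaces them by their underlying functions.
-/
lemma quantize_graph_ket {P R : FreeProfunctor A B} (φ : NatHom P R) {a : A} {b : B}
    (p : P.obj a b) : (graph φ).quantize.toLin (P.ket p) = R.ket (φ.app p) := by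
  classical
  rw [quantize_ket, Finset.sum_eq_single (φ.app p)]
  · rw [graph_apply, if_pos rfl, Nat.cast_one, one_smul]
  · intro q _ h
    rw [graph_apply, if_neg (Ne.symm h), Nat.cast_zero, zero_smul]
  · simp

lemma quantize_id (P : FreeProfunctor A B) : (id P).quantize = Intertwiner.id P.quantize :=
  ext_span (span_ket P) fun i => quantize_graph_ket _ i.2.2

/-- Vertical composition is matrix multiplication, and Q(σ) is the linear map with matrix σ.
Expanding both sides at p leaves the same double sum in two orders. -/
lemma quantize_vcomp {P Q R : FreeProfunctor A B} (σ : Protransformation P Q)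
    (τ : Protransformation Q R) :
    (vcomp σ τ).quantize = Intertwiner.vcomp σ.quantize τ.quantize := by
  refine ext_span (span_ket P) fun ⟨a, b, p⟩ => ?_
  change (vcomp σ τ).quantize.toLin (P.ket p) = τ.quantize.toLin (σ.quantize.toLin (P.ket p))
  simp only [quantize_ket, map_sum, map_smul, vcomp, Nat.cast_sum, Nat.cast_mul, Finset.sum_smul,
    Finset.smul_sum, smul_smul]
  exact Finset.sum_comm

/-- Conjugation fixes natural numbers, so the adjoint has the transposed matrix. The coefficient of
the inner product at g pairs p with translates by g; invariance of σ under the right action is what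
makes the transposition compatible with these translates. -/
lemma inner_quantizeFun {P R : FreeProfunctor A B} (σ : Protransformation P R)
    (ξ : ProfunctorSpace P) (η : ProfunctorSpace R) :
    ProfunctorSpace.inner (σ.quantizeFun ξ) η =
      ProfunctorSpace.inner ξ (σ.dagger.quantizeFun η) := by
  ext b b' g
  simp only [inner_apply, quantizeFun_apply, map_sum, map_mul, Complex.conj_natCast,
    Finset.sum_mul, Finset.mul_sum]
  refine Finset.sum_congr rfl fun a _ => ?_
  rw [Finset.sum_comm]
  refine Finset.sum_congr rfl fun p _ => ?_
  -- On the right the sum runs over R_{b',a}. Writing its elements as r.g with r in R_{b,a} turns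
  -- the matrix entry into σ(p.g, r.g) = σ(p, r).
  rw [← sum_r R g]
  refine Finset.sum_congr rfl fun r _ => ?_
  have : σ.dagger.toFun (R.r r g) (P.r p g) = σ.toFun p r := σ.r_r g p r
  rw [this]
  ring

lemma quantize_dagger {P R : FreeProfunctor A B} (σ : Protransformation P R) :
    σ.dagger.quantize = σ.quantize.dagger :=
  (Intertwiner.dagger_unique fun ξ η => inner_quantizeFun σ ξ η).symm

/-- This is naturality of p ⊗ s ↦ [p, s] in both variables at once; the two whiskering axioms are
the cases in which one of the 2-morphisms is an identity. It holds because the coefficient of a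
class y in the horizontal composite is the sum of σ(p, v) τ(s, w) over its representatives (v, w)
with middle object b. -/
lemma quantize_hcomp {P P' : FreeProfunctor A B} {S S' : FreeProfunctor B C}
    (σ : Protransformation P P') (τ : Protransformation S S') :
    Intertwiner.vcomp (quantizeComp P S).hom (hcomp σ τ).quantize =
      Intertwiner.vcomp (Intertwiner.hcomp σ.quantize τ.quantize) (quantizeComp P' S').hom := by
  classical
  refine ext_span (span_tmul_ket P S) fun ⟨b, ⟨a, p⟩, ⟨c, s⟩⟩ => ?_
  change (hcomp σ τ).quantize.toLin ((quantizeComp P S).hom.toLin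
      (tmul P.quantize S.quantize (P.ket p) (S.ket s))) = (quantizeComp P' S').hom.toLin
    (tmul P'.quantize S'.quantize (σ.quantize.toLin (P.ket p)) (τ.quantize.toLin (S.ket s)))
  -- Protransformations relate only elements over the same pair of objects. Hence every term of the
  -- bilinear expansion has the middle object b of p and s, and is again a composable pair.
  have hR : tmul P'.quantize S'.quantize (σ.quantize.toLin (P.ket p))
      (τ.quantize.toLin (S.ket s)) = ∑ w : P'.obj a b × S'.obj b c,
        ((σ.toFun p w.1 * τ.toFun s w.2 : ℕ) : ℂ) •
          tmul P'.quantize S'.quantize (P'.ket w.1) (S'.ket w.2) := by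
    rw [quantize_ket, quantize_ket, Fintype.sum_prod_type]
    simp only [← tmulₗ_apply, map_sum, map_smul, LinearMap.sum_apply, LinearMap.smul_apply,
      smul_smul, Nat.cast_mul, Finset.smul_sum]
    rw [Finset.sum_comm]
    simp only [mul_comm]
  rw [hR, map_sum, quantizeComp_hom, quantize_ket]
  simp only [map_smul, quantizeComp_hom, hcomp_eq_sum_fiber, Nat.cast_sum, Finset.sum_smul]
  -- After the exchange the outer sum runs over pairs w, and in the inner sum over classes y only y
  -- = [w.1, w.2] contributes.
  rw [Finset.sum_comm]
  refine Finset.sum_congr rfl fun w _ => ?_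
  rw [Finset.sum_eq_single (cls P' S' w.1 w.2)]
  · rw [if_pos rfl]
  · intro y _ hy
    rw [if_neg (Ne.symm hy), Nat.cast_zero, zero_smul]
  · simp

/-- The linear span of the `(p ⊗ s) ⊗ t` with composable `(p, s)` is everything. -/
lemma span_tmul_tmul_ket (P : FreeProfunctor A B) (S : FreeProfunctor B C)
    (T : FreeProfunctor C D) :
    Submodule.span ℂ (Set.range fun i : Σ c : C, (Σ b : B, (Σ a, P.obj a b) × S.obj b c) ×
        Σ d : D, T.obj c d =>
      tmul (P.quantize.comp S.quantize) T.quantize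
        (tmul P.quantize S.quantize (P.ket i.2.1.2.1.2) (S.ket i.2.1.2.2)) (T.ket i.2.2.2)) = ⊤ := by
  rw [eq_top_iff, ← span_tmul' (span_tmul_ket P S) (span_ket T), Submodule.span_le]
  rintro _ ⟨⟨⟨b, ⟨a, p⟩, ⟨c, s⟩⟩, ⟨c', d, t⟩⟩, rfl⟩
  change tmul _ _ (tmul P.quantize S.quantize (P.ket p) (S.ket s)) (T.ket t) ∈ _
  by_cases hc : c' = c
  · subst hc
    exact Submodule.subset_span ⟨⟨c', ⟨b, ⟨a, p⟩, s⟩, ⟨d, t⟩⟩, rfl⟩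
  -- The left factor is a tensor and not a basis element, so `tmul_ket_of_ne` does not apply. The
  -- same insertion works: the identity of c fixes p ⊗ s because it acts on it through s, and it
  -- annihilates t.
  · have h1 : T.quantize.left (GroupoidAlgebra.single (𝟙 c)) (T.ket t) = 0 :=
      lact_single_of_ne _ _ hc
    have h2 : tmul P.quantize S.quantize (P.ket p) (S.ket s) =
        (P.quantize.comp S.quantize).r (tmul P.quantize S.quantize (P.ket p) (S.ket s))
          (GroupoidAlgebra.single (𝟙 c)) := by
      refine Eq.trans ?_ (right_tmul _ _ _).symm
      refine congrArg (tmul P.quantize S.quantize (P.ket p)) ?_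
      exact ((S.r_ket (𝟙 c) s).trans (by rw [S.r_id])).symm
    rw [h2, tmul_r, h1]
    have h3 := (tmulₗ (P.quantize.comp S.quantize) T.quantize
      (tmul P.quantize S.quantize (P.ket p) (S.ket s))).map_zero
    rw [tmulₗ_apply] at h3
    rw [h3]
    exact zero_mem _

/-- Both composites send (p ⊗ s) ⊗ t to [p, [s, t]]. The unitaries appear in the direction p ⊗ s ↦
[p, s] throughout, since only there are they given by a formula on generators. -/
lemma quantize_assoc (P : FreeProfunctor A B) (S : FreeProfunctor B C) (T : FreeProfunctor C D) :
    Intertwiner.vcomp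
      (Intertwiner.hcomp (quantizeComp P S).hom (Intertwiner.id T.quantize))
      (Intertwiner.vcomp (quantizeComp (P.comp S) T).hom (graph (assocHom P S T)).quantize) =
    Intertwiner.vcomp (HilbertBimodule.assoc P.quantize S.quantize T.quantize).hom
      (Intertwiner.vcomp
        (Intertwiner.hcomp (Intertwiner.id P.quantize) (quantizeComp S T).hom)
        (quantizeComp P (S.comp T)).hom) := by
  refine ext_span (span_tmul_tmul_ket P S T) fun ⟨c, ⟨b, ⟨a, p⟩, s⟩, ⟨d, t⟩⟩ => ?_
  change (graph (assocHom P S T)).quantize.toLin ((quantizeComp (P.comp S) T).hom.toLin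
      (tmul _ _ ((quantizeComp P S).hom.toLin (tmul _ _ (P.ket p) (S.ket s))) (T.ket t))) =
    (quantizeComp P (S.comp T)).hom.toLin
      ((Intertwiner.hcomp (Intertwiner.id P.quantize) (quantizeComp S T).hom).toLin
        ((HilbertBimodule.assoc P.quantize S.quantize T.quantize).hom.toLin
          (tmul _ _ (tmul _ _ (P.ket p) (S.ket s)) (T.ket t))))
  rw [assoc_hom, Intertwiner.hcomp_tmul, quantizeComp_hom, quantizeComp_hom, quantizeComp_hom,
    quantize_graph_ket]
  exact (quantizeComp_hom P (S.comp T) p (cls S T s t)).symm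

/-- Both composites send f ⊗ p to f.p: once through the class [f, p] and the graph of the action,
once through the action of f as an element of ℂA. -/
lemma quantize_leftUnitor (P : FreeProfunctor A B) :
    Intertwiner.vcomp (quantizeComp (FreeProfunctor.id A) P).hom
      (graph (leftUnitHom P)).quantize =
    Intertwiner.vcomp (Intertwiner.hcomp (quantizeId A).hom (Intertwiner.id P.quantize))
      (HilbertBimodule.leftUnitor P.quantize).hom := by
  refine ext_span (span_tmul_ket _ P) fun ⟨a', ⟨a, f⟩, ⟨b, p⟩⟩ => ?_
  change (graph (leftUnitHom P)).quantize.toLin ((quantizeComp (FreeProfunctor.id A) P).hom.toLin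
      (tmul _ _ ((FreeProfunctor.id A).ket f) (P.ket p))) =
    (HilbertBimodule.leftUnitor P.quantize).hom.toLin
      (tmul _ _ ((quantizeId A).hom.toLin ((FreeProfunctor.id A).ket f)) (P.ket p))
  rw [quantizeComp_hom, quantize_graph_ket, leftUnitor_hom, quantizeId_hom]
  exact (P.left_ket (toHom f) p).symm

/-- Here p ⊗ f goes to p.f on both sides, by the mirror image of the argument for the left unitor.
-/
lemma quantize_rightUnitor (P : FreeProfunctor A B) :
    Intertwiner.vcomp (quantizeComp P (FreeProfunctor.id B)).hom
      (graph (rightUnitHom P)).quantize =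
    Intertwiner.vcomp (Intertwiner.hcomp (Intertwiner.id P.quantize) (quantizeId B).hom)
      (HilbertBimodule.rightUnitor P.quantize).hom := by
  refine ext_span (span_tmul_ket P _) fun ⟨b', ⟨a, p⟩, ⟨b, f⟩⟩ => ?_
  change (graph (rightUnitHom P)).quantize.toLin ((quantizeComp P (FreeProfunctor.id B)).hom.toLin
      (tmul _ _ (P.ket p) ((FreeProfunctor.id B).ket f))) =
    (HilbertBimodule.rightUnitor P.quantize).hom.toLin
      (tmul _ _ (P.ket p) ((quantizeId B).hom.toLin ((FreeProfunctor.id B).ket f)))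
  rw [quantizeComp_hom, quantize_graph_ket, rightUnitor_hom, quantizeId_hom]
  exact (P.r_ket (toHom f) p).symm

end Protransformation

/-! ### The dagger pseudofunctor and its composites -/

open Protransformation

/-- Quantization as a pseudofunctor. -/
def quantizationPseudofunctor : GAf.{u} ⥤ᵖ CStarAlg.{u} where
  toPrelaxFunctorStruct := quantization
  map₂_id P := quantize_id P
  map₂_comp σ τ := quantize_vcomp σ τ
  mapId A := FreeProfunctor.quantizeId A.carrier
  -- The structure isomorphism of a pseudofunctor points from Q(S ∘ P) to the tensor product, hence
  -- the inverse. In each axiom below `Iso.eq_inv_comp` moves this inverse to the other side, where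
  -- it becomes the unitary p ⊗ s ↦ [p, s].
  mapComp P S := (FreeProfunctor.quantizeComp P S).symm
  map₂_whisker_left {A B C} P S S' τ := by
    refine (Iso.eq_inv_comp (FreeProfunctor.quantizeComp P S)).2 ?_
    -- Whiskering is horizontal composition with an identity in both bicategories, and Q preserves
    -- identities.
    have h := quantize_hcomp (Protransformation.id P) τ
    rw [quantize_id] at h
    exact h
  map₂_whisker_right {A B C} P P' σ S := by
    refine (Iso.eq_inv_comp (FreeProfunctor.quantizeComp P S)).2 ?_
    have h := quantize_hcomp σ (Protransformation.id S)
    rw [quantize_id] at h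
    exact h
  map₂_associator {A B C D} P S T := by
    refine (Iso.eq_inv_comp (FreeProfunctor.quantizeComp
      (FreeProfunctor.comp P S) T)).2 ?_
    -- The associativity axiom has a second inverse at the front, that of the unitary for P and S
    -- whiskered with Q(T). Once it is moved across as well, the claim is `quantize_assoc`.
    refine (Iso.eq_inv_comp (Bicategory.whiskerRightIso
      (show quantization.map P ≫ quantization.map S ≅ quantization.map (P ≫ S) from
        FreeProfunctor.quantizeComp P S) (quantization.map T))).2 ?_
    exact quantize_assoc P S T
  map₂_left_unitor {A B} P :=
    (Iso.eq_inv_comp (FreeProfunctor.quantizeComp (FreeProfunctor.id A.carrier) P)).2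
      (quantize_leftUnitor P)
  map₂_right_unitor {A B} P :=
    (Iso.eq_inv_comp (FreeProfunctor.quantizeComp P (FreeProfunctor.id B.carrier))).2
      (quantize_rightUnitor P)

lemma isDaggerPseudofunctor_quantization :
    IsDaggerPseudofunctor quantizationPseudofunctor.{u} where
  map_dagger σ := quantize_dagger σ
  dagger_mapId A := FreeProfunctor.quantizeId_dagger
  dagger_mapComp P S := by
    -- For the unitary u of P and S this reads u† = u⁻¹, whereas the structure isomorphism is u⁻¹.
    -- Taking daggers once more gives (u⁻¹)† = u.
    have h := FreeProfunctor.quantizeComp_dagger P S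
    have h' := congrArg Intertwiner.dagger h
    rw [Intertwiner.dagger_dagger] at h'
    exact h'.symm

/-- Dagger pseudofunctors compose. -/
lemma IsDaggerPseudofunctor.comp {K L M : Type*} [Bicategory K] [Bicategory L] [Bicategory M]
    [DaggerBicategory K] [DaggerBicategory L] [DaggerBicategory M] {F : K ⥤ᵖ L} {G : L ⥤ᵖ M}
    (hF : IsDaggerPseudofunctor F) (hG : IsDaggerPseudofunctor G) :
    IsDaggerPseudofunctor (F.comp G) where
  map_dagger σ := (congrArg G.map₂ (hF.map_dagger σ)).trans (hG.map_dagger _)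
  dagger_mapId a := by
    change DaggerBicategory.dagger (G.map₂ (F.mapId a).hom ≫ (G.mapId (F.obj a)).hom) =
      (G.mapId (F.obj a)).inv ≫ G.map₂ (F.mapId a).inv
    -- The coherence isomorphism of the composite is a product of one of G and the image of one of
    -- F. The first is unitary, the second is the image of a unitary under a dagger-preserving map,
    -- and the dagger reverses the product just as inversion does.
    rw [DaggerBicategory.dagger_comp, hG.dagger_mapId, ← hG.map_dagger, hF.dagger_mapId]
  dagger_mapComp f g := by
    change DaggerBicategory.dagger (G.map₂ (F.mapComp f g).hom ≫
        (G.mapComp (F.map f) (F.map g)).hom) =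
      (G.mapComp (F.map f) (F.map g)).inv ≫ G.map₂ (F.mapComp f g).inv
    rw [DaggerBicategory.dagger_comp, hG.dagger_mapComp, ← hG.map_dagger, hF.dagger_mapComp]

end

end GroupoidQuantization

/-- The isomorphisms μ and ι are typed over `quantization`, so that their formulas refer to the
given data and not to F. As F agrees with these data only through an equation, its coherence
isomorphisms are compared with μ and ι by heterogeneous equality. The formula for composites
concerns the inverse of μ because μ starts at Q(S ∘ P). -/
theorem mainTheorem3 :
    ∃ (F : GAf.{u} ⥤ᵖ CStarAlg.{u})
      (μ : ∀ {A B C : GAf.{u}} (P : A ⟶ B) (S : B ⟶ C),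
        quantization.map (P ≫ S) ≅ quantization.map P ≫ quantization.map S)
      (ι : ∀ A : GAf.{u}, quantization.map (𝟙 A) ≅ 𝟙 (quantization.obj A)),
      F.toPrelaxFunctorStruct = quantization ∧
      (∀ {A B C : GAf.{u}} (P : A ⟶ B) (S : B ⟶ C), HEq (F.mapComp P S) (μ P S)) ∧
      (∀ A : GAf.{u}, HEq (F.mapId A) (ι A)) ∧
      IsDaggerPseudofunctor F ∧
      (∀ {A B C : GAf.{u}} (P : FreeProfunctor A.carrier B.carrier)
        (S : FreeProfunctor B.carrier C.carrier)
        {a : A.carrier} {b : B.carrier} {c : C.carrier} (p : P.obj a b) (s : S.obj b c),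
        Intertwiner.toLin (μ (A := A) (B := B) (C := C) P S).inv
          (HilbertBimodule.tmul P.quantize S.quantize
            (ProfunctorSpace.single p) (ProfunctorSpace.single s)) =
          ProfunctorSpace.single (FreeProfunctor.cls P S p s)) ∧
      (∀ (A : GAf.{u}) {a b : A.carrier} (f : b ⟶ a),
        Intertwiner.toLin (ι A).hom (ProfunctorSpace.single (FreeProfunctor.ofHom f)) =
          GroupoidAlgebra.single f) ∧
      ∀ (K : Type*) [Bicategory K] [DaggerBicategory K] (R : CStarAlg.{u} ⥤ᵖ K),
        IsDaggerPseudofunctor R → IsDaggerPseudofunctor (F.comp R) := by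
  -- The pseudofunctor is built on `quantization` itself, so the equality of data and both
  -- heterogeneous equalities hold by definition.
  refine ⟨quantizationPseudofunctor, fun P S => (FreeProfunctor.quantizeComp P S).symm,
    fun A => FreeProfunctor.quantizeId A.carrier, rfl, fun _ _ => HEq.rfl, fun _ => HEq.rfl,
    isDaggerPseudofunctor_quantization, fun P S _ _ _ p s =>
      FreeProfunctor.quantizeComp_hom P S p s, fun A _ _ f =>
      FreeProfunctor.quantizeId_hom (ProfunctorSpace.single (FreeProfunctor.ofHom f)),
    fun K _ _ R hR => isDaggerPseudofunctor_quantization.comp hR⟩
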